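/- Let $\Omega\subset\mathbb R^2$ be a finite union of open axis-parallel rectangles, let $k\ge 1$ be an integer, $\alpha\ge 1$ and $\sigma$ real numbers. Let $\mathcal T_h$ denote a mesh of $\Omega$: a finite set of closed nondegenerate axis-parallel rectangles $T$ whose interiors lie in $\Omega$ and whose union is $\overline\Omega$, such that two different elements are disjoint or meet exactly in a common vertex or in a whole common edge, and such that each edge without its end points lies in $\Omega$, or the edge lies in $\partial\Omega$. Let $h_T$ be the diameter of $T$ and $h=\max_T h_T$; the mesh is shape-regular with constant $\sigma$ if $h_T$ is at most $\sigma$ times the shorter side of $T$, for all $T$. Let $Q_{i,j}$ be the polynomials of degree at most $i$ in $x$ and at most $j$ in $y$, $Q_k=Q_{k,k}$, let $P_k(e)$ be the polynomials of degree at most $k$ on an edge $e$, and $W_k=Q_{k-1,k}\times Q_{k,k-1}$. Let $V_h$ be the space of weak functions $v=\{v_0,v_b\}$ with $v_0|_T\in Q_k$ on each element $T$ and $v_b|_e\in P_k(e)$ on each edge $e$ ($v_b$ single-valued on each edge), and let $V_h^0$ be the subspace of those with $v_b=0$ on all edges in $\partial\Omega$. The discrete weak gradient $\nabla_w v$ is,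 on each $T$, the unique element of $W_k$ with $$(\nabla_w v,\mathbf q)_T=-(v_0,\nabla\cdot\mathbf q)_T+\langle v_b,\mathbf q\cdot\mathbf n\rangle_{\partial T}\qquad\text{for all }\mathbf q\in W_k,$$ where $\mathbf n$ is the outward unit normal. Put $$a_s(w,v)=\sum_{T}(\nabla_w w,\nabla_w v)_T+\sum_{T}h^{-\alpha}\langle w_0-w_b,v_0-v_b\rangle_{\partial T},\qquad |\!|\!|v|\!|\!|=a_s(v,v)^{1/2}.$$ For a continuous function $w$ on $\overline\Omega$ let $\mathcal I_h w$ be the piecewise $Q_k$ function that on each $T$ is the tensor-product Lagrange interpolant of $w$ at the $(k+1)^2$ images of the Lobatto points (the Lobatto points being $\pm1$ and the zeros of the derivative of the Legendre polynomial of degree $k$); it is continuous, and is regarded as the weak function $\{\mathcal I_hw,\ \mathcal I_hw|_e\}$. Then there is a constant $C>0$, depending only on $\Omega$, $k$, $\alpha$ and $\sigma$, such that the following holds. Let $f\in L^2(\Omega)$ and let $u\in H^{k+2}(\Omega)$ be the solution of $-\Delta u=f$ in $\Omega$, $u=0$ on $\partial\Omega$, that is, $u\in H^1_0(\Omega)$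 and $(\nabla u,\nabla v)=(f,v)$ for all $v\in H^1_0(\Omega)$. Then $u$ has a representative that is continuous on $\overline\Omega$, and with this representative, for every mesh $\mathcal T_h$ of $\Omega$ that is shape-regular with constant $\sigma$ and for the solution $u_h\in V_h^0$ of the weak Galerkin scheme $$a_s(u_h,v)=(f,v_0)\qquad\text{for all }v\in V_h^0,$$ one has $$|\!|\!|\mathcal I_h u-u_h|\!|\!|\le C\,h^{\min\{k+1,\;k+\frac{\alpha-1}{2}\}}\,\|u\|_{k+2},$$ where $\|\cdot\|_{k+2}$ is the norm of $H^{k+2}(\Omega)$. -/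

import Mathlib

open MeasureTheory Set
open scoped ContDiff Polynomial

noncomputable section

namespace WG

/-! ### Sobolev spaces on an open set of the plane -/

/-- Partial derivative in the first variable. -/
def dx (φ : ℝ × ℝ → ℝ) : ℝ × ℝ → ℝ := fun p => fderiv ℝ φ p (1, 0)

/-- Partial derivative in the second variable. -/
def dy (φ : ℝ × ℝ → ℝ) : ℝ × ℝ → ℝ := fun p => fderiv ℝ φ p (0, 1)

/-- Test functions: `φ ∈ C_c^∞(Ω)`. -/
def IsTestFunction (Ω : Set (ℝ × ℝ)) (φ : ℝ × ℝ → ℝ) : Prop :=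
  ContDiff ℝ ∞ φ ∧ HasCompactSupport φ ∧ tsupport φ ⊆ Ω

/-- `w` is an `L²(Ω)` weak derivative `∂_x^i ∂_y^j u`. -/
def IsWeakDeriv (Ω : Set (ℝ × ℝ)) (i j : ℕ) (u w : ℝ × ℝ → ℝ) : Prop :=
  MemLp w 2 (volume.restrict Ω) ∧
    ∀ φ, IsTestFunction Ω φ →
      ∫ p in Ω, u p * (dx^[i] (dy^[j] φ)) p = (-1) ^ (i + j) * ∫ p in Ω, w p * φ p

/-- `u ∈ H^m(Ω)`. -/
def MemH (Ω : Set (ℝ × ℝ)) (m : ℕ) (u : ℝ × ℝ → ℝ) : Prop :=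
  MemLp u 2 (volume.restrict Ω) ∧ ∀ i j : ℕ, i + j ≤ m → ∃ w, IsWeakDeriv Ω i j u w

open Classical in
/-- The weak derivative `∂_x^i ∂_y^j u` (unique up to null sets; `0` if there is none in `L²`). -/
def weakD (Ω : Set (ℝ × ℝ)) (i j : ℕ) (u : ℝ × ℝ → ℝ) : ℝ × ℝ → ℝ :=
  if h : ∃ w, IsWeakDeriv Ω i j u w then h.choose else 0

/-- The norm `‖u‖_m = (∑_{i+j≤m} ‖∂_x^i ∂_y^j u‖²_{L²(Ω)})^{1/2}` of `H^m(Ω)`. -/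
def sobolevNorm (Ω : Set (ℝ × ℝ)) (m : ℕ) (u : ℝ × ℝ → ℝ) : ℝ :=
  Real.sqrt (∑ i ∈ Finset.range (m + 1), ∑ j ∈ Finset.range (m + 1 - i),
    ∫ p in Ω, (weakD Ω i j u p) ^ 2)

/-- `u ∈ H^1_0(Ω)`, the closure of `C_c^∞(Ω)` in `H^1(Ω)`. -/
def MemH10 (Ω : Set (ℝ × ℝ)) (u : ℝ × ℝ → ℝ) : Prop :=
  MemH Ω 1 u ∧ ∀ ε > 0, ∃ φ, IsTestFunction Ω φ ∧ sobolevNorm Ω 1 (u - φ) < ε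

/-- `u` is the weak solution of `-Δu = f` in `Ω`, `u = 0` on `∂Ω`. -/
def IsWeakSolution (Ω : Set (ℝ × ℝ)) (f u : ℝ × ℝ → ℝ) : Prop :=
  MemH10 Ω u ∧ ∀ v, MemH10 Ω v →
    ∫ p in Ω, (weakD Ω 1 0 u p * weakD Ω 1 0 v p + weakD Ω 0 1 u p * weakD Ω 0 1 v p)
      = ∫ p in Ω, f p * v p

/-! ### Rectangles, edges and meshes -/

/-- A nondegenerate axis-parallel rectangle `[a,b] × [c,d]`. -/
structure Rect where
  a : ℝ
  b : ℝ
  c : ℝ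
  d : ℝ
  hab : a < b
  hcd : c < d

/-- An axis-parallel segment: `[a,b] × {y}` or `{x} × [c,d]`. -/
inductive Edge where
  | horiz (a b y : ℝ)
  | vert (x c d : ℝ)

namespace Edge

/-- Lower end of the range of the tangential coordinate. -/
def lo : Edge → ℝ
  | horiz a _ _ => a
  | vert _ c _ => c

/-- Upper end of the range of the tangential coordinate. -/
def hi : Edge → ℝ
  | horiz _ b _ => b
  | vert _ _ d => d

/-- The point of the edge's line with tangential coordinate `t`. -/
def point : Edge → ℝ → ℝ × ℝ
  | horiz _ _ y, t => (t, y)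
  | vert x _ _, t => (x, t)

/-- The closed segment. -/
def toSet (e : Edge) : Set (ℝ × ℝ) := e.point '' Icc e.lo e.hi

/-- The segment without its end points. -/
def openSet (e : Edge) : Set (ℝ × ℝ) := e.point '' Ioo e.lo e.hi

end Edge

namespace Rect

/-- The closed rectangle. -/
def toSet (T : Rect) : Set (ℝ × ℝ) := Icc T.a T.b ×ˢ Icc T.c T.d

/-- The open rectangle. -/
def openSet (T : Rect) : Set (ℝ × ℝ) := Ioo T.a T.b ×ˢ Ioo T.c T.d

/-- The (Euclidean) diameter `h_T`. -/
def diam (T : Rect) : ℝ := Real.sqrt ((T.b - T.a) ^ 2 + (T.d - T.c) ^ 2)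

/-- The four vertices. -/
def vertices (T : Rect) : Set (ℝ × ℝ) := {(T.a, T.c), (T.a, T.d), (T.b, T.c), (T.b, T.d)}

/-- The four edges: bottom, top, left, right. -/
def side (T : Rect) : Fin 4 → Edge :=
  ![Edge.horiz T.a T.b T.c, Edge.horiz T.a T.b T.d, Edge.vert T.a T.c T.d, Edge.vert T.b T.c T.d]

end Rect

/-- The outward unit normals on the bottom, top, left and right edge. -/
def normal : Fin 4 → ℝ × ℝ := ![(0, -1), (0, 1), (-1, 0), (1, 0)]

/-- `Ω` is a (nonempty, finite) union of open axis-parallel rectangles. -/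
def IsRectangularDomain (Ω : Set (ℝ × ℝ)) : Prop :=
  ∃ R : Finset Rect, R.Nonempty ∧ Ω = ⋃ T ∈ R, T.openSet

/-- `e` is an edge of the mesh. -/
def IsMeshEdge (𝒯 : Finset Rect) (e : Edge) : Prop := ∃ T ∈ 𝒯, ∃ i, e = T.side i

/-- `𝒯` is a conforming rectangular mesh of `Ω`: the elements cover the closure of `Ω`, their
interiors lie in `Ω`, two different elements meet in nothing, a common vertex or a whole common
edge, and every edge is either an interior edge or a boundary edge. -/
structure IsMesh (Ω : Set (ℝ × ℝ)) (𝒯 : Finset Rect) : Prop where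
  cover : ⋃ T ∈ 𝒯, T.toSet = closure Ω
  interior_subset : ∀ T ∈ 𝒯, T.openSet ⊆ Ω
  conforming : ∀ T ∈ 𝒯, ∀ T' ∈ 𝒯, T ≠ T' →
    T.toSet ∩ T'.toSet = ∅ ∨
    (∃ p ∈ T.vertices ∩ T'.vertices, T.toSet ∩ T'.toSet = {p}) ∨
    (∃ i j, T.side i = T'.side j ∧ T.toSet ∩ T'.toSet = (T.side i).toSet)
  edges : ∀ e, IsMeshEdge 𝒯 e → e.openSet ⊆ Ω ∨ e.toSet ⊆ frontier Ω

/-- The mesh size `h = max_T h_T`. -/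
def meshSize (𝒯 : Finset Rect) : ℝ := sSup (Rect.diam '' (𝒯 : Set Rect))

/-- Shape regularity with constant `σ`. -/
def ShapeRegular (σ : ℝ) (𝒯 : Finset Rect) : Prop :=
  ∀ T ∈ 𝒯, T.diam ≤ σ * min (T.b - T.a) (T.d - T.c)

/-! ### The weak Galerkin method -/

/-- `Q_{i,j}`: polynomials of degree at most `i` in `x` and at most `j` in `y`. -/
def Q (i j : ℕ) : Submodule ℝ (ℝ × ℝ → ℝ) :=
  Submodule.span ℝ {g | ∃ m n : ℕ, m ≤ i ∧ n ≤ j ∧ g = fun p => p.1 ^ m * p.2 ^ n}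

/-- `P_k`: polynomials in one variable of degree at most `k`. -/
def P (k : ℕ) : Submodule ℝ (ℝ → ℝ) :=
  Submodule.span ℝ {g | ∃ m : ℕ, m ≤ k ∧ g = fun t => t ^ m}

/-- Vector fields on the plane. -/
abbrev VField : Type := (ℝ × ℝ → ℝ) × (ℝ × ℝ → ℝ)

/-- `W_r = [Q_{r-1,r}, Q_{r,r-1}]`. -/
def W (r : ℕ) : Submodule ℝ VField := (Q (r - 1) r).prod (Q r (r - 1))

/-- Weak functions `v = {v_0, v_b}`: `v.1 T` is `v_0` on the element `T`, and `v.2 e` is `v_b` on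
the edge `e` as a function of the tangential coordinate (so `v_b` is single-valued on each edge). -/
abbrev WeakFunction : Type := (Rect → ℝ × ℝ → ℝ) × (Edge → ℝ → ℝ)

/-- The space `V_h`. -/
def Vh (𝒯 : Finset Rect) (k : ℕ) : Submodule ℝ WeakFunction where
  carrier := {v | (∀ T ∈ 𝒯, v.1 T ∈ Q k k) ∧ ∀ e, IsMeshEdge 𝒯 e → v.2 e ∈ P k}
  zero_mem' := ⟨fun _ _ => Submodule.zero_mem _, fun _ _ => Submodule.zero_mem _⟩
  add_mem' hv hw := ⟨fun T hT => Submodule.add_mem _ (hv.1 T hT) (hw.1 T hT),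
    fun e he => Submodule.add_mem _ (hv.2 e he) (hw.2 e he)⟩
  smul_mem' c _ hv := ⟨fun T hT => Submodule.smul_mem _ c (hv.1 T hT),
    fun e he => Submodule.smul_mem _ c (hv.2 e he)⟩

/-- The space `V_h^0` of those `v ∈ V_h` whose `v_b` vanishes on the edges in `∂Ω`. -/
def Vh0 (Ω : Set (ℝ × ℝ)) (𝒯 : Finset Rect) (k : ℕ) : Submodule ℝ WeakFunction :=
  Vh 𝒯 k ⊓
  { carrier := {v | ∀ e, IsMeshEdge 𝒯 e → e.toSet ⊆ frontier Ω → v.2 e = 0}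
    zero_mem' := fun _ _ _ => rfl
    add_mem' := fun {v w} hv hw e he hf => by
      change v.2 e + w.2 e = 0
      rw [hv e he hf, hw e he hf, add_zero]
    smul_mem' := fun c v hv e he hf => by
      change c • v.2 e = 0
      rw [hv e he hf, smul_zero] }

/-- `g ∈ W_k` is the discrete weak gradient of `v` on `T`:
`(g, q)_T = -(v_0, ∇·q)_T + ⟨v_b, q·n⟩_{∂T}` for all `q ∈ W_k`. -/
def IsDiscreteWeakGrad (k : ℕ) (T : Rect) (v : WeakFunction) (g : VField) : Prop :=
  g ∈ W k ∧ ∀ q ∈ W k,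
    ∫ p in T.toSet, (g.1 p * q.1 p + g.2 p * q.2 p) =
      -(∫ p in T.toSet, v.1 T p * (dx q.1 p + dy q.2 p)) +
      ∑ i, ∫ t in (T.side i).lo..(T.side i).hi, v.2 (T.side i) t *
        (q.1 ((T.side i).point t) * (normal i).1 + q.2 ((T.side i).point t) * (normal i).2)

open Classical in
/-- The discrete weak gradient `∇_w v` on `T`; it exists and is unique for `v ∈ V_h`. -/
def discreteWeakGrad (k : ℕ) (T : Rect) (v : WeakFunction) : VField :=
  if h : ∃ g, IsDiscreteWeakGrad k T v g then h.choose else 0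

/-- The stabilizer `s(w,v) = ∑_T h^{-α} ⟨w_0 - w_b, v_0 - v_b⟩_{∂T}`. -/
def stabilizer (𝒯 : Finset Rect) (α : ℝ) (w v : WeakFunction) : ℝ :=
  ∑ T ∈ 𝒯, meshSize 𝒯 ^ (-α) * ∑ i, ∫ t in (T.side i).lo..(T.side i).hi,
    (w.1 T ((T.side i).point t) - w.2 (T.side i) t) *
    (v.1 T ((T.side i).point t) - v.2 (T.side i) t)

/-- The bilinear form `a_s(w,v) = (∇_w w, ∇_w v)_h + s(w,v)`. -/
def aS (𝒯 : Finset Rect) (k : ℕ) (α : ℝ) (w v : WeakFunction) : ℝ :=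
  (∑ T ∈ 𝒯, ∫ p in T.toSet,
    ((discreteWeakGrad k T w).1 p * (discreteWeakGrad k T v).1 p +
     (discreteWeakGrad k T w).2 p * (discreteWeakGrad k T v).2 p)) + stabilizer 𝒯 α w v

/-- The energy norm, `|||v|||² = a_s(v,v)`. -/
def energyNorm (𝒯 : Finset Rect) (k : ℕ) (α : ℝ) (v : WeakFunction) : ℝ :=
  Real.sqrt (aS 𝒯 k α v v)

/-- `u_h` solves the weak Galerkin scheme: `u_h ∈ V_h^0` and `a_s(u_h, v) = (f, v_0)` for all
`v ∈ V_h^0`. -/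
def IsWGSolution (Ω : Set (ℝ × ℝ)) (𝒯 : Finset Rect) (k : ℕ) (α : ℝ) (f : ℝ × ℝ → ℝ)
    (uh : WeakFunction) : Prop :=
  uh ∈ Vh0 Ω 𝒯 k ∧
    ∀ v ∈ Vh0 Ω 𝒯 k, aS 𝒯 k α uh v = ∑ T ∈ 𝒯, ∫ p in T.toSet, f p * v.1 T p

/-! ### Interpolation at the Lobatto points -/

/-- The Lobatto polynomial `ω_{k+1}` up to a constant factor: the `(k-1)`-st derivative of
`(x²-1)^k`, that is, a multiple of `∫_{-1}^x L_k` and of `(x²-1) L_k'`, where `L_k` is the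
Legendre polynomial. -/
def lobattoPoly (k : ℕ) : ℝ[X] :=
  Polynomial.derivative^[k - 1] ((Polynomial.X ^ 2 - 1) ^ k)

/-- The `k+1` Lobatto points on `[-1,1]`. -/
def lobattoNodes (k : ℕ) : Finset ℝ := (lobattoPoly k).roots.toFinset

/-- The Lagrange basis polynomial `l_ζ` at the Lobatto points. -/
def lobattoBasis (k : ℕ) (ζ : ℝ) : ℝ[X] := Lagrange.basis (lobattoNodes k) id ζ

/-- The affine map from `[-1,1]` onto `[a,b]`. -/
def fromRef (a b ζ : ℝ) : ℝ := (a + b) / 2 + (b - a) / 2 * ζ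

/-- The affine map from `[a,b]` onto `[-1,1]`. -/
def toRef (a b x : ℝ) : ℝ := (2 * x - a - b) / (b - a)

/-- The tensor-product Lagrange interpolant of `u` at the Lobatto points of `T`. -/
def interpRect (k : ℕ) (u : ℝ × ℝ → ℝ) (T : Rect) : ℝ × ℝ → ℝ := fun p =>
  ∑ ζ ∈ lobattoNodes k, ∑ η ∈ lobattoNodes k,
    u (fromRef T.a T.b ζ, fromRef T.c T.d η) *
      (lobattoBasis k ζ).eval (toRef T.a T.b p.1) * (lobattoBasis k η).eval (toRef T.c T.d p.2)

/-- The Lagrange interpolant of `u` at the Lobatto points of the edge `e`. -/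
def interpEdge (k : ℕ) (u : ℝ × ℝ → ℝ) (e : Edge) : ℝ → ℝ := fun t =>
  ∑ ζ ∈ lobattoNodes k,
    u (e.point (fromRef e.lo e.hi ζ)) * (lobattoBasis k ζ).eval (toRef e.lo e.hi t)

/-- The interpolant `I_h u`, as the weak function `{I_h u, I_h u|_e}`; `interpRect_side` below
shows that the second component is the trace of the first on every edge of every element. -/
def Ih (k : ℕ) (u : ℝ × ℝ → ℝ) : WeakFunction := (interpRect k u, interpEdge k u)

theorem lobattoPoly_ne_zero {k : ℕ} (hk : 1 ≤ k) : lobattoPoly k ≠ 0 := by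
  have hm : (Polynomial.X ^ 2 - 1 : ℝ[X]).Monic := by
    simpa using Polynomial.monic_X_pow_sub_C (1 : ℝ) (n := 2) two_ne_zero
  have hd : ((Polynomial.X ^ 2 - 1 : ℝ[X]) ^ k).natDegree = k + 1 + (k - 1) := by
    have : (Polynomial.X ^ 2 - 1 : ℝ[X]).natDegree = 2 := by
      simpa using Polynomial.natDegree_X_pow_sub_C (n := 2) (r := (1 : ℝ))
    rw [Polynomial.natDegree_pow, this]
    omega
  intro h
  have hc := congrArg (fun q => Polynomial.coeff q (k + 1)) h
  simp only [lobattoPoly, Polynomial.coeff_iterate_derivative, Polynomial.coeff_zero] at hc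
  rw [← hd, Polynomial.coeff_natDegree, (hm.pow k).leadingCoeff, nsmul_eq_mul, mul_one,
    Nat.cast_eq_zero, Nat.descFactorial_eq_zero_iff_lt] at hc
  omega

theorem mem_lobattoNodes {k : ℕ} (hk : 1 ≤ k) {ζ : ℝ} (hζ : ζ ^ 2 = 1) : ζ ∈ lobattoNodes k := by
  unfold lobattoNodes
  rw [Multiset.mem_toFinset, Polynomial.mem_roots (lobattoPoly_ne_zero hk)]
  have h := Polynomial.pow_sub_dvd_iterate_derivative_pow (Polynomial.X ^ 2 - 1 : ℝ[X]) k (k - 1)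
  have h1 : k - (k - 1) = 1 := by omega
  rw [h1, pow_one] at h
  exact Polynomial.IsRoot.dvd (by simp [hζ]) h

theorem sum_lobattoBasis {k : ℕ} {ξ : ℝ} (hξ : ξ ∈ lobattoNodes k) (g : ℝ → ℝ) :
    ∑ ζ ∈ lobattoNodes k, g ζ * (lobattoBasis k ζ).eval ξ = g ξ := by
  rw [Finset.sum_eq_single_of_mem ξ hξ]
  · have := Lagrange.eval_basis_self (v := (id : ℝ → ℝ)) (Function.injective_id.injOn) hξ
    rw [lobattoBasis, show Polynomial.eval ξ (Lagrange.basis (lobattoNodes k) id ξ) = 1 from this,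
      mul_one]
  · intro ζ _ hne
    have := Lagrange.eval_basis_of_ne (v := (id : ℝ → ℝ)) hne hξ
    rw [lobattoBasis, show Polynomial.eval ξ (Lagrange.basis (lobattoNodes k) id ζ) = 0 from this,
      mul_zero]

/-- On each edge of `T` the two-dimensional interpolant is the one-dimensional one. -/
theorem interpRect_side {k : ℕ} (hk : 1 ≤ k) (u : ℝ × ℝ → ℝ) (T : Rect) (i : Fin 4) (t : ℝ) :
    interpRect k u T ((T.side i).point t) = interpEdge k u (T.side i) t := by
  have hab : T.b - T.a ≠ 0 := (sub_pos.2 T.hab).ne'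
  have hcd : T.d - T.c ≠ 0 := (sub_pos.2 T.hcd).ne'
  have e1 : ∀ a b : ℝ, b - a ≠ 0 → toRef a b a = -1 := fun a b h => by
    unfold toRef; field_simp; ring
  have e2 : ∀ a b : ℝ, b - a ≠ 0 → toRef a b b = 1 := fun a b h => by
    unfold toRef; field_simp; ring
  have e3 : ∀ a b : ℝ, fromRef a b (-1) = a := fun a b => by unfold fromRef; ring
  have e4 : ∀ a b : ℝ, fromRef a b 1 = b := fun a b => by unfold fromRef; ring
  have m1 : (-1 : ℝ) ∈ lobattoNodes k := mem_lobattoNodes hk (by norm_num)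
  have m2 : (1 : ℝ) ∈ lobattoNodes k := mem_lobattoNodes hk (by norm_num)
  fin_cases i <;>
    simp only [interpRect, interpEdge, Rect.side, Edge.point, Edge.lo, Edge.hi, Fin.zero_eta,
      Fin.mk_one, Fin.reduceFinMk, Matrix.cons_val]
  · simp only [e1 _ _ hcd, sum_lobattoBasis m1, e3]
  · simp only [e2 _ _ hcd, sum_lobattoBasis m2, e4]
  · rw [Finset.sum_comm]
    refine Finset.sum_congr rfl fun ζ _ => ?_
    rw [← Finset.sum_mul, e1 _ _ hab,
      sum_lobattoBasis m1 (fun x => u (fromRef T.a T.b x, fromRef T.c T.d ζ)), e3]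
  · rw [Finset.sum_comm]
    refine Finset.sum_congr rfl fun ζ _ => ?_
    rw [← Finset.sum_mul, e2 _ _ hab,
      sum_lobattoBasis m2 (fun x => u (fromRef T.a T.b x, fromRef T.c T.d ζ)), e4]

end WG

end

noncomputable section

namespace WG


/-! ### The Lobatto points -/

/-! The error `e = I_h u - u_h` lies in `V_h^0`, so its energy is found by taking `v = e` in a
formula for `a_s(e, v)`. The interpolant has no jumps, and tested against `W_k` its weak gradient
acts like `∇ I_h u`. Also `f = -Δu` almost everywhere, and the fluxes of `∇u` cancel across interior
edges. Therefore (`aS_error_eq`) `a_s(e, v)` is the sum over the elements of `(∇ I_h u, ∇_w v)_T +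
(Δu, v₀)_T - ⟨∇u·n, v_b⟩_∂T`. For smooth `u`, Green's formula turns each summand into `-(∇(u - I_h
u), ∇v₀)_T + ⟨∂_n(u - I_h u), v₀ - v_b⟩_∂T` (`elementError_eq`).

The volume term is superconvergent. In one variable the interpolation error of a polynomial of
degree `k + 1` is a multiple of the Lobatto polynomial. Its derivative is a Legendre polynomial,
orthogonal to degrees below `k`, and `∂_x v₀` has degree below `k` in `x`. This gains one order
(`exists_sq_integral_interp_error_mul_le`), and the tensor product inherits it
(`exists_sq_integral_interpError_mul_le`). The gradient of `v₀` is controlled by `∇_w v` and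
`h_T^{-1/2}` times the jump (`exists_integral_sq_grad_le`). The boundary term has only the ordinary
order `h^{k-1/2}`, but it is paired with the jump, and the stabilizer bounds the jump by `h^{α/2}`
times the energy norm. This produces the two exponents `k + 1` and `k + (α - 1)/2`. Cauchy–Schwarz
over the elements and division by the energy of `e` finish the estimate; powers of `h` in excess are
absorbed because `Ω` is bounded.

These estimates are proved for smooth functions and carried over to `H^{k+2}` on each element by
density (`exists_contDiff_forall_integral_sq_lt`, from contraction followed by mollification). A
Sobolev inequality with mixed derivatives makes the approximations and their gradients converge
uniformly, so every term of the element error passes to the limit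
(`exists_sq_elementError_weakD_le`).

The continuous representative of `u` is glued from representatives on rectangles. A union of open
rectangles may have slits, or corners where two parts of `Ω` touch; there the pieces fit only
because `u` has zero boundary values (`eq_zero_of_memH10`, `exists_common_value`). The same zero
values put `I_h u` into `V_h^0`. -/

theorem lobattoPow_eval_eq_zero {k j : ℕ} (hj : j < k) {x : ℝ} (hx : x ^ 2 = 1) :
    (Polynomial.derivative^[j] ((Polynomial.X ^ 2 - 1 : ℝ[X]) ^ k)).eval x = 0 := by
  have h := Polynomial.pow_sub_dvd_iterate_derivative_pow (Polynomial.X ^ 2 - 1 : ℝ[X]) k j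
  have h1 : (Polynomial.X ^ 2 - 1 : ℝ[X]) ∣ (Polynomial.X ^ 2 - 1 : ℝ[X]) ^ (k - j) :=
    dvd_pow_self _ (by omega)
  exact Polynomial.IsRoot.dvd (by simp [hx]) (h1.trans h)

theorem natDegree_lobattoPow (k : ℕ) :
    ((Polynomial.X ^ 2 - 1 : ℝ[X]) ^ k).natDegree = 2 * k := by
  have : (Polynomial.X ^ 2 - 1 : ℝ[X]).natDegree = 2 := by
    simpa using Polynomial.natDegree_X_pow_sub_C (n := 2) (r := (1 : ℝ))
  rw [Polynomial.natDegree_pow, this]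
  omega

theorem iterate_derivative_lobattoPow_ne_zero {k j : ℕ} (hj : j ≤ 2 * k) :
    Polynomial.derivative^[j] ((Polynomial.X ^ 2 - 1 : ℝ[X]) ^ k) ≠ 0 := by
  intro h
  have hm : (Polynomial.X ^ 2 - 1 : ℝ[X]).Monic := by
    simpa using Polynomial.monic_X_pow_sub_C (1 : ℝ) (n := 2) two_ne_zero
  have hc := congrArg (fun q => Polynomial.coeff q (2 * k - j)) h
  simp only [Polynomial.coeff_iterate_derivative, Polynomial.coeff_zero] at hc
  rw [show 2 * k - j + j = 2 * k by omega] at hc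
  rw [← natDegree_lobattoPow k, Polynomial.coeff_natDegree, (hm.pow k).leadingCoeff,
    nsmul_eq_mul, mul_one, Nat.cast_eq_zero, Nat.descFactorial_eq_zero_iff_lt] at hc
  have := natDegree_lobattoPow k
  omega

/-- Rolle's theorem. If the `j`-th derivative has `j + 2` distinct roots, the next one has `j + 1`
further roots between them. The points `±1` are still roots of both, which gives `j + 3`. -/
theorem card_roots_iterate_derivative_lobattoPow {k : ℕ} : ∀ {j : ℕ}, j < k →
    j + 2 ≤ (Polynomial.derivative^[j] ((Polynomial.X ^ 2 - 1 : ℝ[X]) ^ k)).roots.toFinset.card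
  | 0, h => by
    have hsub : ({1, -1} : Finset ℝ) ⊆
        (Polynomial.derivative^[0] ((Polynomial.X ^ 2 - 1 : ℝ[X]) ^ k)).roots.toFinset := by
      intro x hx
      rw [Multiset.mem_toFinset,
        Polynomial.mem_roots (iterate_derivative_lobattoPow_ne_zero (by omega))]
      refine lobattoPow_eval_eq_zero h ?_
      simp only [Finset.mem_insert, Finset.mem_singleton] at hx
      rcases hx with rfl | rfl <;> norm_num
    refine le_trans ?_ (Finset.card_le_card hsub)
    rw [Finset.card_pair (by norm_num)]
  | j + 1, h => by
    have ih := card_roots_iterate_derivative_lobattoPow (k := k) (j := j) (by omega)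
    have hR := Polynomial.card_roots_toFinset_le_card_roots_derivative_sdiff_roots_succ
      (Polynomial.derivative^[j] ((Polynomial.X ^ 2 - 1 : ℝ[X]) ^ k))
    rw [← Function.iterate_succ_apply' Polynomial.derivative j] at hR
    set A := (Polynomial.derivative^[j] ((Polynomial.X ^ 2 - 1 : ℝ[X]) ^ k)).roots.toFinset with hA
    set B := (Polynomial.derivative^[j + 1] ((Polynomial.X ^ 2 - 1 : ℝ[X]) ^ k)).roots.toFinset
      with hB
    have hsub : ({1, -1} : Finset ℝ) ⊆ B ∩ A := by
      intro x hx
      have hx' : x ^ 2 = 1 := by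
        simp only [Finset.mem_insert, Finset.mem_singleton] at hx
        rcases hx with rfl | rfl <;> norm_num
      rw [Finset.mem_inter, hA, hB, Multiset.mem_toFinset, Multiset.mem_toFinset,
        Polynomial.mem_roots (iterate_derivative_lobattoPow_ne_zero (by omega)),
        Polynomial.mem_roots (iterate_derivative_lobattoPow_ne_zero (by omega))]
      exact ⟨lobattoPow_eval_eq_zero h hx', lobattoPow_eval_eq_zero (by omega) hx'⟩
    have h2 := Finset.card_le_card hsub
    rw [Finset.card_pair (by norm_num)] at h2
    have h3 := Finset.card_sdiff_add_card_inter B A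
    omega

theorem natDegree_lobattoPoly_le {k : ℕ} (hk : 1 ≤ k) : (lobattoPoly k).natDegree ≤ k + 1 := by
  have := Polynomial.natDegree_iterate_derivative ((Polynomial.X ^ 2 - 1 : ℝ[X]) ^ k) (k - 1)
  rw [natDegree_lobattoPow] at this
  unfold lobattoPoly
  omega

/-- The degree bounds the number of roots by `k + 1`, and Rolle with `j = k - 1` supplies that many
distinct real ones. -/
theorem card_lobattoNodes {k : ℕ} (hk : 1 ≤ k) : (lobattoNodes k).card = k + 1 := by
  apply le_antisymm
  · refine (Multiset.toFinset_card_le _).trans ?_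
    exact (Polynomial.card_roots' _).trans (natDegree_lobattoPoly_le hk)
  · have := card_roots_iterate_derivative_lobattoPow (k := k) (j := k - 1) (by omega)
    unfold lobattoNodes lobattoPoly
    omega

theorem natDegree_lobattoPoly {k : ℕ} (hk : 1 ≤ k) : (lobattoPoly k).natDegree = k + 1 := by
  apply le_antisymm (natDegree_lobattoPoly_le hk)
  rw [← card_lobattoNodes hk]
  exact (Multiset.toFinset_card_le _).trans (Polynomial.card_roots' _)

/-- Gauss–Lucas, applied to one derivative after the other: all complex roots stay in the convex
strip `|Re z| ≤ 1`, since those of `(z² - 1)^k` are `±1`. -/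
theorem lobattoNodes_subset_Icc {k : ℕ} (hk : 1 ≤ k) {ζ : ℝ} (hζ : ζ ∈ lobattoNodes k) :
    ζ ∈ Icc (-1 : ℝ) 1 := by
  have key : ∀ j : ℕ, j < 2 * k → ((Polynomial.derivative^[j] ((Polynomial.X ^ 2 - 1 : ℝ[X]) ^ k)).map
      (algebraMap ℝ ℂ)).rootSet ℂ ⊆ {z : ℂ | z.re ∈ Icc (-1 : ℝ) 1} := by
    intro j
    induction j with
    | zero =>
      intro _ z hz
      rw [Polynomial.mem_rootSet'] at hz
      have h := hz.2
      simp only [Function.iterate_zero, id_eq, Polynomial.map_pow, Polynomial.map_sub,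
        Polynomial.map_X, Polynomial.map_one, map_pow, map_sub, map_one, Polynomial.aeval_X] at h
      have h1 : z ^ 2 - 1 = 0 := by
        exact pow_eq_zero_iff (by omega) |>.1 h
      have h2 : (z - 1) * (z + 1) = 0 := by linear_combination h1
      rcases mul_eq_zero.1 h2 with h3 | h3
      · have : z = 1 := by linear_combination h3
        simp [this]
      · have : z = -1 := by linear_combination h3
        simp [this]
    | succ j ih =>
      intro hj
      have hd : 0 < ((Polynomial.derivative^[j] ((Polynomial.X ^ 2 - 1 : ℝ[X]) ^ k)).map
          (algebraMap ℝ ℂ)).degree := by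
        rw [Polynomial.degree_map]
        by_contra hcon
        rw [not_lt] at hcon
        have := Polynomial.derivative_of_natDegree_zero
          (Polynomial.natDegree_eq_zero_iff_degree_le_zero.2 hcon)
        rw [← Function.iterate_succ_apply' Polynomial.derivative j] at this
        exact iterate_derivative_lobattoPow_ne_zero (by omega) this
      have := Polynomial.rootSet_derivative_subset_convexHull_rootSet hd
      rw [Polynomial.derivative_map, ← Function.iterate_succ_apply' Polynomial.derivative j] at this
      refine this.trans (convexHull_min (ih (by omega)) ?_)
      have : {z : ℂ | z.re ∈ Icc (-1 : ℝ) 1} = Complex.reLm ⁻¹' (Icc (-1 : ℝ) 1) := rfl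
      rw [this]
      exact (convex_Icc _ _).linear_preimage _
  unfold lobattoNodes at hζ
  rw [Multiset.mem_toFinset, Polynomial.mem_roots (lobattoPoly_ne_zero hk)] at hζ
  have h1 : (ζ : ℂ) ∈ ((Polynomial.derivative^[k - 1] ((Polynomial.X ^ 2 - 1 : ℝ[X]) ^ k)).map
      (algebraMap ℝ ℂ)).rootSet ℂ := by
    rw [Polynomial.mem_rootSet']
    constructor
    · simp only [Polynomial.map_map]
      rw [Polynomial.map_ne_zero_iff]
      · exact lobattoPoly_ne_zero hk
      · exact RingHom.injective _
    · rw [Polynomial.aeval_map_algebraMap]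
      have h2 : Polynomial.aeval (algebraMap ℝ ℂ ζ) (lobattoPoly k) = 0 := by
        rw [Polynomial.aeval_algebraMap_apply]
        have : Polynomial.aeval ζ (lobattoPoly k) = 0 := by
          simpa using hζ
        rw [this]; simp
      exact h2
  simpa using key (k - 1) (by omega) h1

/-- Integration by parts `j` times. The boundary terms vanish because `±1` are roots of order `k`,
hence roots of every derivative of order below `k`. -/
theorem integral_iterate_derivative_lobattoPow {k : ℕ} (q : ℝ[X]) : ∀ {j : ℕ}, j ≤ k →
    ∫ x in (-1 : ℝ)..1, (Polynomial.derivative^[j] ((Polynomial.X ^ 2 - 1 : ℝ[X]) ^ k)).eval x *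
      q.eval x = (-1) ^ j * ∫ x in (-1 : ℝ)..1, ((Polynomial.X ^ 2 - 1 : ℝ[X]) ^ k).eval x *
      (Polynomial.derivative^[j] q).eval x := by
  intro j
  induction j generalizing q with
  | zero => intro _; simp
  | succ j ih =>
    intro hj
    have h1 := intervalIntegral.integral_mul_deriv_eq_deriv_mul (a := -1) (b := 1)
      (u := fun x => q.eval x) (u' := fun x => (Polynomial.derivative q).eval x)
      (v := fun x => (Polynomial.derivative^[j] ((Polynomial.X ^ 2 - 1 : ℝ[X]) ^ k)).eval x)
      (v' := fun x => (Polynomial.derivative^[j + 1] ((Polynomial.X ^ 2 - 1 : ℝ[X]) ^ k)).eval x)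
      (fun x _ => q.hasDerivAt x)
      (fun x _ => by
        rw [Function.iterate_succ_apply']
        exact Polynomial.hasDerivAt _ x)
      ((Polynomial.continuous _).intervalIntegrable _ _)
      ((Polynomial.continuous _).intervalIntegrable _ _)
    rw [lobattoPow_eval_eq_zero (by omega) (by norm_num),
      lobattoPow_eval_eq_zero (by omega) (by norm_num)] at h1
    simp_rw [mul_comm (Polynomial.eval _ (Polynomial.derivative^[j + 1] _)) (q.eval _)]
    rw [h1]
    simp_rw [mul_comm (Polynomial.eval _ (Polynomial.derivative q))]
    rw [ih (Polynomial.derivative q) (by omega), ← Function.iterate_succ_apply]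
    ring

/-- The derivative of the Lobatto polynomial, a multiple of the Legendre polynomial, is orthogonal
to all polynomials of lower degree. -/
theorem integral_derivative_lobattoPoly {k : ℕ} (hk : 1 ≤ k) {q : ℝ[X]} (hq : q.natDegree < k) :
    ∫ x in (-1 : ℝ)..1, (Polynomial.derivative (lobattoPoly k)).eval x * q.eval x = 0 := by
  have := integral_iterate_derivative_lobattoPow (k := k) q le_rfl
  rw [Polynomial.iterate_derivative_eq_zero hq] at this
  unfold lobattoPoly
  rw [← Function.iterate_succ_apply' Polynomial.derivative, show (k - 1).succ = k by omega, this]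
  simp

section

/-! ### Cauchy–Schwarz inequalities -/

/-- The weighted arithmetic–geometric inequality read backwards: the minimum of `t a + b / t` over
`t > 0` is `2 √(a b)`, attained or approached. -/
theorem sq_le_mul_of_forall_le {x a b : ℝ} (ha : 0 ≤ a) (hb : 0 ≤ b)
    (h : ∀ t : ℝ, 0 < t → 2 * |x| ≤ t * a + t⁻¹ * b) : x ^ 2 ≤ a * b := by
  rcases eq_or_ne x 0 with rfl | hx
  · simpa using mul_nonneg ha hb
  have hx' : 0 < |x| := abs_pos.2 hx
  rcases ha.eq_or_lt with rfl | ha'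
  · exfalso
    -- With `a = 0` a large `t` contradicts the hypothesis: the right side becomes `|x| b / (b +
    -- 1)`, which is less than `2 |x|`.
    have := h ((b + 1) / |x|) (by positivity)
    rw [mul_zero, zero_add, inv_div] at this
    have h2 : |x| / (b + 1) * b ≤ |x| := by
      rw [div_mul_eq_mul_div, div_le_iff₀ (by positivity)]
      nlinarith
    linarith
  · have := h (|x| / a) (by positivity)
    rw [inv_div, div_mul_cancel₀ _ ha'.ne'] at this
    have h2 : |x| ≤ a / |x| * b := by linarith
    rw [div_mul_eq_mul_div, le_div_iff₀ hx'] at h2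
    nlinarith [sq_abs x]

/-- Young's inequality with weight `t` under the integral, then the best `t`. Asking only for `F² ≤
A B` pointwise lets one lemma serve products, scalar products of fields, weighted averages and inner
integrals; nothing is required of `F` itself. -/
theorem sq_integral_le_mul_integral {X : Type*} [MeasurableSpace X] {μ : Measure X}
    {F A B : X → ℝ} (hA : Integrable A μ) (hB : Integrable B μ) (hA0 : ∀ᵐ x ∂μ, 0 ≤ A x)
    (hB0 : ∀ᵐ x ∂μ, 0 ≤ B x) (h : ∀ᵐ x ∂μ, F x ^ 2 ≤ A x * B x) :
    (∫ x, F x ∂μ) ^ 2 ≤ (∫ x, A x ∂μ) * ∫ x, B x ∂μ := by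
  refine sq_le_mul_of_forall_le (integral_nonneg_of_ae hA0) (integral_nonneg_of_ae hB0) ?_
  intro t ht
  have h1 : ‖∫ x, F x ∂μ‖ ≤ ∫ x, (t * A x + t⁻¹ * B x) / 2 ∂μ := by
    refine norm_integral_le_of_norm_le (((hA.const_mul t).add (hB.const_mul t⁻¹)).div_const 2) ?_
    filter_upwards [h, hA0, hB0] with x hx ha hb
    rw [Real.norm_eq_abs]
    apply abs_le_of_sq_le_sq _ (by positivity)
    have : A x * B x = (t * A x) * (t⁻¹ * B x) := by field_simp
    rw [this] at hx
    nlinarith [sq_nonneg (t * A x - t⁻¹ * B x)]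
  rw [integral_div, integral_add (hA.const_mul t) (hB.const_mul t⁻¹), integral_const_mul,
    integral_const_mul, Real.norm_eq_abs] at h1
  linarith

theorem sq_integral_mul_le {X : Type*} [MeasurableSpace X] {μ : Measure X} {f g : X → ℝ}
    (hf : Integrable (fun x => f x ^ 2) μ) (hg : Integrable (fun x => g x ^ 2) μ) :
    (∫ x, f x * g x ∂μ) ^ 2 ≤ (∫ x, f x ^ 2 ∂μ) * ∫ x, g x ^ 2 ∂μ :=
  sq_integral_le_mul_integral hf hg (.of_forall fun _ => sq_nonneg _)
    (.of_forall fun _ => sq_nonneg _) (.of_forall fun x => (mul_pow (f x) (g x) 2).le)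

theorem sq_intervalIntegral_le_mul {F A B : ℝ → ℝ} {a b : ℝ} (hab : a ≤ b)
    (hA : Continuous A) (hB : Continuous B) (hA0 : ∀ x, 0 ≤ A x)
    (hB0 : ∀ x, 0 ≤ B x) (h : ∀ x ∈ Icc a b, F x ^ 2 ≤ A x * B x) :
    (∫ x in a..b, F x) ^ 2 ≤ (∫ x in a..b, A x) * ∫ x in a..b, B x := by
  simp only [intervalIntegral.integral_of_le hab]
  refine sq_integral_le_mul_integral ?_ ?_ (.of_forall hA0) (.of_forall hB0) ?_
  · exact (hA.intervalIntegrable a b).1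
  · exact (hB.intervalIntegrable a b).1
  · filter_upwards [ae_restrict_mem measurableSet_Ioc] with x hx
    exact h x (Ioc_subset_Icc_self hx)

theorem sq_intervalIntegral_mul_le {f g : ℝ → ℝ} {a b : ℝ} (hab : a ≤ b)
    (hf : Continuous f) (hg : Continuous g) :
    (∫ x in a..b, f x * g x) ^ 2 ≤ (∫ x in a..b, f x ^ 2) * ∫ x in a..b, g x ^ 2 :=
  sq_intervalIntegral_le_mul hab (by fun_prop) (by fun_prop) (fun _ => sq_nonneg _)
    (fun _ => sq_nonneg _) (fun x _ => (mul_pow (f x) (g x) 2).le)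

/-- The increment of a function is controlled by the `L²` norm of its derivative. -/
theorem sq_sub_le_integral_sq_deriv {g g' : ℝ → ℝ} {a b x y : ℝ}
    (hg : ∀ t, HasDerivAt g (g' t) t) (hg' : Continuous g') (hx : x ∈ Icc a b) (hy : y ∈ Icc a b) :
    (g x - g y) ^ 2 ≤ (b - a) * ∫ t in a..b, g' t ^ 2 := by
  wlog hxy : y ≤ x generalizing x y
  · have := this hy hx (by linarith)
    nlinarith
  have h1 : ∫ t in y..x, g' t = g x - g y :=
    intervalIntegral.integral_eq_sub_of_hasDerivAt (fun t _ => hg t) (hg'.intervalIntegrable _ _)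
  have h2 := sq_intervalIntegral_mul_le (f := fun _ => (1 : ℝ)) (g := g') hxy continuous_const hg'
  simp only [one_mul, one_pow, intervalIntegral.integral_const, smul_eq_mul, mul_one] at h2
  rw [h1] at h2
  have h3 : ∫ t in y..x, g' t ^ 2 ≤ ∫ t in a..b, g' t ^ 2 := by
    refine intervalIntegral.integral_mono_interval hy.1 hxy hx.2 ?_ ?_
    · exact .of_forall fun t => sq_nonneg _
    · exact (hg'.pow 2).intervalIntegrable _ _
  refine h2.trans (mul_le_mul (by linarith [hx.2, hy.1]) h3 ?_ (by linarith [hx.2, hy.1]))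
  exact intervalIntegral.integral_nonneg hxy fun t _ => sq_nonneg _

theorem integral_sq_nonneg {g : ℝ → ℝ} {a b : ℝ} (hab : a ≤ b) : 0 ≤ ∫ t in a..b, g t ^ 2 :=
  intervalIntegral.integral_nonneg hab fun _ _ => sq_nonneg _

theorem intervalIntegral_sq_le_of_le {g : ℝ → ℝ} {a b M : ℝ} (hab : a ≤ b)
    (h : ∀ x ∈ Icc a b, g x ^ 2 ≤ M) (hg : Continuous g) :
    ∫ t in a..b, g t ^ 2 ≤ (b - a) * M := by
  have := intervalIntegral.integral_mono_on (μ := volume) hab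
    ((hg.pow 2).intervalIntegrable a b) (intervalIntegrable_const (c := M)) h
  simpa using this

/-! ### Taylor approximation in one variable -/

theorem exists_polynomial_derivative_eq (p : ℝ[X]) (c a : ℝ) : ∃ P : ℝ[X],
    Polynomial.derivative P = p ∧ P.natDegree ≤ p.natDegree + 1 ∧ P.eval a = c := by
  let P₀ : ℝ[X] := p.sum fun n r => Polynomial.C (r / (n + 1)) * Polynomial.X ^ (n + 1)
  have hd : Polynomial.derivative P₀ = p := by
    simp only [P₀, Polynomial.sum, Polynomial.derivative_sum,
      Polynomial.derivative_C_mul_X_pow]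
    conv_rhs => rw [Polynomial.as_sum_support_C_mul_X_pow p]
    refine Finset.sum_congr rfl fun n _ => ?_
    congr 2
    push_cast
    field_simp
  have hn : P₀.natDegree ≤ p.natDegree + 1 := by
    refine Polynomial.natDegree_sum_le_of_forall_le _ _ fun n hn => ?_
    refine (Polynomial.natDegree_C_mul_X_pow_le _ _).trans ?_
    have := Polynomial.le_natDegree_of_mem_supp n hn
    omega
  refine ⟨P₀ + Polynomial.C (c - P₀.eval a), by simp [hd], ?_, by simp⟩
  refine (Polynomial.natDegree_add_le _ _).trans ?_
  simp only [Polynomial.natDegree_C]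
  omega

/-- Induction on the degree: approximate `g'`, then integrate the polynomial starting from the value
`g a`. The remainder vanishes at `a`, so each integration costs a factor `(b - a)²` in the square.
-/
theorem exists_polynomial_sq_sub_le {a b : ℝ} (hab : a ≤ b) (n : ℕ) : ∀ {g : ℝ → ℝ},
    ContDiff ℝ ∞ g → ∃ p : ℝ[X], p.natDegree ≤ n ∧ ∀ x ∈ Icc a b,
      (g x - p.eval x) ^ 2 ≤ (b - a) ^ (2 * n + 1) * ∫ t in a..b, iteratedDeriv (n + 1) g t ^ 2 := by
  induction n with
  | zero =>
    intro g hg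
    refine ⟨Polynomial.C (g a), by simp, fun x hx => ?_⟩
    have h := sq_sub_le_integral_sq_deriv (g := g) (g' := deriv g) (a := a) (b := b) (x := x)
      (y := a) (fun t => (hg.differentiable (by simp) t).hasDerivAt)
      (hg.continuous_deriv (by simp)) hx (by simp [hab])
    simpa using h
  | succ n ih =>
    intro g hg
    have hg' : ContDiff ℝ ∞ (deriv g) := by
      have := (contDiff_infty_iff_deriv (𝕜 := ℝ) (f := g)).1 hg
      exact this.2
    obtain ⟨p, hp, hpb⟩ := ih hg'
    obtain ⟨P, hP, hPn, hPa⟩ := exists_polynomial_derivative_eq p (g a) a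
    refine ⟨P, by omega, fun x hx => ?_⟩
    have h := sq_sub_le_integral_sq_deriv (g := fun x => g x - P.eval x)
      (g' := fun x => deriv g x - p.eval x) (a := a) (b := b) (x := x) (y := a)
      (fun t => ((hg.differentiable (by simp) t).hasDerivAt).sub (by
        have := P.hasDerivAt t
        rwa [hP] at this)) (hg'.continuous.sub p.continuous) hx (by simp [hab])
    simp only [hPa, sub_self, sub_zero] at h
    refine h.trans ?_
    have h2 := intervalIntegral_sq_le_of_le hab hpb (hg'.continuous.sub p.continuous)
    rw [iteratedDeriv_succ']
    calc (b - a) * ∫ t in a..b, (deriv g t - p.eval t) ^ 2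
        ≤ (b - a) * ((b - a) * ((b - a) ^ (2 * n + 1) *
            ∫ t in a..b, iteratedDeriv (n + 1) (deriv g) t ^ 2)) :=
          mul_le_mul_of_nonneg_left h2 (by linarith)
      _ = _ := by ring

/-- Taylor approximation, with a bound for the derivative of the remainder. -/
theorem exists_polynomial_sq_deriv_sub_le {a b : ℝ} (hab : a ≤ b) {n : ℕ} (hn : 1 ≤ n)
    {g : ℝ → ℝ} (hg : ContDiff ℝ ∞ g) : ∃ p : ℝ[X], p.natDegree ≤ n ∧ ∀ x ∈ Icc a b,
      (deriv g x - (Polynomial.derivative p).eval x) ^ 2 ≤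
        (b - a) ^ (2 * n - 1) * ∫ t in a..b, iteratedDeriv (n + 1) g t ^ 2 := by
  have hg' : ContDiff ℝ ∞ (deriv g) := ((contDiff_infty_iff_deriv (𝕜 := ℝ) (f := g)).1 hg).2
  obtain ⟨n, rfl⟩ : ∃ m, n = m + 1 := ⟨n - 1, by omega⟩
  obtain ⟨p, hp, hpb⟩ := exists_polynomial_sq_sub_le hab n hg'
  obtain ⟨P, hP, hPn, -⟩ := exists_polynomial_derivative_eq p 0 a
  refine ⟨P, by omega, fun x hx => ?_⟩
  rw [hP, iteratedDeriv_succ', show 2 * (n + 1) - 1 = 2 * n + 1 by omega]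
  exact hpb x hx

/-! ### Lobatto interpolation in one variable -/

/-- The Lagrange interpolant of `g` at the Lobatto points of `[a,b]`. -/
def interp (k : ℕ) (a b : ℝ) (g : ℝ → ℝ) : ℝ → ℝ := fun t =>
  ∑ ζ ∈ lobattoNodes k, g (fromRef a b ζ) * (lobattoBasis k ζ).eval (toRef a b t)

/-- The derivative of the interpolant. -/
def interpDeriv (k : ℕ) (a b : ℝ) (g : ℝ → ℝ) : ℝ → ℝ := fun t =>
  ∑ ζ ∈ lobattoNodes k, g (fromRef a b ζ) *
    ((Polynomial.derivative (lobattoBasis k ζ)).eval (toRef a b t) * (2 / (b - a)))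

theorem toRef_fromRef {a b : ℝ} (hab : a < b) (ζ : ℝ) : toRef a b (fromRef a b ζ) = ζ := by
  have : b - a ≠ 0 := (sub_pos.2 hab).ne'
  unfold toRef fromRef; field_simp; ring

theorem fromRef_toRef {a b : ℝ} (hab : a < b) (x : ℝ) : fromRef a b (toRef a b x) = x := by
  have : b - a ≠ 0 := (sub_pos.2 hab).ne'
  unfold toRef fromRef; field_simp; ring

theorem fromRef_mem_Icc {a b ζ : ℝ} (hab : a < b) (hζ : ζ ∈ Icc (-1 : ℝ) 1) :
    fromRef a b ζ ∈ Icc a b := by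
  obtain ⟨h1, h2⟩ := hζ
  unfold fromRef
  constructor <;> nlinarith

theorem toRef_mem_Icc {a b x : ℝ} (hab : a < b) (hx : x ∈ Icc a b) :
    toRef a b x ∈ Icc (-1 : ℝ) 1 := by
  obtain ⟨h1, h2⟩ := hx
  have : 0 < b - a := sub_pos.2 hab
  unfold toRef
  constructor
  · rw [le_div_iff₀ this]; linarith
  · rw [div_le_iff₀ this]; linarith

theorem hasDerivAt_toRef (a b x : ℝ) : HasDerivAt (toRef a b) (2 / (b - a)) x := by
  unfold toRef
  have := ((((hasDerivAt_id x).const_mul 2).sub_const a).sub_const b).div_const (b - a)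
  simpa using this

theorem continuous_toRef (a b : ℝ) : Continuous (toRef a b) :=
  continuous_iff_continuousAt.2 fun x => (hasDerivAt_toRef a b x).continuousAt

theorem hasDerivAt_interp (k : ℕ) (a b : ℝ) (g : ℝ → ℝ) (t : ℝ) :
    HasDerivAt (interp k a b g) (interpDeriv k a b g t) t := by
  unfold interp interpDeriv
  refine HasDerivAt.fun_sum fun ζ _ => ?_
  refine HasDerivAt.const_mul _ ?_
  exact ((lobattoBasis k ζ).hasDerivAt (toRef a b t)).comp t (hasDerivAt_toRef a b t)

theorem continuous_interp (k : ℕ) (a b : ℝ) (g : ℝ → ℝ) : Continuous (interp k a b g) :=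
  continuous_iff_continuousAt.2 fun x => (hasDerivAt_interp k a b g x).continuousAt

theorem continuous_interpDeriv (k : ℕ) (a b : ℝ) (g : ℝ → ℝ) :
    Continuous (interpDeriv k a b g) := by
  unfold interpDeriv
  refine continuous_finsetSum _ fun ζ _ => ?_
  have := (Polynomial.continuous (Polynomial.derivative (lobattoBasis k ζ))).comp
    (continuous_toRef a b)
  exact continuous_const.mul (this.mul continuous_const)

theorem interpDeriv_sub (k : ℕ) (a b : ℝ) (f g : ℝ → ℝ) (t : ℝ) :
    interpDeriv k a b (fun x => f x - g x) t = interpDeriv k a b f t - interpDeriv k a b g t := by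
  simp only [interpDeriv, sub_mul, Finset.sum_sub_distrib]

/-- The polynomial `p ∘ fromRef`. -/
theorem exists_polynomial_comp_fromRef (a b : ℝ) (p : ℝ[X]) : ∃ P : ℝ[X],
    P.natDegree ≤ p.natDegree ∧ ∀ ζ, P.eval ζ = p.eval (fromRef a b ζ) := by
  refine ⟨p.comp (Polynomial.C ((a + b) / 2) + Polynomial.C ((b - a) / 2) * Polynomial.X), ?_, ?_⟩
  · refine Polynomial.natDegree_comp_le.trans ?_
    have : (Polynomial.C ((a + b) / 2) + Polynomial.C ((b - a) / 2) * Polynomial.X : ℝ[X]).natDegree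
        ≤ 1 := by
      refine (Polynomial.natDegree_add_le _ _).trans ?_
      simp only [Polynomial.natDegree_C, zero_le, sup_of_le_right]
      exact (Polynomial.natDegree_C_mul_le _ _).trans Polynomial.natDegree_X_le
    nlinarith
  · intro ζ
    simp [fromRef]

theorem interp_eq_eval_interpolate (k : ℕ) (a b : ℝ) (g : ℝ → ℝ) (t : ℝ) :
    interp k a b g t =
      (Lagrange.interpolate (lobattoNodes k) id fun ζ => g (fromRef a b ζ)).eval (toRef a b t) := by
  simp [interp, Lagrange.interpolate_apply, Polynomial.eval_finsetSum, lobattoBasis]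

/-- Interpolation reproduces polynomials of degree at most `k`. -/
theorem interp_polynomial {k : ℕ} (hk : 1 ≤ k) {a b : ℝ} (hab : a < b) {p : ℝ[X]}
    (hp : p.natDegree ≤ k) (t : ℝ) : interp k a b (fun x => p.eval x) t = p.eval t := by
  obtain ⟨P, hP, hPe⟩ := exists_polynomial_comp_fromRef a b p
  rw [interp_eq_eval_interpolate]
  simp only [← hPe]
  have := Lagrange.eq_interpolate (s := lobattoNodes k) (v := (id : ℝ → ℝ)) (f := P)
    Function.injective_id.injOn (by
      rw [card_lobattoNodes hk]
      refine lt_of_le_of_lt Polynomial.degree_le_natDegree ?_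
      exact_mod_cast (by omega : P.natDegree < k + 1))
  simp only [id_eq] at this
  rw [← this, hPe, fromRef_toRef hab]

/-- The interpolation error of a polynomial of degree `k + 1` is a multiple of the Lobatto
polynomial. -/
theorem exists_sub_interp_polynomial_eq {k : ℕ} (hk : 1 ≤ k) {a b : ℝ} (hab : a < b) {p : ℝ[X]}
    (hp : p.natDegree ≤ k + 1) : ∃ c : ℝ, ∀ t,
      p.eval t - interp k a b (fun x => p.eval x) t = c * (lobattoPoly k).eval (toRef a b t) := by
  obtain ⟨P, hP, hPe⟩ := exists_polynomial_comp_fromRef a b p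
  set I := Lagrange.interpolate (lobattoNodes k) id fun ζ => P.eval ζ with hI
  set L := lobattoPoly k with hL
  have hLn : L.natDegree = k + 1 := natDegree_lobattoPoly hk
  have hL0 : L ≠ 0 := lobattoPoly_ne_zero hk
  -- This `c` removes the coefficient of degree `k + 1`. What remains has degree at most `k` and
  -- vanishes at the `k + 1` nodes, hence is zero.
  set c := P.coeff (k + 1) / L.leadingCoeff with hc
  have hId : I.degree < (k + 1 : ℕ) := by
    have := Lagrange.degree_interpolate_lt (s := lobattoNodes k) (v := (id : ℝ → ℝ))
      (fun ζ => P.eval ζ) Function.injective_id.injOn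
    rwa [card_lobattoNodes hk] at this
  have hz : P - I - Polynomial.C c * L = 0 := by
    refine Polynomial.eq_zero_of_degree_lt_of_eval_finset_eq_zero (lobattoNodes k) ?_ ?_
    · rw [card_lobattoNodes hk, Polynomial.degree_lt_iff_coeff_zero]
      intro m hm
      have h1 : I.coeff m = 0 := Polynomial.coeff_eq_zero_of_degree_lt
        (lt_of_lt_of_le hId (by exact_mod_cast hm))
      rcases hm.eq_or_lt with rfl | hm'
      · simp only [Polynomial.coeff_sub, h1, Polynomial.coeff_C_mul]
        rw [← hLn, Polynomial.coeff_natDegree, hc, hLn]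
        rw [div_mul_cancel₀ _ (by simpa using hL0)]
        ring
      · simp only [Polynomial.coeff_sub, h1, Polynomial.coeff_C_mul]
        rw [Polynomial.coeff_eq_zero_of_natDegree_lt (by omega : P.natDegree < m),
          Polynomial.coeff_eq_zero_of_natDegree_lt (by omega : L.natDegree < m)]
        ring
    · intro ζ hζ
      have h1 := Lagrange.eval_interpolate_at_node (s := lobattoNodes k) (v := (id : ℝ → ℝ))
        (fun ζ => P.eval ζ) Function.injective_id.injOn hζ
      have h2 : L.eval ζ = 0 := by
        have := hζ
        unfold lobattoNodes at this
        rw [Multiset.mem_toFinset, Polynomial.mem_roots hL0] at this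
        exact this
      simp only [id_eq] at h1
      rw [Polynomial.eval_sub, Polynomial.eval_sub, Polynomial.eval_mul, h2, hI, h1]
      ring
  refine ⟨c, fun t => ?_⟩
  rw [interp_eq_eval_interpolate]
  simp only [← hPe]
  rw [← hI]
  have h3 := congrArg (fun q => Polynomial.eval (toRef a b t) q) hz
  simp only [Polynomial.eval_sub, Polynomial.eval_mul, Polynomial.eval_C, Polynomial.eval_zero,
    hPe, fromRef_toRef hab] at h3
  linarith

/-- Superconvergence: the derivative of the interpolation error of a polynomial of degree `k + 1`
is orthogonal to the polynomials of degree less than `k`. -/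
theorem integral_deriv_sub_interp_polynomial {k : ℕ} (hk : 1 ≤ k) {a b : ℝ} (hab : a < b)
    {p : ℝ[X]} (hp : p.natDegree ≤ k + 1) {q : ℝ[X]} (hq : q.natDegree < k) :
    ∫ t in a..b, ((Polynomial.derivative p).eval t - interpDeriv k a b (fun x => p.eval x) t) *
      q.eval t = 0 := by
  obtain ⟨c, hc⟩ := exists_sub_interp_polynomial_eq hk hab hp
  obtain ⟨Q, hQ, hQe⟩ := exists_polynomial_comp_fromRef a b q
  -- The derivative of the error is a multiple of the rescaled Legendre polynomial, so pulling the
  -- integral back to `[-1,1]` gives the orthogonality.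
  have hd : ∀ t, (Polynomial.derivative p).eval t - interpDeriv k a b (fun x => p.eval x) t =
      c * ((Polynomial.derivative (lobattoPoly k)).eval (toRef a b t) * (2 / (b - a))) := by
    intro t
    have h1 := (p.hasDerivAt t).sub (hasDerivAt_interp k a b (fun x => p.eval x) t)
    have h2 : HasDerivAt (fun t => c * (lobattoPoly k).eval (toRef a b t)) _ t :=
      (((lobattoPoly k).hasDerivAt (toRef a b t)).comp t (hasDerivAt_toRef a b t)).const_mul c
    have h3 : (fun t => p.eval t - interp k a b (fun x => p.eval x) t) =
      fun t => c * (lobattoPoly k).eval (toRef a b t) := funext hc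
    refine HasDerivAt.unique (f := fun t => c * (lobattoPoly k).eval (toRef a b t)) ?_ h2
    rw [← h3]
    exact h1
  have hba : (0 : ℝ) < b - a := sub_pos.2 hab
  have h4 := intervalIntegral.integral_comp_add_mul (a := -1) (b := 1)
    (fun t => ((Polynomial.derivative p).eval t - interpDeriv k a b (fun x => p.eval x) t) *
      q.eval t) (c := (b - a) / 2) (by positivity) ((a + b) / 2)
  have h5 : (a + b) / 2 + (b - a) / 2 * (-1) = a := by ring
  have h6 : (a + b) / 2 + (b - a) / 2 * 1 = b := by ring
  rw [h5, h6] at h4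
  have h7 : ∫ x in (-1 : ℝ)..1, ((Polynomial.derivative p).eval ((a + b) / 2 + (b - a) / 2 * x) -
      interpDeriv k a b (fun x => p.eval x) ((a + b) / 2 + (b - a) / 2 * x)) *
      q.eval ((a + b) / 2 + (b - a) / 2 * x) = 0 := by
    have : ∀ x : ℝ, ((Polynomial.derivative p).eval ((a + b) / 2 + (b - a) / 2 * x) -
      interpDeriv k a b (fun x => p.eval x) ((a + b) / 2 + (b - a) / 2 * x)) *
      q.eval ((a + b) / 2 + (b - a) / 2 * x) =
      (c * (2 / (b - a))) * ((Polynomial.derivative (lobattoPoly k)).eval x * Q.eval x) := by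
      intro x
      rw [hd, hQe, show (a + b) / 2 + (b - a) / 2 * x = fromRef a b x from rfl, toRef_fromRef hab]
      ring
    simp_rw [this]
    rw [intervalIntegral.integral_const_mul, integral_derivative_lobattoPoly hk (by omega),
      mul_zero]
  rw [h7] at h4
  have h8 : ((b - a) / 2)⁻¹ ≠ 0 := by positivity
  exact (smul_eq_zero.1 h4.symm).resolve_left h8

theorem exists_bound_interpBasis (k : ℕ) : ∃ M : ℝ, 0 < M ∧ ∀ ζ ∈ lobattoNodes k,
    ∀ x ∈ Icc (-1 : ℝ) 1, |(Polynomial.derivative (lobattoBasis k ζ)).eval x| ≤ M := by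
  have h : ∀ ζ : ℝ, ∃ C, ∀ x ∈ Icc (-1 : ℝ) 1,
      ‖(Polynomial.derivative (lobattoBasis k ζ)).eval x‖ ≤ C := fun ζ =>
    isCompact_Icc.exists_bound_of_continuousOn (Polynomial.continuous _).continuousOn
  choose C hC using h
  refine ⟨1 + ∑ ζ ∈ lobattoNodes k, |C ζ|, by positivity, fun ζ hζ x hx => ?_⟩
  have h1 := hC ζ x hx
  rw [Real.norm_eq_abs] at h1
  have h2 := Finset.single_le_sum (f := fun ζ => |C ζ|) (fun ζ _ => abs_nonneg _) hζ
  linarith [le_abs_self (C ζ)]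

/-- `H¹` stability of the interpolation, in a pointwise form. -/
theorem exists_sq_interpDeriv_le {k : ℕ} (hk : 1 ≤ k) : ∃ C : ℝ, 0 < C ∧ ∀ (a b : ℝ), a < b →
    ∀ (g g' : ℝ → ℝ), (∀ t, HasDerivAt g (g' t) t) → Continuous g' → ∀ x ∈ Icc a b,
      interpDeriv k a b g x ^ 2 ≤ C * (b - a)⁻¹ * ∫ t in a..b, g' t ^ 2 := by
  obtain ⟨M, hM, hMb⟩ := exists_bound_interpBasis k
  refine ⟨((k + 1 : ℝ) * M * 2) ^ 2, by positivity, fun a b hab g g' hg hg' x hx => ?_⟩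
  have hba : 0 < b - a := sub_pos.2 hab
  -- Constants are reproduced, so `g` may be replaced by `g - g a`, whose nodal values are
  -- controlled by the `L²` norm of `g'`.
  have hconst : interpDeriv k a b (fun _ => g a) x = 0 := by
    have h1 : interp k a b (fun _ => g a) = fun _ => g a := by
      funext t
      have := interp_polynomial hk hab (p := Polynomial.C (g a)) (by simp) t
      simpa using this
    have h2 := hasDerivAt_interp k a b (fun _ => g a) x
    rw [h1] at h2
    exact h2.unique (hasDerivAt_const x (g a))
  have h1 : interpDeriv k a b g x = interpDeriv k a b (fun t => g t - g a) x := by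
    rw [interpDeriv_sub, hconst, sub_zero]
  set D := (b - a) * ∫ t in a..b, g' t ^ 2 with hD
  have hD0 : 0 ≤ D := mul_nonneg hba.le (integral_sq_nonneg hab.le)
  have h2 : |interpDeriv k a b g x| ≤ (k + 1) * (Real.sqrt D * (M * (2 / (b - a)))) := by
    rw [h1]
    unfold interpDeriv
    refine (Finset.abs_sum_le_sum_abs _ _).trans ?_
    have : ∀ ζ ∈ lobattoNodes k, |(g (fromRef a b ζ) - g a) *
        ((Polynomial.derivative (lobattoBasis k ζ)).eval (toRef a b x) * (2 / (b - a)))| ≤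
        Real.sqrt D * (M * (2 / (b - a))) := by
      intro ζ hζ
      rw [abs_mul, abs_mul, abs_of_pos (by positivity : 0 < 2 / (b - a))]
      gcongr
      · apply Real.abs_le_sqrt
        exact sq_sub_le_integral_sq_deriv hg hg'
          (fromRef_mem_Icc hab (lobattoNodes_subset_Icc hk hζ)) (by simp [hab.le])
      · exact hMb ζ hζ _ (toRef_mem_Icc hab hx)
    refine (Finset.sum_le_sum this).trans ?_
    rw [Finset.sum_const, card_lobattoNodes hk, nsmul_eq_mul]
    push_cast
    exact le_rfl
  calc interpDeriv k a b g x ^ 2 = |interpDeriv k a b g x| ^ 2 := (sq_abs _).symm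
    _ ≤ ((k + 1) * (Real.sqrt D * (M * (2 / (b - a))))) ^ 2 := by gcongr
    _ = ((k + 1 : ℝ) * M * 2) ^ 2 * ((b - a)⁻¹) ^ 2 * Real.sqrt D ^ 2 := by
        rw [div_eq_mul_inv]; ring
    _ = _ := by
        rw [Real.sq_sqrt hD0, hD]
        field_simp

theorem deriv_continuous {g : ℝ → ℝ} (hg : ContDiff ℝ ∞ g) : Continuous (deriv g) :=
  hg.continuous_deriv (by simp)

theorem smooth_hasDerivAt {g : ℝ → ℝ} (hg : ContDiff ℝ ∞ g) (t : ℝ) :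
    HasDerivAt g (deriv g t) t := (hg.differentiable (by simp) t).hasDerivAt

/-- A decomposition of the derivative of the interpolation error: polynomial part plus remainder. -/
theorem exists_interp_error_decomp {k : ℕ} (hk : 1 ≤ k) : ∃ C : ℝ, 0 < C ∧ ∀ (a b : ℝ), a < b →
    ∀ g : ℝ → ℝ, ContDiff ℝ ∞ g → ∀ n : ℕ, 1 ≤ n → ∃ p : ℝ[X], p.natDegree ≤ n ∧
      ∀ x ∈ Icc a b, ((deriv g x - interpDeriv k a b g x) -
        ((Polynomial.derivative p).eval x - interpDeriv k a b (fun t => p.eval t) x)) ^ 2 ≤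
        C * (b - a) ^ (2 * n - 1) * ∫ t in a..b, iteratedDeriv (n + 1) g t ^ 2 := by
  obtain ⟨C, hC, hCb⟩ := exists_sq_interpDeriv_le hk
  refine ⟨2 + 2 * C, by positivity, fun a b hab g hg n hn => ?_⟩
  have hba : 0 < b - a := sub_pos.2 hab
  obtain ⟨p, hp, hpb⟩ := exists_polynomial_sq_deriv_sub_le hab.le hn hg
  refine ⟨p, hp, fun x hx => ?_⟩
  have hcont : Continuous fun t => deriv g t - (Polynomial.derivative p).eval t :=
    (deriv_continuous hg).sub (Polynomial.continuous _)
  -- Stability of the interpolation is applied to the Taylor remainder `g - p`; integrating the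
  -- pointwise bound supplies the factor `b - a` that cancels `(b - a)⁻¹`.
  have h1 := hCb a b hab (fun t => g t - p.eval t)
    (fun t => deriv g t - (Polynomial.derivative p).eval t)
    (fun t => (smooth_hasDerivAt hg t).sub (p.hasDerivAt t)) hcont x hx
  rw [interpDeriv_sub] at h1
  have h2 := intervalIntegral_sq_le_of_le hab.le hpb hcont
  set E := (b - a) ^ (2 * n - 1) * ∫ t in a..b, iteratedDeriv (n + 1) g t ^ 2 with hE
  have h3 : (interpDeriv k a b g x - interpDeriv k a b (fun t => p.eval t) x) ^ 2 ≤ C * E := by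
    refine h1.trans ?_
    calc _ ≤ C * (b - a)⁻¹ * ((b - a) * E) := by gcongr
      _ = C * E := by field_simp
  have h4 := hpb x hx
  have h5 : ((deriv g x - interpDeriv k a b g x) -
        ((Polynomial.derivative p).eval x - interpDeriv k a b (fun t => p.eval t) x)) ^ 2 ≤
      2 * (deriv g x - (Polynomial.derivative p).eval x) ^ 2 +
      2 * (interpDeriv k a b g x - interpDeriv k a b (fun t => p.eval t) x) ^ 2 := by
    nlinarith [sq_nonneg ((deriv g x - (Polynomial.derivative p).eval x) +
      (interpDeriv k a b g x - interpDeriv k a b (fun t => p.eval t) x))]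
  rw [mul_assoc, ← hE]
  nlinarith

/-- The derivative of the interpolation error, pointwise. -/
theorem exists_sq_deriv_sub_interpDeriv_le {k : ℕ} (hk : 1 ≤ k) : ∃ C : ℝ, 0 < C ∧
    ∀ (a b : ℝ), a < b → ∀ g : ℝ → ℝ, ContDiff ℝ ∞ g → ∀ x ∈ Icc a b,
      (deriv g x - interpDeriv k a b g x) ^ 2 ≤
        C * (b - a) ^ (2 * k - 1) * ∫ t in a..b, iteratedDeriv (k + 1) g t ^ 2 := by
  obtain ⟨C, hC, hCb⟩ := exists_interp_error_decomp hk
  refine ⟨C, hC, fun a b hab g hg x hx => ?_⟩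
  -- With degree `k` the polynomial part is reproduced exactly and only the remainder is left.
  obtain ⟨p, hp, hpb⟩ := hCb a b hab g hg k hk
  have h1 : (Polynomial.derivative p).eval x - interpDeriv k a b (fun t => p.eval t) x = 0 := by
    have h2 := hasDerivAt_interp k a b (fun t => p.eval t) x
    rw [show interp k a b (fun t => p.eval t) = fun t => p.eval t from
      funext fun t => interp_polynomial hk hab hp t] at h2
    rw [h2.unique (p.hasDerivAt x), sub_self]
  have h3 := hpb x hx
  rwa [h1, sub_zero] at h3

/-- The superconvergence estimate in one variable. -/
theorem exists_sq_integral_interp_error_mul_le {k : ℕ} (hk : 1 ≤ k) : ∃ C : ℝ, 0 < C ∧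
    ∀ (a b : ℝ), a < b → ∀ g : ℝ → ℝ, ContDiff ℝ ∞ g → ∀ q : ℝ[X], q.natDegree < k →
      (∫ t in a..b, (deriv g t - interpDeriv k a b g t) * q.eval t) ^ 2 ≤
        C * (b - a) ^ (2 * k + 2) * (∫ t in a..b, iteratedDeriv (k + 2) g t ^ 2) *
          ∫ t in a..b, q.eval t ^ 2 := by
  obtain ⟨C, hC, hCb⟩ := exists_interp_error_decomp hk
  refine ⟨C, hC, fun a b hab g hg q hq => ?_⟩
  -- With degree `k + 1` the polynomial part is not reproduced, but the derivative of its error is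
  -- orthogonal to `q`. The remainder then carries one more power of `b - a`.
  obtain ⟨p, hp, hpb⟩ := hCb a b hab g hg (k + 1) (by omega)
  have hc1 : Continuous fun t => deriv g t - interpDeriv k a b g t :=
    (deriv_continuous hg).sub (continuous_interpDeriv _ _ _ _)
  have hc2 : Continuous fun t => (Polynomial.derivative p).eval t -
      interpDeriv k a b (fun t => p.eval t) t :=
    (Polynomial.continuous _).sub (continuous_interpDeriv _ _ _ _)
  have h0 : ∫ t in a..b, (deriv g t - interpDeriv k a b g t) * q.eval t =
      ∫ t in a..b, ((deriv g t - interpDeriv k a b g t) - ((Polynomial.derivative p).eval t -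
        interpDeriv k a b (fun t => p.eval t) t)) * q.eval t := by
    have h1 := intervalIntegral.integral_sub (μ := volume) (a := a) (b := b)
      ((hc1.mul q.continuous).intervalIntegrable a b)
      ((hc2.mul q.continuous).intervalIntegrable a b)
    simp only [Pi.mul_apply] at h1
    rw [integral_deriv_sub_interp_polynomial hk hab hp hq, sub_zero] at h1
    rw [← h1]
    exact intervalIntegral.integral_congr fun t _ => (sub_mul _ _ _).symm
  rw [h0]
  refine (sq_intervalIntegral_mul_le hab.le (hc1.sub hc2) q.continuous).trans ?_
  refine mul_le_mul_of_nonneg_right ?_ (integral_sq_nonneg hab.le)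
  refine (intervalIntegral_sq_le_of_le hab.le hpb (hc1.sub hc2)).trans (le_of_eq ?_)
  rw [show 2 * (k + 1) - 1 = 2 * k + 1 by omega]
  ring

/-- The `L²` interpolation error. -/
theorem exists_integral_sq_sub_interp_le {k : ℕ} (hk : 1 ≤ k) : ∃ C : ℝ, 0 < C ∧
    ∀ (a b : ℝ), a < b → ∀ g : ℝ → ℝ, ContDiff ℝ ∞ g →
      ∫ t in a..b, (g t - interp k a b g t) ^ 2 ≤
        C * (b - a) ^ (2 * k + 2) * ∫ t in a..b, iteratedDeriv (k + 1) g t ^ 2 := by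
  obtain ⟨C, hC, hCb⟩ := exists_sq_deriv_sub_interpDeriv_le hk
  refine ⟨C, hC, fun a b hab g hg => ?_⟩
  have hba : 0 < b - a := sub_pos.2 hab
  have hc : Continuous fun t => deriv g t - interpDeriv k a b g t :=
    (deriv_continuous hg).sub (continuous_interpDeriv _ _ _ _)
  have h1 := intervalIntegral_sq_le_of_le hab.le (hCb a b hab g hg) hc
  -- The end point `a` is a node, so the error vanishes there and is bounded by its derivative.
  have ha : interp k a b g a = g a := by
    have e : toRef a b a = -1 := by
      have : b - a ≠ 0 := hba.ne'
      unfold toRef; field_simp; ring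
    unfold interp
    rw [e, sum_lobattoBasis (mem_lobattoNodes hk (by norm_num)) (fun ζ => g (fromRef a b ζ))]
    congr 1
    unfold fromRef; ring
  have h2 : ∀ x ∈ Icc a b, (g x - interp k a b g x) ^ 2 ≤
      (b - a) * ∫ t in a..b, (deriv g t - interpDeriv k a b g t) ^ 2 := by
    intro x hx
    have := sq_sub_le_integral_sq_deriv (g := fun t => g t - interp k a b g t)
      (g' := fun t => deriv g t - interpDeriv k a b g t) (a := a) (b := b) (x := x) (y := a)
      (fun t => (smooth_hasDerivAt hg t).sub (hasDerivAt_interp k a b g t)) hc hx (by simp [hab.le])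
    simpa [ha] using this
  refine (intervalIntegral_sq_le_of_le hab.le h2 (hg.continuous.sub
    (continuous_interp _ _ _ _))).trans ?_
  calc (b - a) * ((b - a) * ∫ t in a..b, (deriv g t - interpDeriv k a b g t) ^ 2)
      ≤ (b - a) * ((b - a) * ((b - a) * (C * (b - a) ^ (2 * k - 1) *
          ∫ t in a..b, iteratedDeriv (k + 1) g t ^ 2))) := by gcongr
    _ = C * ((b - a) ^ (2 * k - 1) * (b - a) ^ 3) *
          ∫ t in a..b, iteratedDeriv (k + 1) g t ^ 2 := by ring
    _ = _ := by rw [← pow_add, show 2 * k - 1 + 3 = 2 * k + 2 by omega]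

end


/-! ### Partial derivatives of smooth functions -/

theorem contDiff_dx {φ : ℝ × ℝ → ℝ} (h : ContDiff ℝ ∞ φ) : ContDiff ℝ ∞ (dx φ) :=
  (h.fderiv_right (m := ∞) (by simp)).clm_apply contDiff_const

theorem contDiff_dy {φ : ℝ × ℝ → ℝ} (h : ContDiff ℝ ∞ φ) : ContDiff ℝ ∞ (dy φ) :=
  (h.fderiv_right (m := ∞) (by simp)).clm_apply contDiff_const

theorem contDiff_iterate_dx {φ : ℝ × ℝ → ℝ} (h : ContDiff ℝ ∞ φ) (n : ℕ) :
    ContDiff ℝ ∞ (dx^[n] φ) := by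
  induction n with
  | zero => exact h
  | succ n ih => rw [Function.iterate_succ_apply']; exact contDiff_dx ih

theorem contDiff_iterate_dy {φ : ℝ × ℝ → ℝ} (h : ContDiff ℝ ∞ φ) (n : ℕ) :
    ContDiff ℝ ∞ (dy^[n] φ) := by
  induction n with
  | zero => exact h
  | succ n ih => rw [Function.iterate_succ_apply']; exact contDiff_dy ih

theorem hasDerivAt_slice_fst {φ : ℝ × ℝ → ℝ} (h : ContDiff ℝ ∞ φ) (x y : ℝ) :
    HasDerivAt (fun s => φ (s, y)) (dx φ (x, y)) x := by
  have h1 : HasFDerivAt φ (fderiv ℝ φ (x, y)) (x, y) := (h.differentiable (by simp) _).hasFDerivAt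
  have h2 : HasDerivAt (fun s : ℝ => (s, y)) ((1 : ℝ), (0 : ℝ)) x :=
    (hasDerivAt_id x).prodMk (hasDerivAt_const x y)
  exact h1.comp_hasDerivAt x h2

theorem hasDerivAt_slice_snd {φ : ℝ × ℝ → ℝ} (h : ContDiff ℝ ∞ φ) (x y : ℝ) :
    HasDerivAt (fun t => φ (x, t)) (dy φ (x, y)) y := by
  have h1 : HasFDerivAt φ (fderiv ℝ φ (x, y)) (x, y) := (h.differentiable (by simp) _).hasFDerivAt
  have h2 : HasDerivAt (fun t : ℝ => (x, t)) ((0 : ℝ), (1 : ℝ)) y :=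
    (hasDerivAt_const y x).prodMk (hasDerivAt_id y)
  exact h1.comp_hasDerivAt y h2

theorem contDiff_slice_fst {φ : ℝ × ℝ → ℝ} (h : ContDiff ℝ ∞ φ) (y : ℝ) :
    ContDiff ℝ ∞ fun s => φ (s, y) := h.comp (contDiff_id.prodMk contDiff_const)

theorem contDiff_slice_snd {φ : ℝ × ℝ → ℝ} (h : ContDiff ℝ ∞ φ) (x : ℝ) :
    ContDiff ℝ ∞ fun t => φ (x, t) := h.comp (contDiff_const.prodMk contDiff_id)

theorem iteratedDeriv_slice_fst {φ : ℝ × ℝ → ℝ} (h : ContDiff ℝ ∞ φ) (n : ℕ) (x y : ℝ) :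
    iteratedDeriv n (fun s => φ (s, y)) x = dx^[n] φ (x, y) := by
  induction n generalizing φ with
  | zero => simp
  | succ n ih =>
    rw [iteratedDeriv_succ', Function.iterate_succ_apply, ← ih (contDiff_dx h)]
    congr 1
    funext s
    exact (hasDerivAt_slice_fst h s y).deriv

theorem iteratedDeriv_slice_snd {φ : ℝ × ℝ → ℝ} (h : ContDiff ℝ ∞ φ) (n : ℕ) (x y : ℝ) :
    iteratedDeriv n (fun t => φ (x, t)) y = dy^[n] φ (x, y) := by
  induction n generalizing φ with
  | zero => simp
  | succ n ih =>
    rw [iteratedDeriv_succ', Function.iterate_succ_apply, ← ih (contDiff_dy h)]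
    congr 1
    funext s
    exact (hasDerivAt_slice_snd h x s).deriv

theorem dx_dy_comm {φ : ℝ × ℝ → ℝ} (h : ContDiff ℝ ∞ φ) : dx (dy φ) = dy (dx φ) := by
  funext p
  have hs : IsSymmSndFDerivAt ℝ φ p := h.contDiffAt.isSymmSndFDerivAt (by
    rw [minSmoothness_of_isRCLikeNormedField]
    exact WithTop.coe_le_coe.2 (le_top : (2 : ℕ∞) ≤ ⊤))
  have hd : DifferentiableAt ℝ (fderiv ℝ φ) p :=
    (h.fderiv_right (m := ∞) (by simp)).differentiable (by simp) p
  have key : ∀ v w : ℝ × ℝ, fderiv ℝ (fun q => fderiv ℝ φ q v) p w = fderiv ℝ (fderiv ℝ φ) p w v := by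
    intro v w
    rw [fderiv_clm_apply hd (differentiableAt_const v)]
    simp
  change fderiv ℝ (fun q => fderiv ℝ φ q (0, 1)) p (1, 0) =
    fderiv ℝ (fun q => fderiv ℝ φ q (1, 0)) p (0, 1)
  rw [key, key]
  exact hs _ _

theorem dx_iterate_dy_comm {φ : ℝ × ℝ → ℝ} (h : ContDiff ℝ ∞ φ) (n : ℕ) :
    dx (dy^[n] φ) = dy^[n] (dx φ) := by
  induction n with
  | zero => rfl
  | succ n ih =>
    rw [Function.iterate_succ_apply', Function.iterate_succ_apply',
      dx_dy_comm (contDiff_iterate_dy h n), ih]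

theorem iterate_dx_dy_comm {φ : ℝ × ℝ → ℝ} (h : ContDiff ℝ ∞ φ) (n : ℕ) :
    dx^[n] (dy φ) = dy (dx^[n] φ) := by
  induction n with
  | zero => rfl
  | succ n ih =>
    rw [Function.iterate_succ_apply', Function.iterate_succ_apply', ih,
      dx_dy_comm (contDiff_iterate_dx h n)]

/-- Reflection in the diagonal: the interpolation error estimates are proved for `∂_x` only and
carried over to `∂_y` by `Prod.swap`. -/
theorem dx_comp_swap {φ : ℝ × ℝ → ℝ} (h : ContDiff ℝ ∞ φ) :
    dx (φ ∘ Prod.swap) = dy φ ∘ Prod.swap := by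
  funext ⟨x, y⟩
  have h1 := hasDerivAt_slice_fst (h.comp (contDiff_snd.prodMk contDiff_fst) :
    ContDiff ℝ ∞ (φ ∘ Prod.swap)) x y
  exact h1.unique (hasDerivAt_slice_snd h y x)

theorem contDiff_comp_swap {φ : ℝ × ℝ → ℝ} (h : ContDiff ℝ ∞ φ) :
    ContDiff ℝ ∞ (φ ∘ Prod.swap) := h.comp (contDiff_snd.prodMk contDiff_fst)

theorem dy_comp_swap {φ : ℝ × ℝ → ℝ} (h : ContDiff ℝ ∞ φ) :
    dy (φ ∘ Prod.swap) = dx φ ∘ Prod.swap := by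
  have := dx_comp_swap (contDiff_comp_swap h)
  have h2 : (φ ∘ Prod.swap) ∘ Prod.swap = φ := by funext p; simp
  rw [h2] at this
  rw [this]
  funext p; simp

theorem iterate_dx_comp_swap {φ : ℝ × ℝ → ℝ} (h : ContDiff ℝ ∞ φ) (n : ℕ) :
    dx^[n] (φ ∘ Prod.swap) = dy^[n] φ ∘ Prod.swap := by
  induction n with
  | zero => rfl
  | succ n ih =>
    rw [Function.iterate_succ_apply', Function.iterate_succ_apply', ih,
      dx_comp_swap (contDiff_iterate_dy h n)]

theorem iterate_dy_comp_swap {φ : ℝ × ℝ → ℝ} (h : ContDiff ℝ ∞ φ) (n : ℕ) :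
    dy^[n] (φ ∘ Prod.swap) = dx^[n] φ ∘ Prod.swap := by
  induction n with
  | zero => rfl
  | succ n ih =>
    rw [Function.iterate_succ_apply', Function.iterate_succ_apply', ih,
      dy_comp_swap (contDiff_iterate_dx h n)]

theorem dx_add {φ ψ : ℝ × ℝ → ℝ} (h : ContDiff ℝ ∞ φ) (h' : ContDiff ℝ ∞ ψ) :
    dx (φ + ψ) = dx φ + dx ψ := by
  funext p
  simp only [dx, Pi.add_apply]
  rw [fderiv_add (h.differentiable (by simp) p) (h'.differentiable (by simp) p)]
  rfl

theorem dy_add {φ ψ : ℝ × ℝ → ℝ} (h : ContDiff ℝ ∞ φ) (h' : ContDiff ℝ ∞ ψ) :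
    dy (φ + ψ) = dy φ + dy ψ := by
  funext p
  simp only [dy, Pi.add_apply]
  rw [fderiv_add (h.differentiable (by simp) p) (h'.differentiable (by simp) p)]
  rfl

theorem dx_smul (c : ℝ) {φ : ℝ × ℝ → ℝ} (h : ContDiff ℝ ∞ φ) : dx (c • φ) = c • dx φ := by
  funext p
  simp only [dx, Pi.smul_apply]
  rw [fderiv_const_smul (h.differentiable (by simp) p)]
  rfl

theorem dy_smul (c : ℝ) {φ : ℝ × ℝ → ℝ} (h : ContDiff ℝ ∞ φ) : dy (c • φ) = c • dy φ := by
  funext p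
  simp only [dy, Pi.smul_apply]
  rw [fderiv_const_smul (h.differentiable (by simp) p)]
  rfl

theorem dx_sub {φ ψ : ℝ × ℝ → ℝ} (h : ContDiff ℝ ∞ φ) (h' : ContDiff ℝ ∞ ψ) :
    dx (φ - ψ) = dx φ - dx ψ := by
  funext p
  simp only [dx, Pi.sub_apply]
  rw [fderiv_sub (h.differentiable (by simp) p) (h'.differentiable (by simp) p)]
  rfl

theorem dy_sub {φ ψ : ℝ × ℝ → ℝ} (h : ContDiff ℝ ∞ φ) (h' : ContDiff ℝ ∞ ψ) :
    dy (φ - ψ) = dy φ - dy ψ := by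
  funext p
  simp only [dy, Pi.sub_apply]
  rw [fderiv_sub (h.differentiable (by simp) p) (h'.differentiable (by simp) p)]
  rfl

theorem iterate_dx_sub {φ ψ : ℝ × ℝ → ℝ} (h : ContDiff ℝ ∞ φ) (h' : ContDiff ℝ ∞ ψ) (n : ℕ) :
    dx^[n] (φ - ψ) = dx^[n] φ - dx^[n] ψ := by
  induction n with
  | zero => rfl
  | succ n ih =>
    simp only [Function.iterate_succ_apply']
    rw [ih, dx_sub (contDiff_iterate_dx h n) (contDiff_iterate_dx h' n)]

theorem iterate_dy_sub {φ ψ : ℝ × ℝ → ℝ} (h : ContDiff ℝ ∞ φ) (h' : ContDiff ℝ ∞ ψ) (n : ℕ) :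
    dy^[n] (φ - ψ) = dy^[n] φ - dy^[n] ψ := by
  induction n with
  | zero => rfl
  | succ n ih =>
    simp only [Function.iterate_succ_apply']
    rw [ih, dy_sub (contDiff_iterate_dy h n) (contDiff_iterate_dy h' n)]

/-! ### Integrals over rectangles -/

theorem Rect.isCompact_toSet (T : Rect) : IsCompact T.toSet := isCompact_Icc.prod isCompact_Icc

theorem Rect.measurableSet_toSet (T : Rect) : MeasurableSet T.toSet :=
  T.isCompact_toSet.measurableSet

theorem Rect.isOpen_openSet (T : Rect) : IsOpen T.openSet := isOpen_Ioo.prod isOpen_Ioo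

theorem Rect.openSet_subset (T : Rect) : T.openSet ⊆ T.toSet :=
  prod_mono Ioo_subset_Icc_self Ioo_subset_Icc_self

theorem Rect.openSet_nonempty (T : Rect) : T.openSet.Nonempty :=
  (nonempty_Ioo.2 T.hab).prod (nonempty_Ioo.2 T.hcd)

theorem Rect.closure_openSet (T : Rect) : closure T.openSet = T.toSet := by
  unfold Rect.openSet Rect.toSet
  rw [closure_prod_eq, closure_Ioo T.hab.ne, closure_Ioo T.hcd.ne]

/-- The boundary is a null set. This connects integrals over closed elements with weak derivatives,
which live on the open set `Ω`. -/
theorem Rect.restrict_toSet_eq (T : Rect) :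
    (volume : Measure (ℝ × ℝ)).restrict T.toSet = volume.restrict T.openSet := by
  unfold Rect.openSet Rect.toSet
  rw [Measure.volume_eq_prod, ← Measure.prod_restrict, ← Measure.prod_restrict,
    restrict_Ioo_eq_restrict_Icc, restrict_Ioo_eq_restrict_Icc]

theorem integrableOn_rect {F : ℝ × ℝ → ℝ} {T : Rect} (hF : ContinuousOn F T.toSet) :
    IntegrableOn F T.toSet := hF.integrableOn_compact T.isCompact_toSet

theorem setIntegral_rect {F : ℝ × ℝ → ℝ} (hF : Continuous F) (T : Rect) :
    ∫ p in T.toSet, F p = ∫ x in T.a..T.b, ∫ y in T.c..T.d, F (x, y) := by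
  have h := integrableOn_rect (T := T) hF.continuousOn
  unfold Rect.toSet at h ⊢
  rw [Measure.volume_eq_prod] at h ⊢
  rw [setIntegral_prod F h, intervalIntegral.integral_of_le T.hab.le, integral_Icc_eq_integral_Ioc]
  simp only [intervalIntegral.integral_of_le T.hcd.le, integral_Icc_eq_integral_Ioc]

theorem continuous_integral_snd {F : ℝ × ℝ → ℝ} (hF : Continuous F) (c d : ℝ) :
    Continuous fun x => ∫ y in c..d, F (x, y) :=
  intervalIntegral.continuous_parametric_intervalIntegral_of_continuous' (f := fun x y => F (x, y))
    hF c d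

theorem continuous_integral_fst {F : ℝ × ℝ → ℝ} (hF : Continuous F) (a b : ℝ) :
    Continuous fun y => ∫ x in a..b, F (x, y) :=
  continuous_integral_snd (F := F ∘ Prod.swap) (hF.comp continuous_swap) a b

theorem integral_swap {F : ℝ × ℝ → ℝ} (hF : Continuous F) (a b c d : ℝ) :
    ∫ x in a..b, ∫ y in c..d, F (x, y) = ∫ y in c..d, ∫ x in a..b, F (x, y) := by
  refine intervalIntegral_intervalIntegral_swap ?_
  have h : IntegrableOn F (uIcc a b ×ˢ uIcc c d) (volume.prod volume) :=
    hF.continuousOn.integrableOn_compact (isCompact_uIcc.prod isCompact_uIcc)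
  have h2 := h.mono_set (prod_mono (uIoc_subset_uIcc (a := a) (b := b))
    (uIoc_subset_uIcc (a := c) (b := d)))
  exact h2

theorem setIntegral_rect' {F : ℝ × ℝ → ℝ} (hF : Continuous F) (T : Rect) :
    ∫ p in T.toSet, F p = ∫ y in T.c..T.d, ∫ x in T.a..T.b, F (x, y) := by
  rw [setIntegral_rect hF, integral_swap hF]

/-! ### Green's formula -/

/-- The boundary integral of `v q·n` over the edges of a rectangle. -/
theorem sum_side_normal (T : Rect) (v : Fin 4 → ℝ → ℝ) (q₁ q₂ : ℝ × ℝ → ℝ) :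
    ∑ i, ∫ t in (T.side i).lo..(T.side i).hi, v i t *
        (q₁ ((T.side i).point t) * (normal i).1 + q₂ ((T.side i).point t) * (normal i).2) =
      -(∫ t in T.a..T.b, v 0 t * q₂ (t, T.c)) + (∫ t in T.a..T.b, v 1 t * q₂ (t, T.d)) -
        (∫ t in T.c..T.d, v 2 t * q₁ (T.a, t)) + ∫ t in T.c..T.d, v 3 t * q₁ (T.b, t) := by
  simp only [Fin.sum_univ_four, Rect.side, normal, Edge.lo, Edge.hi, Edge.point, Matrix.cons_val]
  simp only [mul_zero, zero_add, add_zero, mul_one, mul_neg, intervalIntegral.integral_neg]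
  ring

theorem integral_mul_dx {v q : ℝ × ℝ → ℝ} (hv : ContDiff ℝ ∞ v) (hq : ContDiff ℝ ∞ q) (T : Rect) :
    ∫ p in T.toSet, v p * dx q p = -(∫ p in T.toSet, q p * dx v p) -
      (∫ t in T.c..T.d, v (T.a, t) * q (T.a, t)) + ∫ t in T.c..T.d, v (T.b, t) * q (T.b, t) := by
  have c1 : Continuous fun p => v p * dx q p := hv.continuous.mul (contDiff_dx hq).continuous
  have c2 : Continuous fun p => q p * dx v p := hq.continuous.mul (contDiff_dx hv).continuous
  rw [setIntegral_rect' c1, setIntegral_rect' c2]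
  have h1 : ∀ y, ∫ x in T.a..T.b, v (x, y) * dx q (x, y) =
      v (T.b, y) * q (T.b, y) - v (T.a, y) * q (T.a, y) - ∫ x in T.a..T.b, q (x, y) * dx v (x, y) := by
    intro y
    rw [intervalIntegral.integral_mul_deriv_eq_deriv_mul (u := fun x => v (x, y))
      (u' := fun x => dx v (x, y)) (v := fun x => q (x, y)) (v' := fun x => dx q (x, y))
      (fun x _ => hasDerivAt_slice_fst hv x y) (fun x _ => hasDerivAt_slice_fst hq x y)
      (((contDiff_slice_fst (contDiff_dx hv) y).continuous).intervalIntegrable _ _)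
      (((contDiff_slice_fst (contDiff_dx hq) y).continuous).intervalIntegrable _ _)]
    simp_rw [mul_comm]
  simp_rw [h1]
  have c3 : ∀ x : ℝ, Continuous fun y => v (x, y) * q (x, y) := fun x =>
    (contDiff_slice_snd hv x).continuous.mul (contDiff_slice_snd hq x).continuous
  rw [intervalIntegral.integral_sub, intervalIntegral.integral_sub]
  · ring
  · exact (c3 _).intervalIntegrable _ _
  · exact (c3 _).intervalIntegrable _ _
  · exact ((c3 _).sub (c3 _)).intervalIntegrable _ _
  · exact (continuous_integral_fst c2 _ _).intervalIntegrable _ _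

theorem integral_mul_dy {v q : ℝ × ℝ → ℝ} (hv : ContDiff ℝ ∞ v) (hq : ContDiff ℝ ∞ q) (T : Rect) :
    ∫ p in T.toSet, v p * dy q p = -(∫ p in T.toSet, q p * dy v p) -
      (∫ t in T.a..T.b, v (t, T.c) * q (t, T.c)) + ∫ t in T.a..T.b, v (t, T.d) * q (t, T.d) := by
  have h := integral_mul_dx (contDiff_comp_swap hv) (contDiff_comp_swap hq)
    ⟨T.c, T.d, T.a, T.b, T.hcd, T.hab⟩
  have c1 : Continuous fun p => v p * dy q p := hv.continuous.mul (contDiff_dy hq).continuous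
  have c2 : Continuous fun p => q p * dy v p := hq.continuous.mul (contDiff_dy hv).continuous
  rw [dx_comp_swap hv, dx_comp_swap hq, setIntegral_rect', setIntegral_rect'] at h
  · rw [setIntegral_rect c1, setIntegral_rect c2]
    exact h
  · exact c2.comp continuous_swap
  · exact c1.comp continuous_swap

/-- Green's formula on a rectangle. -/
theorem green_rect {v q₁ q₂ : ℝ × ℝ → ℝ} (hv : ContDiff ℝ ∞ v) (hq₁ : ContDiff ℝ ∞ q₁)
    (hq₂ : ContDiff ℝ ∞ q₂) (T : Rect) :
    ∫ p in T.toSet, v p * (dx q₁ p + dy q₂ p) =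
      -(∫ p in T.toSet, (q₁ p * dx v p + q₂ p * dy v p)) +
      ∑ i, ∫ t in (T.side i).lo..(T.side i).hi, v ((T.side i).point t) *
        (q₁ ((T.side i).point t) * (normal i).1 + q₂ ((T.side i).point t) * (normal i).2) := by
  have c1 := contDiff_dx hv |>.continuous
  have c2 := contDiff_dy hv |>.continuous
  have c3 := contDiff_dx hq₁ |>.continuous
  have c4 := contDiff_dy hq₂ |>.continuous
  have c5 := hv.continuous
  have c6 := hq₁.continuous
  have c7 := hq₂.continuous
  rw [sum_side_normal T (fun i t => v ((T.side i).point t)) q₁ q₂]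
  simp only [mul_add]
  rw [integral_add, integral_add, integral_mul_dx hv hq₁, integral_mul_dy hv hq₂]
  · simp only [Rect.side, Edge.point, Matrix.cons_val]
    ring
  all_goals exact integrableOn_rect (by fun_prop)

/-! ### Polynomial spaces -/

theorem Q_induction {i j : ℕ} {p : (ℝ × ℝ → ℝ) → Prop}
    (hmono : ∀ m n : ℕ, m ≤ i → n ≤ j → p fun z => z.1 ^ m * z.2 ^ n) (hzero : p 0)
    (hadd : ∀ f g, p f → p g → p (f + g)) (hsmul : ∀ (c : ℝ) f, p f → p (c • f))
    {q : ℝ × ℝ → ℝ} (hq : q ∈ Q i j) : p q := by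
  refine Submodule.span_induction (p := fun x _ => p x) ?_ hzero (fun x y _ _ => hadd x y)
    (fun c x _ => hsmul c x) hq
  rintro _ ⟨m, n, hm, hn, rfl⟩
  exact hmono m n hm hn

theorem mono_mem_Q {i j m n : ℕ} (hm : m ≤ i) (hn : n ≤ j) :
    (fun z : ℝ × ℝ => z.1 ^ m * z.2 ^ n) ∈ Q i j := Submodule.subset_span ⟨m, n, hm, hn, rfl⟩

theorem contDiff_of_mem_Q {i j : ℕ} {q : ℝ × ℝ → ℝ} (hq : q ∈ Q i j) : ContDiff ℝ ∞ q := by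
  refine Q_induction (p := fun q => ContDiff ℝ ∞ q) ?_ contDiff_const ?_ ?_ hq
  · intro m n _ _
    fun_prop
  · intro f g hf hg
    exact hf.add hg
  · intro c f hf
    exact hf.const_smul c

theorem slice_fst_of_mem_Q {i j : ℕ} {q : ℝ × ℝ → ℝ} (hq : q ∈ Q i j) (y : ℝ) :
    ∃ P : ℝ[X], P.natDegree ≤ i ∧ ∀ x, P.eval x = q (x, y) := by
  refine Q_induction (p := fun q => ∃ P : ℝ[X], P.natDegree ≤ i ∧ ∀ x, P.eval x = q (x, y))
    ?_ ?_ ?_ ?_ hq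
  · intro m n hm _
    exact ⟨Polynomial.C (y ^ n) * Polynomial.X ^ m,
      (Polynomial.natDegree_C_mul_X_pow_le _ _).trans hm, fun x => by simp [mul_comm]⟩
  · exact ⟨0, by simp, by simp⟩
  · rintro f g ⟨P, hP, hP'⟩ ⟨R, hR, hR'⟩
    exact ⟨P + R, (Polynomial.natDegree_add_le _ _).trans (max_le hP hR), fun x => by
      simp [hP', hR']⟩
  · rintro c f ⟨P, hP, hP'⟩
    exact ⟨Polynomial.C c * P, (Polynomial.natDegree_C_mul_le _ _).trans hP, fun x => by
      simp [hP']⟩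

theorem comp_swap_mem_Q {i j : ℕ} {q : ℝ × ℝ → ℝ} (hq : q ∈ Q i j) : q ∘ Prod.swap ∈ Q j i := by
  refine Q_induction (p := fun q => q ∘ Prod.swap ∈ Q j i) ?_ ?_ ?_ ?_ hq
  · intro m n hm hn
    have := mono_mem_Q hn hm
    convert this using 1
    funext z
    simp [mul_comm]
  · exact Submodule.zero_mem _
  · intro f g hf hg
    exact Submodule.add_mem _ hf hg
  · intro c f hf
    exact Submodule.smul_mem _ c hf

theorem dx_mem_Q {i j : ℕ} {q : ℝ × ℝ → ℝ} (hq : q ∈ Q i j) : dx q ∈ Q (i - 1) j := by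
  refine (Q_induction (p := fun q => ContDiff ℝ ∞ q ∧ dx q ∈ Q (i - 1) j) ?_ ?_ ?_ ?_ hq).2
  · intro m n hm hn
    have hc : ContDiff ℝ ∞ fun z : ℝ × ℝ => z.1 ^ m * z.2 ^ n := by fun_prop
    refine ⟨hc, ?_⟩
    have : dx (fun z : ℝ × ℝ => z.1 ^ m * z.2 ^ n) =
        (m : ℝ) • fun z : ℝ × ℝ => z.1 ^ (m - 1) * z.2 ^ n := by
      funext ⟨x, y⟩
      refine (hasDerivAt_slice_fst hc x y).unique ?_
      simpa [mul_assoc] using (hasDerivAt_pow m x).mul_const (y ^ n)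
    rw [this]
    exact Submodule.smul_mem _ _ (mono_mem_Q (by omega) hn)
  · refine ⟨contDiff_const, ?_⟩
    have : dx (0 : ℝ × ℝ → ℝ) = 0 := by funext p; simp [dx]
    rw [this]
    exact Submodule.zero_mem _
  · rintro f g ⟨hf, hf'⟩ ⟨hg, hg'⟩
    refine ⟨hf.add hg, ?_⟩
    rw [dx_add hf hg]
    exact Submodule.add_mem _ hf' hg'
  · rintro c f ⟨hf, hf'⟩
    refine ⟨hf.const_smul c, ?_⟩
    rw [dx_smul c hf]
    exact Submodule.smul_mem _ _ hf'

theorem dy_mem_Q {i j : ℕ} {q : ℝ × ℝ → ℝ} (hq : q ∈ Q i j) : dy q ∈ Q i (j - 1) := by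
  have h1 := comp_swap_mem_Q (dx_mem_Q (comp_swap_mem_Q hq))
  rw [dx_comp_swap (contDiff_of_mem_Q hq)] at h1
  convert h1 using 1
  funext p; simp

theorem mul_mem_Q {i j : ℕ} {p r : ℝ[X]} (hp : p.natDegree ≤ i) (hr : r.natDegree ≤ j) :
    (fun z : ℝ × ℝ => p.eval z.1 * r.eval z.2) ∈ Q i j := by
  have : (fun z : ℝ × ℝ => p.eval z.1 * r.eval z.2) = ∑ m ∈ Finset.range (i + 1),
      ∑ n ∈ Finset.range (j + 1), (p.coeff m * r.coeff n) • fun z : ℝ × ℝ => z.1 ^ m * z.2 ^ n := by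
    funext z
    rw [Polynomial.eval_eq_sum_range' (n := i + 1) (by omega),
      Polynomial.eval_eq_sum_range' (n := j + 1) (by omega), Finset.sum_mul_sum]
    simp only [Finset.sum_apply, Pi.smul_apply, smul_eq_mul]
    refine Finset.sum_congr rfl fun m _ => Finset.sum_congr rfl fun n _ => ?_
    ring
  rw [this]
  refine Submodule.sum_mem _ fun m hm => Submodule.sum_mem _ fun n hn => Submodule.smul_mem _ _ ?_
  rw [Finset.mem_range] at hm hn
  exact mono_mem_Q (by omega) (by omega)

theorem exists_polynomial_comp_toRef (a b : ℝ) (p : ℝ[X]) : ∃ P : ℝ[X],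
    P.natDegree ≤ p.natDegree ∧ ∀ x, P.eval x = p.eval (toRef a b x) := by
  refine ⟨p.comp (Polynomial.C (2 / (b - a)) * Polynomial.X + Polynomial.C (-(a + b) / (b - a))),
    ?_, ?_⟩
  · refine Polynomial.natDegree_comp_le.trans ?_
    have : (Polynomial.C (2 / (b - a)) * Polynomial.X +
        Polynomial.C (-(a + b) / (b - a)) : ℝ[X]).natDegree ≤ 1 := by
      refine (Polynomial.natDegree_add_le _ _).trans ?_
      simp only [Polynomial.natDegree_C, zero_le, sup_of_le_left]
      exact (Polynomial.natDegree_C_mul_le _ _).trans Polynomial.natDegree_X_le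
    nlinarith
  · intro x
    simp only [Polynomial.eval_comp, Polynomial.eval_add, Polynomial.eval_mul, Polynomial.eval_C,
      Polynomial.eval_X, toRef]
    congr 1
    ring

theorem natDegree_lobattoBasis {k : ℕ} (hk : 1 ≤ k) {ζ : ℝ} (hζ : ζ ∈ lobattoNodes k) :
    (lobattoBasis k ζ).natDegree = k := by
  unfold lobattoBasis
  rw [Lagrange.natDegree_basis Function.injective_id.injOn hζ, card_lobattoNodes hk]
  rfl

theorem interpRect_mem_Q {k : ℕ} (hk : 1 ≤ k) (u : ℝ × ℝ → ℝ) (T : Rect) :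
    interpRect k u T ∈ Q k k := by
  have : interpRect k u T = ∑ ζ ∈ lobattoNodes k, ∑ η ∈ lobattoNodes k,
      u (fromRef T.a T.b ζ, fromRef T.c T.d η) • fun p : ℝ × ℝ =>
        (lobattoBasis k ζ).eval (toRef T.a T.b p.1) *
          (lobattoBasis k η).eval (toRef T.c T.d p.2) := by
    funext p
    simp only [interpRect, Finset.sum_apply, Pi.smul_apply, smul_eq_mul, mul_assoc]
  rw [this]
  refine Submodule.sum_mem _ fun ζ hζ => Submodule.sum_mem _ fun η hη => Submodule.smul_mem _ _ ?_
  obtain ⟨p, hp, hpe⟩ := exists_polynomial_comp_toRef T.a T.b (lobattoBasis k ζ)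
  obtain ⟨r, hr, hre⟩ := exists_polynomial_comp_toRef T.c T.d (lobattoBasis k η)
  rw [natDegree_lobattoBasis hk hζ] at hp
  rw [natDegree_lobattoBasis hk hη] at hr
  simp_rw [← hpe, ← hre]
  exact mul_mem_Q hp hr

theorem interpEdge_mem_P {k : ℕ} (hk : 1 ≤ k) (u : ℝ × ℝ → ℝ) (e : Edge) :
    interpEdge k u e ∈ P k := by
  have : interpEdge k u e = ∑ ζ ∈ lobattoNodes k, u (e.point (fromRef e.lo e.hi ζ)) •
      fun t : ℝ => (lobattoBasis k ζ).eval (toRef e.lo e.hi t) := by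
    funext p
    simp only [interpEdge, Finset.sum_apply, Pi.smul_apply, smul_eq_mul]
  rw [this]
  refine Submodule.sum_mem _ fun ζ hζ => Submodule.smul_mem _ _ ?_
  obtain ⟨p, hp, hpe⟩ := exists_polynomial_comp_toRef e.lo e.hi (lobattoBasis k ζ)
  rw [natDegree_lobattoBasis hk hζ] at hp
  simp_rw [← hpe]
  have h2 : (fun t => p.eval t) = ∑ m ∈ Finset.range (k + 1), p.coeff m • fun t : ℝ => t ^ m := by
    funext t
    rw [Polynomial.eval_eq_sum_range' (n := k + 1) (by omega)]
    simp
  rw [h2]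
  refine Submodule.sum_mem _ fun m hm => Submodule.smul_mem _ _ (Submodule.subset_span ⟨m, ?_, rfl⟩)
  rw [Finset.mem_range] at hm
  omega

theorem continuous_of_mem_P {k : ℕ} {g : ℝ → ℝ} (hg : g ∈ P k) : Continuous g := by
  refine Submodule.span_induction (p := fun g _ => Continuous g) ?_ continuous_const
    (fun f g _ _ hf hg => hf.add hg) (fun c f _ hf => hf.const_smul c) hg
  rintro _ ⟨m, -, rfl⟩
  fun_prop

/-- A polynomial in one variable with infinitely many zeros is zero; this is used first along
horizontal, then along vertical lines. It makes the `L²(T)` form on `W_k` definite. -/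
theorem eq_zero_of_mem_Q {i j : ℕ} {q : ℝ × ℝ → ℝ} (hq : q ∈ Q i j) (T : Rect)
    (h : ∀ p ∈ T.openSet, q p = 0) : q = 0 := by
  have h1 : ∀ y ∈ Ioo T.c T.d, ∀ x, q (x, y) = 0 := by
    intro y hy x
    obtain ⟨P, -, hP⟩ := slice_fst_of_mem_Q hq y
    have : P = 0 := by
      refine Polynomial.eq_zero_of_infinite_isRoot P ((Ioo_infinite T.hab).mono fun x hx => ?_)
      change P.eval x = 0
      rw [hP]
      exact h _ ⟨hx, hy⟩
    rw [← hP, this, Polynomial.eval_zero]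
  funext ⟨x, y⟩
  obtain ⟨P, -, hP⟩ := slice_fst_of_mem_Q (comp_swap_mem_Q hq) x
  have : P = 0 := by
    refine Polynomial.eq_zero_of_infinite_isRoot P ((Ioo_infinite T.hcd).mono fun y hy => ?_)
    change P.eval y = 0
    rw [hP]
    exact h1 y hy x
  have h2 := hP y
  rw [this, Polynomial.eval_zero] at h2
  exact h2.symm

instance finiteDimensional_Q (i j : ℕ) : FiniteDimensional ℝ (Q i j) := by
  refine FiniteDimensional.span_of_finite ℝ ?_
  refine ((Set.finite_Iic i).prod (Set.finite_Iic j)).image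
    (fun mn : ℕ × ℕ => fun p : ℝ × ℝ => p.1 ^ mn.1 * p.2 ^ mn.2) |>.subset ?_
  rintro _ ⟨m, n, hm, hn, rfl⟩
  exact ⟨(m, n), ⟨hm, hn⟩, rfl⟩

instance finiteDimensional_W (r : ℕ) : FiniteDimensional ℝ (W r) :=
  Module.Finite.iff_fg.2 (Submodule.FG.prod (Module.Finite.iff_fg.1 inferInstance)
    (Module.Finite.iff_fg.1 inferInstance))

section

/-! ### Representation of functionals on finite-dimensional spaces -/

/-- A definite form gives an injective map from `V` to its dual, which is onto because the
dimensions agree. -/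
theorem exists_forall_apply_eq {V : Type*} [AddCommGroup V] [Module ℝ V] [FiniteDimensional ℝ V]
    (B : V →ₗ[ℝ] V →ₗ[ℝ] ℝ) (hB : ∀ v, B v v = 0 → v = 0) (l : V →ₗ[ℝ] ℝ) :
    ∃ g, ∀ q, B g q = l q := by
  have hinj : Function.Injective B := by
    rw [injective_iff_map_eq_zero]
    intro v hv
    exact hB v (by rw [hv]; rfl)
  have hsurj := (LinearMap.injective_iff_surjective_of_finrank_eq_finrank
    (Subspace.dual_finrank_eq (K := ℝ) (V := V)).symm (f := B)).1 hinj
  obtain ⟨g, hg⟩ := hsurj l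
  exact ⟨g, fun q => by rw [hg]⟩

/-- Evaluation on the polynomials of degree at most `k` is given by an `L²(-1,1)` inner product. -/
theorem exists_polynomial_integral_mul_eq_eval (k : ℕ) (x₀ : ℝ) : ∃ r : ℝ[X], ∀ p : ℝ[X],
    p.natDegree ≤ k → ∫ x in (-1 : ℝ)..1, r.eval x * p.eval x = p.eval x₀ := by
  have hint : ∀ p q : ℝ[X], IntervalIntegrable (fun x => p.eval x * q.eval x) volume (-1) 1 :=
    fun p q => (p.continuous.mul q.continuous).intervalIntegrable _ _
  let B : Polynomial.degreeLT ℝ (k + 1) →ₗ[ℝ] Polynomial.degreeLT ℝ (k + 1) →ₗ[ℝ] ℝ :=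
    LinearMap.mk₂ ℝ (fun p q => ∫ x in (-1 : ℝ)..1, p.1.eval x * q.1.eval x)
      (fun p q r => by
        simp only [Submodule.coe_add, Polynomial.eval_add, add_mul]
        exact intervalIntegral.integral_add (hint _ _) (hint _ _))
      (fun c p q => by
        simp only [Submodule.coe_smul, Polynomial.eval_smul, smul_eq_mul, mul_assoc]
        exact intervalIntegral.integral_const_mul _ _)
      (fun p q r => by
        simp only [Submodule.coe_add, Polynomial.eval_add, mul_add]
        exact intervalIntegral.integral_add (hint _ _) (hint _ _))
      (fun c p q => by
        simp only [Submodule.coe_smul, Polynomial.eval_smul, smul_eq_mul, mul_left_comm _ c]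
        exact intervalIntegral.integral_const_mul _ _)
  have hB : ∀ p, B p p = 0 → p = 0 := by
    rintro ⟨p, hp⟩ h
    have h1 : ∫ x in (-1 : ℝ)..1, p.eval x * p.eval x = 0 := h
    rw [Submodule.mk_eq_zero]
    refine Polynomial.eq_zero_of_infinite_isRoot p ((Icc_infinite (by norm_num : (-1 : ℝ) < 1)).mono
      fun x hx => ?_)
    by_contra hne
    have := intervalIntegral.integral_pos (by norm_num : (-1 : ℝ) < 1)
      (p.continuous.mul p.continuous).continuousOn (fun x _ => mul_self_nonneg _)
      ⟨x, hx, mul_self_pos.2 hne⟩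
    exact this.ne' h1
  have : FiniteDimensional ℝ (Polynomial.degreeLT ℝ (k + 1)) :=
    Module.Finite.equiv (Polynomial.degreeLTEquiv ℝ (k + 1)).symm
  obtain ⟨r, hr⟩ := exists_forall_apply_eq B hB
    ((Polynomial.leval x₀).comp (Polynomial.degreeLT ℝ (k + 1)).subtype)
  refine ⟨r.1, fun p hp => ?_⟩
  have hmem : p ∈ Polynomial.degreeLT ℝ (k + 1) := by
    rw [Polynomial.mem_degreeLT]
    refine lt_of_le_of_lt Polynomial.degree_le_natDegree ?_
    exact_mod_cast (by omega : p.natDegree < k + 1)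
  exact hr ⟨p, hmem⟩

/-- The inverse trace inequality in one variable. -/
theorem exists_sq_eval_le (k : ℕ) : ∃ C : ℝ, 0 < C ∧ ∀ (a b : ℝ), a < b → ∀ p : ℝ[X],
    p.natDegree ≤ k → p.eval a ^ 2 ≤ C * (b - a)⁻¹ * ∫ x in a..b, p.eval x ^ 2 ∧
      p.eval b ^ 2 ≤ C * (b - a)⁻¹ * ∫ x in a..b, p.eval x ^ 2 := by
  -- Cauchy–Schwarz against the polynomial that represents evaluation at `x₀` on `[-1,1]`; the
  -- constant is twice its squared norm, with `2 / (b - a)` coming from the change of variables.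
  have key : ∀ x₀ : ℝ, ∃ C : ℝ, 0 ≤ C ∧ ∀ (a b : ℝ), a < b → ∀ p : ℝ[X], p.natDegree ≤ k →
      p.eval (fromRef a b x₀) ^ 2 ≤ C * (b - a)⁻¹ * ∫ x in a..b, p.eval x ^ 2 := by
    intro x₀
    obtain ⟨r, hr⟩ := exists_polynomial_integral_mul_eq_eval k x₀
    have hr0 : 0 ≤ ∫ x in (-1 : ℝ)..1, r.eval x ^ 2 := integral_sq_nonneg (by norm_num)
    refine ⟨(∫ x in (-1 : ℝ)..1, r.eval x ^ 2) * 2, by positivity, fun a b hab p hp => ?_⟩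
    have hba : 0 < b - a := sub_pos.2 hab
    obtain ⟨P, hP, hPe⟩ := exists_polynomial_comp_fromRef a b p
    have h1 := hr P (hP.trans hp)
    have h2 := sq_intervalIntegral_mul_le (by norm_num : (-1 : ℝ) ≤ 1) r.continuous P.continuous
    rw [h1, hPe] at h2
    refine h2.trans (le_of_eq ?_)
    have h4 := intervalIntegral.integral_comp_add_mul (a := -1) (b := 1)
      (fun t => p.eval t ^ 2) (c := (b - a) / 2) (by positivity) ((a + b) / 2)
    rw [show (a + b) / 2 + (b - a) / 2 * (-1) = a by ring,
      show (a + b) / 2 + (b - a) / 2 * 1 = b by ring] at h4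
    have h5 : ∫ x in (-1 : ℝ)..1, P.eval x ^ 2 =
        ∫ x in (-1 : ℝ)..1, p.eval ((a + b) / 2 + (b - a) / 2 * x) ^ 2 := by
      refine intervalIntegral.integral_congr fun x _ => ?_
      simp only [hPe]
      rfl
    rw [h5, h4, smul_eq_mul, inv_div]
    ring
  obtain ⟨C₁, h1, hC₁⟩ := key (-1)
  obtain ⟨C₂, h2, hC₂⟩ := key 1
  refine ⟨C₁ + C₂ + 1, by positivity, fun a b hab p hp => ?_⟩
  have e1 := hC₁ a b hab p hp
  have e2 := hC₂ a b hab p hp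
  rw [show fromRef a b (-1) = a by unfold fromRef; ring] at e1
  rw [show fromRef a b 1 = b by unfold fromRef; ring] at e2
  have hba : 0 < b - a := sub_pos.2 hab
  have h0 : 0 ≤ (b - a)⁻¹ * ∫ x in a..b, p.eval x ^ 2 :=
    mul_nonneg (by positivity) (integral_sq_nonneg hab.le)
  constructor
  · refine e1.trans ?_
    rw [mul_assoc, mul_assoc]
    exact mul_le_mul_of_nonneg_right (by linarith) h0
  · refine e2.trans ?_
    rw [mul_assoc, mul_assoc]
    exact mul_le_mul_of_nonneg_right (by linarith) h0

/-! ### The discrete weak gradient -/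

theorem Edge.continuous_point (e : Edge) : Continuous e.point := by
  cases e with
  | horiz a b y => exact continuous_id.prodMk continuous_const
  | vert x c d => exact continuous_const.prodMk continuous_id

/-- Riesz representation on the finite-dimensional space `W_k`. Continuity of `v₀` and `v_b` makes
the right-hand side integrable, hence linear in `q`. -/
theorem isDiscreteWeakGrad_discreteWeakGrad {k : ℕ} {T : Rect} {v : WeakFunction}
    (hv : Continuous (v.1 T)) (hvb : ∀ i, Continuous (v.2 (T.side i))) :
    IsDiscreteWeakGrad k T v (discreteWeakGrad k T v) := by
  have hex : ∃ g, IsDiscreteWeakGrad k T v g := by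
    have hs1 : ∀ q : W k, ContDiff ℝ ∞ q.1.1 := fun q => contDiff_of_mem_Q q.2.1
    have hs2 : ∀ q : W k, ContDiff ℝ ∞ q.1.2 := fun q => contDiff_of_mem_Q q.2.2
    have hc1 : ∀ q : W k, Continuous q.1.1 := fun q => (hs1 q).continuous
    have hc2 : ∀ q : W k, Continuous q.1.2 := fun q => (hs2 q).continuous
    have hint : ∀ p q : W k, IntegrableOn (fun x => p.1.1 x * q.1.1 x + p.1.2 x * q.1.2 x) T.toSet :=
      fun p q => integrableOn_rect
        (((hc1 p).mul (hc1 q)).add ((hc2 p).mul (hc2 q))).continuousOn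
    let B : W k →ₗ[ℝ] W k →ₗ[ℝ] ℝ :=
      LinearMap.mk₂ ℝ (fun p q => ∫ x in T.toSet, (p.1.1 x * q.1.1 x + p.1.2 x * q.1.2 x))
        (fun p q r => by
          rw [← integral_add (hint _ _) (hint _ _)]
          refine integral_congr_ae (.of_forall fun x => ?_)
          simp only [Submodule.coe_add, Prod.fst_add, Prod.snd_add, Pi.add_apply]
          ring)
        (fun c p q => by
          rw [smul_eq_mul, ← integral_const_mul]
          refine integral_congr_ae (.of_forall fun x => ?_)
          simp only [Submodule.coe_smul, Prod.smul_fst, Prod.smul_snd, Pi.smul_apply, smul_eq_mul]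
          ring)
        (fun p q r => by
          rw [← integral_add (hint _ _) (hint _ _)]
          refine integral_congr_ae (.of_forall fun x => ?_)
          simp only [Submodule.coe_add, Prod.fst_add, Prod.snd_add, Pi.add_apply]
          ring)
        (fun c p q => by
          rw [smul_eq_mul, ← integral_const_mul]
          refine integral_congr_ae (.of_forall fun x => ?_)
          simp only [Submodule.coe_smul, Prod.smul_fst, Prod.smul_snd, Pi.smul_apply, smul_eq_mul]
          ring)
    have hB : ∀ p, B p p = 0 → p = 0 := by
      intro p h
      have h1 : ∫ x in T.toSet, (p.1.1 x * p.1.1 x + p.1.2 x * p.1.2 x) = 0 := h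
      rw [setIntegral_eq_zero_iff_of_nonneg_ae
        (.of_forall fun x => add_nonneg (mul_self_nonneg _) (mul_self_nonneg _)) (hint p p),
        T.restrict_toSet_eq] at h1
      have h2 := Measure.eqOn_open_of_ae_eq h1 T.isOpen_openSet
        (((hc1 p).mul (hc1 p)).add ((hc2 p).mul (hc2 p))).continuousOn continuousOn_const
      have h3 : p.1.1 = 0 := eq_zero_of_mem_Q p.2.1 T fun x hx => by
        have : p.1.1 x * p.1.1 x + p.1.2 x * p.1.2 x = 0 := h2 hx
        nlinarith [mul_self_nonneg (p.1.1 x), mul_self_nonneg (p.1.2 x)]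
      have h4 : p.1.2 = 0 := eq_zero_of_mem_Q p.2.2 T fun x hx => by
        have : p.1.1 x * p.1.1 x + p.1.2 x * p.1.2 x = 0 := h2 hx
        nlinarith [mul_self_nonneg (p.1.1 x), mul_self_nonneg (p.1.2 x)]
      exact Subtype.ext (Prod.ext h3 h4)
    have hp : ∀ i, Continuous (T.side i).point := fun i => (T.side i).continuous_point
    let l : W k →ₗ[ℝ] ℝ :=
      { toFun := fun q => -(∫ p in T.toSet, v.1 T p * (dx q.1.1 p + dy q.1.2 p)) +
          ∑ i, ∫ t in (T.side i).lo..(T.side i).hi, v.2 (T.side i) t *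
          (q.1.1 ((T.side i).point t) * (normal i).1 + q.1.2 ((T.side i).point t) * (normal i).2)
        map_add' := fun q r => by
          have i1 : ∀ q : W k, IntegrableOn (fun p => v.1 T p * (dx q.1.1 p + dy q.1.2 p)) T.toSet :=
            fun q => integrableOn_rect (hv.mul ((contDiff_dx (hs1 q)).continuous.add
              (contDiff_dy (hs2 q)).continuous)).continuousOn
          have i2 : ∀ (q : W k) (i : Fin 4), IntervalIntegrable (fun t => v.2 (T.side i) t *
              (q.1.1 ((T.side i).point t) * (normal i).1 +
                q.1.2 ((T.side i).point t) * (normal i).2)) volume (T.side i).lo (T.side i).hi :=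
            fun q i => Continuous.intervalIntegrable ((hvb i).mul
              ((((hc1 q).comp (hp i)).mul continuous_const).add
                (((hc2 q).comp (hp i)).mul continuous_const))) _ _
          have e1 : ∫ p in T.toSet, v.1 T p * (dx (q + r).1.1 p + dy (q + r).1.2 p) =
              (∫ p in T.toSet, v.1 T p * (dx q.1.1 p + dy q.1.2 p)) +
              ∫ p in T.toSet, v.1 T p * (dx r.1.1 p + dy r.1.2 p) := by
            rw [← integral_add (i1 _) (i1 _)]
            refine integral_congr_ae (.of_forall fun x => ?_)
            simp only [Submodule.coe_add, Prod.fst_add, Prod.snd_add, dx_add (hs1 q) (hs1 r),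
              dy_add (hs2 q) (hs2 r), Pi.add_apply]
            ring
          have e2 : ∀ i : Fin 4, ∫ t in (T.side i).lo..(T.side i).hi, v.2 (T.side i) t *
              ((q + r).1.1 ((T.side i).point t) * (normal i).1 +
                (q + r).1.2 ((T.side i).point t) * (normal i).2) =
              (∫ t in (T.side i).lo..(T.side i).hi, v.2 (T.side i) t *
              (q.1.1 ((T.side i).point t) * (normal i).1 +
                q.1.2 ((T.side i).point t) * (normal i).2)) +
              ∫ t in (T.side i).lo..(T.side i).hi, v.2 (T.side i) t *
              (r.1.1 ((T.side i).point t) * (normal i).1 +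
                r.1.2 ((T.side i).point t) * (normal i).2) := by
            intro i
            rw [← intervalIntegral.integral_add (i2 _ _) (i2 _ _)]
            refine intervalIntegral.integral_congr fun x _ => ?_
            simp only [Submodule.coe_add, Prod.fst_add, Prod.snd_add, Pi.add_apply]
            ring
          rw [e1, Finset.sum_congr rfl fun i _ => e2 i, Finset.sum_add_distrib]
          ring
        map_smul' := fun c q => by
          have e1 : ∫ p in T.toSet, v.1 T p * (dx (c • q).1.1 p + dy (c • q).1.2 p) =
              c * ∫ p in T.toSet, v.1 T p * (dx q.1.1 p + dy q.1.2 p) := by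
            rw [← integral_const_mul]
            refine integral_congr_ae (.of_forall fun x => ?_)
            simp only [Submodule.coe_smul, Prod.smul_fst, Prod.smul_snd, dx_smul c (hs1 q),
              dy_smul c (hs2 q), Pi.smul_apply, smul_eq_mul]
            ring
          have e2 : ∀ i : Fin 4, ∫ t in (T.side i).lo..(T.side i).hi, v.2 (T.side i) t *
              ((c • q).1.1 ((T.side i).point t) * (normal i).1 +
                (c • q).1.2 ((T.side i).point t) * (normal i).2) =
              c * ∫ t in (T.side i).lo..(T.side i).hi, v.2 (T.side i) t *
              (q.1.1 ((T.side i).point t) * (normal i).1 +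
                q.1.2 ((T.side i).point t) * (normal i).2) := by
            intro i
            rw [← intervalIntegral.integral_const_mul]
            refine intervalIntegral.integral_congr fun x _ => ?_
            simp only [Submodule.coe_smul, Prod.smul_fst, Prod.smul_snd, Pi.smul_apply,
              smul_eq_mul]
            ring
          rw [e1, Finset.sum_congr rfl fun i _ => e2 i, ← Finset.mul_sum, RingHom.id_apply,
            smul_eq_mul]
          ring }
    obtain ⟨g, hg⟩ := exists_forall_apply_eq B hB l
    exact ⟨g.1, g.2, fun q hq => hg ⟨q, hq⟩⟩
  unfold discreteWeakGrad
  rw [dif_pos hex]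
  exact hex.choose_spec

end


/-! ### The interpolation error on a rectangle -/

theorem continuous_interpDeriv_fst {F : ℝ × ℝ → ℝ} (hF : Continuous F) (k : ℕ) (a b : ℝ) :
    Continuous fun p : ℝ × ℝ => interpDeriv k a b (fun s => F (s, p.2)) p.1 := by
  unfold interpDeriv
  refine continuous_finsetSum _ fun ζ _ => ?_
  have h1 : Continuous fun p : ℝ × ℝ =>
      (Polynomial.derivative (lobattoBasis k ζ)).eval (toRef a b p.1) :=
    (Polynomial.continuous _).comp ((continuous_toRef a b).comp continuous_fst)
  have h2 : Continuous fun p : ℝ × ℝ => F (fromRef a b ζ, p.2) :=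
    hF.comp (continuous_const.prodMk continuous_snd)
  exact h2.mul (h1.mul continuous_const)

theorem continuous_interp_snd {F : ℝ × ℝ → ℝ} (hF : Continuous F) (k : ℕ) (c d : ℝ) :
    Continuous fun p : ℝ × ℝ => interp k c d (fun t => F (p.1, t)) p.2 := by
  unfold interp
  refine continuous_finsetSum _ fun ζ _ => ?_
  have h1 : Continuous fun p : ℝ × ℝ => (lobattoBasis k ζ).eval (toRef c d p.2) :=
    (Polynomial.continuous _).comp ((continuous_toRef c d).comp continuous_snd)
  have h2 : Continuous fun p : ℝ × ℝ => F (p.1, fromRef c d ζ) :=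
    hF.comp (continuous_fst.prodMk continuous_const)
  exact h2.mul h1

/-- `∂_x (φ - I φ)`, where `I` is the tensor-product interpolation on `[a,b] × [c,d]`. -/
def interpError (k : ℕ) (a b c d : ℝ) (φ : ℝ × ℝ → ℝ) (p : ℝ × ℝ) : ℝ :=
  dx φ p - interpDeriv k a b (fun s => interp k c d (fun t => φ (s, t)) p.2) p.1

theorem continuous_interpError {φ : ℝ × ℝ → ℝ} (h : ContDiff ℝ ∞ φ) (k : ℕ) (a b c d : ℝ) :
    Continuous (interpError k a b c d φ) :=
  (contDiff_dx h).continuous.sub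
    (continuous_interpDeriv_fst (continuous_interp_snd h.continuous k c d) k a b)

/-- `∂_x (φ - I_y φ)`. -/
def interpErrorSnd (k : ℕ) (c d : ℝ) (φ : ℝ × ℝ → ℝ) (p : ℝ × ℝ) : ℝ :=
  dx φ p - interp k c d (fun t => dx φ (p.1, t)) p.2

theorem continuous_interpErrorSnd {φ : ℝ × ℝ → ℝ} (h : ContDiff ℝ ∞ φ) (k : ℕ) (c d : ℝ) :
    Continuous (interpErrorSnd k c d φ) :=
  (contDiff_dx h).continuous.sub (continuous_interp_snd (contDiff_dx h).continuous k c d)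

/-- The one-dimensional `L²` estimate for the slices `t ↦ ∂_x φ(x, t)`, integrated over `x`. It
consumes `k + 1` derivatives in `y` and one in `x`. -/
theorem exists_integral_sq_interpErrorSnd_le {k : ℕ} (hk : 1 ≤ k) : ∃ C : ℝ, 0 < C ∧
    ∀ (a b c d : ℝ), a < b → c < d → ∀ φ : ℝ × ℝ → ℝ, ContDiff ℝ ∞ φ →
      ∫ y in c..d, ∫ x in a..b, interpErrorSnd k c d φ (x, y) ^ 2 ≤
        C * (d - c) ^ (2 * k + 2) * ∫ y in c..d, ∫ x in a..b, dx (dy^[k + 1] φ) (x, y) ^ 2 := by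
  obtain ⟨C, hC, hCb⟩ := exists_integral_sq_sub_interp_le hk
  refine ⟨C, hC, fun a b c d hab hcd φ hφ => ?_⟩
  have c1 := continuous_interpErrorSnd hφ k c d
  have c2 := (contDiff_dx (contDiff_iterate_dy hφ (k + 1))).continuous
  rw [← integral_swap (F := fun p => interpErrorSnd k c d φ p ^ 2) (c1.pow 2),
    ← integral_swap (F := fun p => dx (dy^[k + 1] φ) p ^ 2) (c2.pow 2),
    ← intervalIntegral.integral_const_mul]
  refine intervalIntegral.integral_mono_on hab.le
    ((continuous_integral_snd (F := fun p => interpErrorSnd k c d φ p ^ 2)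
      (c1.pow 2) _ _).intervalIntegrable _ _)
    (((continuous_integral_snd (F := fun p => dx (dy^[k + 1] φ) p ^ 2)
      (c2.pow 2) _ _).const_mul _).intervalIntegrable _ _) ?_
  intro x _
  have := hCb c d hcd (fun t => dx φ (x, t)) (contDiff_slice_snd (contDiff_dx hφ) x)
  simp_rw [iteratedDeriv_slice_snd (contDiff_dx hφ)] at this
  rw [dx_iterate_dy_comm hφ]
  exact this

/-- The splitting `φ - I_x I_y φ = (φ - I_x φ) + I_x (φ - I_y φ)`. The first part is a
one-dimensional error, where superconvergence is available; in the second, `I_x` only has to be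
stable. -/
theorem interpError_eq (k : ℕ) (a b c d : ℝ) {φ : ℝ × ℝ → ℝ} (hφ : ContDiff ℝ ∞ φ) (x y : ℝ) :
    interpError k a b c d φ (x, y) =
      (deriv (fun s => φ (s, y)) x - interpDeriv k a b (fun s => φ (s, y)) x) +
      interpDeriv k a b (fun s => φ (s, y) - interp k c d (fun t => φ (s, t)) y) x := by
  rw [interpDeriv_sub, (hasDerivAt_slice_fst hφ x y).deriv, interpError]
  ring

/-- Interpolation in `y` commutes with `∂_x`, so the function fed to the stability bound of `I_x`
has the derivative `interpErrorSnd`. -/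
theorem exists_sq_interpDeriv_interpError_le {k : ℕ} (hk : 1 ≤ k) : ∃ C : ℝ, 0 < C ∧
    ∀ (a b c d : ℝ), a < b → ∀ φ : ℝ × ℝ → ℝ, ContDiff ℝ ∞ φ → ∀ x ∈ Icc a b, ∀ y,
      interpDeriv k a b (fun s => φ (s, y) - interp k c d (fun t => φ (s, t)) y) x ^ 2 ≤
        C * (b - a)⁻¹ * ∫ x in a..b, interpErrorSnd k c d φ (x, y) ^ 2 := by
  obtain ⟨C, hC, hCb⟩ := exists_sq_interpDeriv_le hk
  refine ⟨C, hC, fun a b c d hab φ hφ x hx y => ?_⟩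
  refine hCb a b hab (fun s => φ (s, y) - interp k c d (fun t => φ (s, t)) y)
    (fun s => interpErrorSnd k c d φ (s, y)) (fun s => ?_)
    ((continuous_interpErrorSnd hφ k c d).comp (continuous_id.prodMk continuous_const)) x hx
  refine (hasDerivAt_slice_fst hφ s y).sub ?_
  unfold interp
  exact HasDerivAt.fun_sum fun ζ _ => (hasDerivAt_slice_fst hφ s _).mul_const _

theorem two_sq_add_two_sq (x y : ℝ) : (x + y) ^ 2 ≤ 2 * x ^ 2 + 2 * y ^ 2 := by
  nlinarith [sq_nonneg (x - y)]

/-- Superconvergence of the tensor-product interpolation. -/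
theorem exists_sq_integral_interpError_mul_le {k : ℕ} (hk : 1 ≤ k) : ∃ C : ℝ, 0 < C ∧
    ∀ (a b c d : ℝ), a < b → c < d → ∀ φ : ℝ × ℝ → ℝ, ContDiff ℝ ∞ φ →
      ∀ V : ℝ × ℝ → ℝ, Continuous V →
      (∀ y, ∃ q : ℝ[X], q.natDegree < k ∧ ∀ x, q.eval x = V (x, y)) →
      (∫ y in c..d, ∫ x in a..b, interpError k a b c d φ (x, y) * V (x, y)) ^ 2 ≤
        C * ((b - a) ^ (2 * k + 2) * (∫ y in c..d, ∫ x in a..b, dx^[k + 2] φ (x, y) ^ 2) +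
          (d - c) ^ (2 * k + 2) * ∫ y in c..d, ∫ x in a..b, dx (dy^[k + 1] φ) (x, y) ^ 2) *
          ∫ y in c..d, ∫ x in a..b, V (x, y) ^ 2 := by
  obtain ⟨C₁, hC₁, h1⟩ := exists_sq_integral_interp_error_mul_le hk
  obtain ⟨C₂, hC₂, h2⟩ := exists_sq_interpDeriv_interpError_le hk
  obtain ⟨C₃, hC₃, h3⟩ := exists_integral_sq_interpErrorSnd_le hk
  refine ⟨2 * C₁ + 2 * (C₂ * C₃), by positivity, fun a b c d hab hcd φ hφ V hV hVp => ?_⟩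
  have hba : 0 < b - a := sub_pos.2 hab
  set D1 : ℝ × ℝ → ℝ := fun p =>
    dx φ p - interpDeriv k a b (fun s => φ (s, p.2)) p.1 with hD1
  set D2 : ℝ × ℝ → ℝ := fun p =>
    interpDeriv k a b (fun s => φ (s, p.2) - interp k c d (fun t => φ (s, t)) p.2) p.1 with hD2
  have cD1 : Continuous D1 := (contDiff_dx hφ).continuous.sub
    (continuous_interpDeriv_fst hφ.continuous k a b)
  have cD2 : Continuous D2 := continuous_interpDeriv_fst
    (F := fun p => φ p - interp k c d (fun t => φ (p.1, t)) p.2)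
    (hφ.continuous.sub (continuous_interp_snd hφ.continuous k c d)) k a b
  have cE := continuous_interpErrorSnd hφ k c d
  have cX := (contDiff_iterate_dx hφ (k + 2)).continuous
  have hsplit : ∫ y in c..d, ∫ x in a..b, interpError k a b c d φ (x, y) * V (x, y) =
      (∫ y in c..d, ∫ x in a..b, D1 (x, y) * V (x, y)) +
      ∫ y in c..d, ∫ x in a..b, D2 (x, y) * V (x, y) := by
    rw [← intervalIntegral.integral_add]
    · refine intervalIntegral.integral_congr fun y _ => ?_
      rw [← intervalIntegral.integral_add]
      · refine intervalIntegral.integral_congr fun x _ => ?_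
        simp only [interpError_eq k a b c d hφ x y, (hasDerivAt_slice_fst hφ x y).deriv, hD1, hD2]
        ring
      · exact ((cD1.mul hV).comp (continuous_id.prodMk continuous_const)).intervalIntegrable _ _
      · exact ((cD2.mul hV).comp (continuous_id.prodMk continuous_const)).intervalIntegrable _ _
    · exact (continuous_integral_fst (F := fun p => D1 p * V p)
        (cD1.mul hV) _ _).intervalIntegrable _ _
    · exact (continuous_integral_fst (F := fun p => D2 p * V p)
        (cD2.mul hV) _ _).intervalIntegrable _ _
  have cV := continuous_integral_fst (F := fun p => V p ^ 2) (hV.pow 2) a b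
  have cXi := continuous_integral_fst (F := fun p => dx^[k + 2] φ p ^ 2) (cX.pow 2) a b
  have cEi := continuous_integral_fst (F := fun p => interpErrorSnd k c d φ p ^ 2) (cE.pow 2) a b
  -- Superconvergence holds on each horizontal line, and Cauchy–Schwarz in `y` combines the lines.
  have e1 : (∫ y in c..d, ∫ x in a..b, D1 (x, y) * V (x, y)) ^ 2 ≤
      (C₁ * (b - a) ^ (2 * k + 2) * ∫ y in c..d, ∫ x in a..b, dx^[k + 2] φ (x, y) ^ 2) *
        ∫ y in c..d, ∫ x in a..b, V (x, y) ^ 2 := by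
    rw [← intervalIntegral.integral_const_mul (C₁ * (b - a) ^ (2 * k + 2))
      (fun y => ∫ x in a..b, dx^[k + 2] φ (x, y) ^ 2)]
    refine sq_intervalIntegral_le_mul hcd.le (cXi.const_mul _) cV (fun y => ?_)
      (fun y => integral_sq_nonneg hab.le) (fun y _ => ?_)
    · exact mul_nonneg (by positivity) (integral_sq_nonneg hab.le)
    · obtain ⟨q, hq, hqe⟩ := hVp y
      have := h1 a b hab (fun s => φ (s, y)) (contDiff_slice_fst hφ y) q hq
      simp_rw [iteratedDeriv_slice_fst hφ, hqe] at this
      simp only [hD1]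
      convert this using 6
      exact (hasDerivAt_slice_fst hφ _ y).deriv.symm
  -- No orthogonality is needed here: the error of `I_y` is of order `k + 1` already.
  have e2 : (∫ y in c..d, ∫ x in a..b, D2 (x, y) * V (x, y)) ^ 2 ≤
      (C₂ * ∫ y in c..d, ∫ x in a..b, interpErrorSnd k c d φ (x, y) ^ 2) *
        ∫ y in c..d, ∫ x in a..b, V (x, y) ^ 2 := by
    rw [← intervalIntegral.integral_const_mul C₂
      (fun y => ∫ x in a..b, interpErrorSnd k c d φ (x, y) ^ 2)]
    refine sq_intervalIntegral_le_mul hcd.le (cEi.const_mul _) cV (fun y => ?_)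
      (fun y => integral_sq_nonneg hab.le) (fun y _ => ?_)
    · exact mul_nonneg (by positivity) (integral_sq_nonneg hab.le)
    · refine (sq_intervalIntegral_mul_le hab.le
        (cD2.comp (continuous_id.prodMk continuous_const))
        (hV.comp (continuous_id.prodMk continuous_const))).trans ?_
      refine mul_le_mul_of_nonneg_right ?_ (integral_sq_nonneg hab.le)
      refine (intervalIntegral_sq_le_of_le hab.le (fun x hx => h2 a b c d hab φ hφ x hx y)
        (cD2.comp (continuous_id.prodMk continuous_const))).trans (le_of_eq ?_)
      field_simp
  have e3 := h3 a b c d hab hcd φ hφ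
  have hV0 : 0 ≤ ∫ y in c..d, ∫ x in a..b, V (x, y) ^ 2 :=
    intervalIntegral.integral_nonneg hcd.le fun y _ => integral_sq_nonneg hab.le
  have hX0 : 0 ≤ ∫ y in c..d, ∫ x in a..b, dx^[k + 2] φ (x, y) ^ 2 :=
    intervalIntegral.integral_nonneg hcd.le fun y _ => integral_sq_nonneg hab.le
  have hY0 : 0 ≤ ∫ y in c..d, ∫ x in a..b, dx (dy^[k + 1] φ) (x, y) ^ 2 :=
    intervalIntegral.integral_nonneg hcd.le fun y _ => integral_sq_nonneg hab.le
  rw [hsplit]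
  refine (two_sq_add_two_sq _ _).trans ?_
  set SX := (b - a) ^ (2 * k + 2) * ∫ y in c..d, ∫ x in a..b, dx^[k + 2] φ (x, y) ^ 2 with hSX
  set SY := (d - c) ^ (2 * k + 2) * ∫ y in c..d, ∫ x in a..b, dx (dy^[k + 1] φ) (x, y) ^ 2 with hSY
  set N := ∫ y in c..d, ∫ x in a..b, V (x, y) ^ 2
  have hSX0 : 0 ≤ SX := mul_nonneg (by positivity) hX0
  have hSY0 : 0 ≤ SY := mul_nonneg (by have := sub_pos.2 hcd; positivity) hY0
  rw [mul_assoc C₁, ← hSX] at e1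
  rw [mul_assoc C₃, ← hSY] at e3
  have e4 : (C₂ * ∫ y in c..d, ∫ x in a..b, interpErrorSnd k c d φ (x, y) ^ 2) * N ≤
      (C₂ * (C₃ * SY)) * N := by gcongr
  have e5 : 0 ≤ C₁ * SY * N := by positivity
  have e6 : 0 ≤ C₂ * C₃ * SX * N := by positivity
  nlinarith

/-- The normal derivative of the interpolation error on the edges `x = x₀`. -/
theorem exists_integral_sq_interpError_edge_le {k : ℕ} (hk : 1 ≤ k) : ∃ C : ℝ, 0 < C ∧
    ∀ (a b c d : ℝ), a < b → c < d → ∀ φ : ℝ × ℝ → ℝ, ContDiff ℝ ∞ φ → ∀ x₀ ∈ Icc a b,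
      ∫ y in c..d, interpError k a b c d φ (x₀, y) ^ 2 ≤
        C * ((b - a) ^ (2 * k - 1) * (∫ y in c..d, ∫ x in a..b, dx^[k + 1] φ (x, y) ^ 2) +
          (b - a)⁻¹ * (d - c) ^ (2 * k + 2) *
            ∫ y in c..d, ∫ x in a..b, dx (dy^[k + 1] φ) (x, y) ^ 2) := by
  obtain ⟨C₁, hC₁, h1⟩ := exists_sq_deriv_sub_interpDeriv_le hk
  obtain ⟨C₂, hC₂, h2⟩ := exists_sq_interpDeriv_interpError_le hk
  obtain ⟨C₃, hC₃, h3⟩ := exists_integral_sq_interpErrorSnd_le hk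
  refine ⟨2 * C₁ + 2 * (C₂ * C₃), by positivity, fun a b c d hab hcd φ hφ x₀ hx₀ => ?_⟩
  have hba : 0 < b - a := sub_pos.2 hab
  have hdc : 0 < d - c := sub_pos.2 hcd
  have cX := (contDiff_iterate_dx hφ (k + 1)).continuous
  have cE := continuous_interpErrorSnd hφ k c d
  have cXi := continuous_integral_fst (F := fun p => dx^[k + 1] φ p ^ 2) (cX.pow 2) a b
  have cEi := continuous_integral_fst (F := fun p => interpErrorSnd k c d φ p ^ 2) (cE.pow 2) a b
  -- On a single line no orthogonality helps. The first part keeps the ordinary order, with exponent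
  -- `2 k - 1` in the square.
  have e1 : ∫ y in c..d, interpError k a b c d φ (x₀, y) ^ 2 ≤
      ∫ y in c..d, (2 * (C₁ * (b - a) ^ (2 * k - 1)) * (∫ x in a..b, dx^[k + 1] φ (x, y) ^ 2) +
        2 * (C₂ * (b - a)⁻¹) * ∫ x in a..b, interpErrorSnd k c d φ (x, y) ^ 2) := by
    refine intervalIntegral.integral_mono_on hcd.le ?_ ?_ fun y _ => ?_
    · exact (((continuous_interpError hφ k a b c d).comp
        (continuous_const.prodMk continuous_id)).pow 2).intervalIntegrable _ _
    · exact ((cXi.const_mul _).add (cEi.const_mul _)).intervalIntegrable _ _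
    · rw [interpError_eq k a b c d hφ]
      refine (two_sq_add_two_sq _ _).trans ?_
      have f1 := h1 a b hab (fun s => φ (s, y)) (contDiff_slice_fst hφ y) x₀ hx₀
      simp_rw [iteratedDeriv_slice_fst hφ] at f1
      have f2 := h2 a b c d hab φ hφ x₀ hx₀ y
      linarith
  rw [intervalIntegral.integral_add ((cXi.const_mul _).intervalIntegrable _ _)
    ((cEi.const_mul _).intervalIntegrable _ _), intervalIntegral.integral_const_mul,
    intervalIntegral.integral_const_mul] at e1
  refine e1.trans ?_
  have e3 := h3 a b c d hab hcd φ hφ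
  have hX0 : 0 ≤ ∫ y in c..d, ∫ x in a..b, dx^[k + 1] φ (x, y) ^ 2 :=
    intervalIntegral.integral_nonneg hcd.le fun y _ => integral_sq_nonneg hab.le
  have hY0 : 0 ≤ ∫ y in c..d, ∫ x in a..b, dx (dy^[k + 1] φ) (x, y) ^ 2 :=
    intervalIntegral.integral_nonneg hcd.le fun y _ => integral_sq_nonneg hab.le
  set X := ∫ y in c..d, ∫ x in a..b, dx^[k + 1] φ (x, y) ^ 2
  set Y := ∫ y in c..d, ∫ x in a..b, dx (dy^[k + 1] φ) (x, y) ^ 2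
  have e4 : 2 * (C₂ * (b - a)⁻¹) * (∫ y in c..d, ∫ x in a..b, interpErrorSnd k c d φ (x, y) ^ 2) ≤
      2 * (C₂ * (b - a)⁻¹) * (C₃ * (d - c) ^ (2 * k + 2) * Y) := by gcongr
  have e5 : 0 ≤ C₁ * ((b - a)⁻¹ * (d - c) ^ (2 * k + 2) * Y) := by positivity
  have e6 : 0 ≤ C₂ * C₃ * ((b - a) ^ (2 * k - 1) * X) := by positivity
  nlinarith


/-! ### The consistency error on one element -/

/-- The boundary integral `⟨w, q·n⟩_{∂T}`. -/
def flux (T : Rect) (w : Fin 4 → ℝ → ℝ) (q₁ q₂ : ℝ × ℝ → ℝ) : ℝ :=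
  ∑ i, ∫ t in (T.side i).lo..(T.side i).hi, w i t *
    (q₁ ((T.side i).point t) * (normal i).1 + q₂ ((T.side i).point t) * (normal i).2)

/-- `‖∇_w v‖²_T`. -/
def gradSq (k : ℕ) (T : Rect) (v : WeakFunction) : ℝ :=
  ∫ p in T.toSet, ((discreteWeakGrad k T v).1 p * (discreteWeakGrad k T v).1 p +
    (discreteWeakGrad k T v).2 p * (discreteWeakGrad k T v).2 p)

/-- `‖v_0 - v_b‖²_{∂T}`. -/
def jumpSq (T : Rect) (v : WeakFunction) : ℝ :=
  ∑ i, ∫ t in (T.side i).lo..(T.side i).hi,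
    (v.1 T ((T.side i).point t) - v.2 (T.side i) t) *
    (v.1 T ((T.side i).point t) - v.2 (T.side i) t)

/-- The square of the Sobolev norm over `T` of a family `w i j` of derivatives. -/
def sobolevSq (T : Rect) (m : ℕ) (w : ℕ → ℕ → ℝ × ℝ → ℝ) : ℝ :=
  ∑ i ∈ Finset.range (m + 1), ∑ j ∈ Finset.range (m + 1 - i), ∫ p in T.toSet, w i j p ^ 2

/-- The consistency error `(∇ I u, ∇_w v)_T + (Δu, v_0)_T - ⟨∇u·n, v_b⟩_{∂T}`. -/
def elementError (k : ℕ) (T : Rect) (v : WeakFunction) (u gx gy lap : ℝ × ℝ → ℝ) : ℝ :=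
  (∫ p in T.toSet, (dx (interpRect k u T) p * (discreteWeakGrad k T v).1 p +
    dy (interpRect k u T) p * (discreteWeakGrad k T v).2 p)) +
  (∫ p in T.toSet, lap p * v.1 T p) - flux T (fun i => v.2 (T.side i)) gx gy

theorem le_sobolevSq (T : Rect) {m : ℕ} (w : ℕ → ℕ → ℝ × ℝ → ℝ) {i j : ℕ} (h : i + j ≤ m) :
    ∫ p in T.toSet, w i j p ^ 2 ≤ sobolevSq T m w := by
  have h0 : ∀ i j, 0 ≤ ∫ p in T.toSet, w i j p ^ 2 := fun i j => integral_nonneg fun p => sq_nonneg _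
  refine le_trans ?_ (Finset.single_le_sum (f := fun i => ∑ j ∈ Finset.range (m + 1 - i),
    ∫ p in T.toSet, w i j p ^ 2) (fun i _ => Finset.sum_nonneg fun j _ => h0 i j)
    (Finset.mem_range.2 (by omega : i < m + 1)))
  exact Finset.single_le_sum (f := fun j => ∫ p in T.toSet, w i j p ^ 2) (fun j _ => h0 i j)
    (Finset.mem_range.2 (by omega : j < m + 1 - i))

theorem sobolevSq_nonneg (T : Rect) (m : ℕ) (w : ℕ → ℕ → ℝ × ℝ → ℝ) : 0 ≤ sobolevSq T m w :=
  Finset.sum_nonneg fun _ _ => Finset.sum_nonneg fun _ _ => integral_nonneg fun _ => sq_nonneg _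

theorem Rect.lo_le_hi (T : Rect) (i : Fin 4) : (T.side i).lo ≤ (T.side i).hi := by
  fin_cases i <;> simp [Rect.side, Edge.lo, Edge.hi, T.hab.le, T.hcd.le]

theorem jumpSq_nonneg (T : Rect) (v : WeakFunction) : 0 ≤ jumpSq T v :=
  Finset.sum_nonneg fun i _ => intervalIntegral.integral_nonneg (T.lo_le_hi i)
    fun _ _ => mul_self_nonneg _

theorem gradSq_nonneg (k : ℕ) (T : Rect) (v : WeakFunction) : 0 ≤ gradSq k T v :=
  integral_nonneg fun _ => add_nonneg (mul_self_nonneg _) (mul_self_nonneg _)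

theorem flux_add {T : Rect} {w w' : Fin 4 → ℝ → ℝ} {q₁ q₂ : ℝ × ℝ → ℝ}
    (hw : ∀ i, Continuous (w i)) (hw' : ∀ i, Continuous (w' i)) (h1 : Continuous q₁)
    (h2 : Continuous q₂) :
    flux T (fun i t => w i t - w' i t) q₁ q₂ = flux T w q₁ q₂ - flux T w' q₁ q₂ := by
  unfold flux
  rw [← Finset.sum_sub_distrib]
  refine Finset.sum_congr rfl fun i _ => ?_
  have hp := (T.side i).continuous_point
  have := hw i
  have := hw' i
  rw [← intervalIntegral.integral_sub]
  · simp_rw [sub_mul]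
  · exact Continuous.intervalIntegrable (by fun_prop) _ _
  · exact Continuous.intervalIntegrable (by fun_prop) _ _

theorem flux_sub_field {T : Rect} {w : Fin 4 → ℝ → ℝ} {q₁ q₂ r₁ r₂ : ℝ × ℝ → ℝ}
    (hw : ∀ i, Continuous (w i)) (h1 : Continuous q₁)
    (h2 : Continuous q₂) (h3 : Continuous r₁) (h4 : Continuous r₂) :
    flux T w (fun p => q₁ p - r₁ p) (fun p => q₂ p - r₂ p) = flux T w q₁ q₂ - flux T w r₁ r₂ := by
  unfold flux
  rw [← Finset.sum_sub_distrib]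
  refine Finset.sum_congr rfl fun i _ => ?_
  have hp := (T.side i).continuous_point
  have := hw i
  rw [← intervalIntegral.integral_sub]
  · refine intervalIntegral.integral_congr fun t _ => ?_
    ring
  · exact Continuous.intervalIntegrable (by fun_prop) _ _
  · exact Continuous.intervalIntegrable (by fun_prop) _ _

/-- `‖q·n‖²_{∂T}` -/
theorem sum_sq_normal (T : Rect) (q₁ q₂ : ℝ × ℝ → ℝ) :
    ∑ i, ∫ t in (T.side i).lo..(T.side i).hi,
      (q₁ ((T.side i).point t) * (normal i).1 + q₂ ((T.side i).point t) * (normal i).2) ^ 2 =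
      (∫ t in T.a..T.b, q₂ (t, T.c) ^ 2) + (∫ t in T.a..T.b, q₂ (t, T.d) ^ 2) +
        (∫ t in T.c..T.d, q₁ (T.a, t) ^ 2) + ∫ t in T.c..T.d, q₁ (T.b, t) ^ 2 := by
  simp only [Fin.sum_univ_four, Rect.side, normal, Edge.lo, Edge.hi, Edge.point, Matrix.cons_val]
  simp only [mul_zero, zero_add, add_zero, mul_one, mul_neg, neg_sq]

/-- Cauchy–Schwarz on each edge and then over the four edges; only the normal component of the field
enters. -/
theorem sq_flux_le {T : Rect} {v : WeakFunction} {q₁ q₂ : ℝ × ℝ → ℝ}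
    (hv : Continuous (v.1 T)) (hvb : ∀ i, Continuous (v.2 (T.side i))) (h1 : Continuous q₁)
    (h2 : Continuous q₂) :
    flux T (fun i t => v.1 T ((T.side i).point t) - v.2 (T.side i) t) q₁ q₂ ^ 2 ≤
      jumpSq T v * ((∫ t in T.a..T.b, q₂ (t, T.c) ^ 2) + (∫ t in T.a..T.b, q₂ (t, T.d) ^ 2) +
        (∫ t in T.c..T.d, q₁ (T.a, t) ^ 2) + ∫ t in T.c..T.d, q₁ (T.b, t) ^ 2) := by
  rw [← sum_sq_normal]
  unfold flux jumpSq
  refine Finset.sum_sq_le_sum_mul_sum_of_sq_le_mul _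
    (fun i _ => intervalIntegral.integral_nonneg (T.lo_le_hi i) fun _ _ => mul_self_nonneg _)
    (fun i _ => integral_sq_nonneg (T.lo_le_hi i)) fun i _ => ?_
  have hp := (T.side i).continuous_point
  have := hvb i
  have := sq_intervalIntegral_mul_le (T.lo_le_hi i)
    (f := fun t => v.1 T ((T.side i).point t) - v.2 (T.side i) t)
    (g := fun t => q₁ ((T.side i).point t) * (normal i).1 + q₂ ((T.side i).point t) * (normal i).2)
    (by fun_prop) (by fun_prop)
  simpa only [sq (v.1 T _ - v.2 _ _)] using this

/-- The tensor-product interpolant can be formed in either order. Having `x` outermost gives the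
formula for `∂_x`; the other order gives that for `∂_y`. -/
theorem interpRect_eq_interp (k : ℕ) (u : ℝ × ℝ → ℝ) (T : Rect) (x y : ℝ) :
    interpRect k u T (x, y) =
      interp k T.a T.b (fun s => interp k T.c T.d (fun t => u (s, t)) y) x := by
  simp only [interpRect, interp, Finset.sum_mul]
  refine Finset.sum_congr rfl fun ζ _ => Finset.sum_congr rfl fun η _ => ?_
  ring

theorem interpRect_eq_interp' (k : ℕ) (u : ℝ × ℝ → ℝ) (T : Rect) (x y : ℝ) :
    interpRect k u T (x, y) =
      interp k T.c T.d (fun t => interp k T.a T.b (fun s => u (s, t)) x) y := by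
  simp only [interpRect, interp, Finset.sum_mul]
  rw [Finset.sum_comm]

theorem dx_interpRect {k : ℕ} (hk : 1 ≤ k) (u : ℝ × ℝ → ℝ) (T : Rect) (x y : ℝ) :
    dx (interpRect k u T) (x, y) =
      interpDeriv k T.a T.b (fun s => interp k T.c T.d (fun t => u (s, t)) y) x := by
  have h1 := hasDerivAt_slice_fst (contDiff_of_mem_Q (interpRect_mem_Q hk u T)) x y
  simp_rw [interpRect_eq_interp] at h1
  exact h1.unique (hasDerivAt_interp _ _ _ _ _)

theorem dy_interpRect {k : ℕ} (hk : 1 ≤ k) (u : ℝ × ℝ → ℝ) (T : Rect) (x y : ℝ) :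
    dy (interpRect k u T) (x, y) =
      interpDeriv k T.c T.d (fun t => interp k T.a T.b (fun s => u (s, t)) x) y := by
  have h1 := hasDerivAt_slice_snd (contDiff_of_mem_Q (interpRect_mem_Q hk u T)) x y
  simp_rw [interpRect_eq_interp'] at h1
  exact h1.unique (hasDerivAt_interp _ _ _ _ _)

theorem dx_sub_dx_interpRect {k : ℕ} (hk : 1 ≤ k) (φ : ℝ × ℝ → ℝ) (T : Rect) (p : ℝ × ℝ) :
    dx φ p - dx (interpRect k φ T) p = interpError k T.a T.b T.c T.d φ p := by
  obtain ⟨x, y⟩ := p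
  rw [dx_interpRect hk]
  rfl

theorem dy_sub_dy_interpRect {k : ℕ} (hk : 1 ≤ k) {φ : ℝ × ℝ → ℝ} (hφ : ContDiff ℝ ∞ φ) (T : Rect)
    (p : ℝ × ℝ) : dy φ p - dy (interpRect k φ T) p =
      interpError k T.c T.d T.a T.b (φ ∘ Prod.swap) p.swap := by
  obtain ⟨x, y⟩ := p
  rw [dy_interpRect hk, interpError, dx_comp_swap hφ]
  rfl

/-- Testing `∇_w v` with `q = ∇ I φ ∈ W_k` and using Green gives `(∇ I φ, ∇_w v) = (∇ I φ, ∇v₀) -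
⟨∂_n I φ, v₀ - v_b⟩`. Green for `φ` rewrites `(Δφ, v₀)`, and the two combine so that only the
interpolation error and the jump remain. -/
theorem elementError_eq {k : ℕ} (hk : 1 ≤ k) {T : Rect} {v : WeakFunction} (hv : v.1 T ∈ Q k k)
    (hvb : ∀ i, Continuous (v.2 (T.side i))) {φ : ℝ × ℝ → ℝ} (hφ : ContDiff ℝ ∞ φ) :
    elementError k T v φ (dx φ) (dy φ) (fun p => dx (dx φ) p + dy (dy φ) p) =
      -(∫ p in T.toSet, ((dx φ p - dx (interpRect k φ T) p) * dx (v.1 T) p +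
        (dy φ p - dy (interpRect k φ T) p) * dy (v.1 T) p)) +
      flux T (fun i t => v.1 T ((T.side i).point t) - v.2 (T.side i) t)
        (fun p => dx φ p - dx (interpRect k φ T) p)
        (fun p => dy φ p - dy (interpRect k φ T) p) := by
  have sv : ContDiff ℝ ∞ (v.1 T) := contDiff_of_mem_Q hv
  have hI := interpRect_mem_Q hk φ T
  set I := interpRect k φ T with hIdef
  have sI : ContDiff ℝ ∞ I := contDiff_of_mem_Q hI
  have hg := isDiscreteWeakGrad_discreteWeakGrad (k := k) sv.continuous hvb
  have h1 := hg.2 (dx I, dy I) ⟨dx_mem_Q hI, dy_mem_Q hI⟩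
  have h2 := green_rect sv (contDiff_dx sI) (contDiff_dy sI) T
  have h3 := green_rect sv (contDiff_dx hφ) (contDiff_dy hφ) T
  have c1 := (contDiff_dx sI).continuous
  have c2 := (contDiff_dy sI).continuous
  have c3 := (contDiff_dx hφ).continuous
  have c4 := (contDiff_dy hφ).continuous
  have c5 := (contDiff_dx sv).continuous
  have c6 := (contDiff_dy sv).continuous
  have hvs : ∀ i, Continuous fun t => v.1 T ((T.side i).point t) := fun i =>
    sv.continuous.comp (T.side i).continuous_point
  rw [flux_add (q₁ := fun p => dx φ p - dx I p) (q₂ := fun p => dy φ p - dy I p) hvs hvb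
      (c3.sub c1) (c4.sub c2), flux_sub_field hvs c3 c4 c1 c2,
    flux_sub_field hvb c3 c4 c1 c2]
  have h4 : ∫ p in T.toSet, ((dx φ p - dx I p) * dx (v.1 T) p + (dy φ p - dy I p) * dy (v.1 T) p) =
      (∫ p in T.toSet, (dx φ p * dx (v.1 T) p + dy φ p * dy (v.1 T) p)) -
      ∫ p in T.toSet, (dx I p * dx (v.1 T) p + dy I p * dy (v.1 T) p) := by
    rw [← integral_sub (integrableOn_rect (by fun_prop)) (integrableOn_rect (by fun_prop))]
    refine integral_congr_ae (.of_forall fun p => ?_)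
    ring
  have h5 : ∫ p in T.toSet, (dx I p * (discreteWeakGrad k T v).1 p +
      dy I p * (discreteWeakGrad k T v).2 p) = ∫ p in T.toSet,
      ((discreteWeakGrad k T v).1 p * dx I p + (discreteWeakGrad k T v).2 p * dy I p) := by
    refine integral_congr_ae (.of_forall fun p => ?_)
    ring
  have h6 : ∫ p in T.toSet, (dx (dx φ) p + dy (dy φ) p) * v.1 T p =
      ∫ p in T.toSet, v.1 T p * (dx (dx φ) p + dy (dy φ) p) := by
    refine integral_congr_ae (.of_forall fun p => ?_)
    ring
  rw [elementError, ← hIdef, h4, h5, h6, h1, h2, h3]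
  unfold flux
  ring

/-! ### Shape regularity and the bound for one element -/

theorem Rect.sub_le_diam (T : Rect) : T.b - T.a ≤ T.diam ∧ T.d - T.c ≤ T.diam := by
  unfold Rect.diam
  constructor <;> apply Real.le_sqrt_of_sq_le <;> nlinarith [sq_nonneg (T.b - T.a),
    sq_nonneg (T.d - T.c)]

theorem Rect.diam_pos (T : Rect) : 0 < T.diam :=
  lt_of_lt_of_le (sub_pos.2 T.hab) T.sub_le_diam.1

/-- A rectangle has positive diameter, so the mere existence of a shape-regular element forces `σ >
0`. This is why constants stated for arbitrary real `σ` contain `|σ|`. -/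
theorem inv_sub_le_of_shapeRegular {T : Rect} {σ : ℝ}
    (h : T.diam ≤ σ * min (T.b - T.a) (T.d - T.c)) :
    0 < σ ∧ (T.b - T.a)⁻¹ ≤ σ * T.diam⁻¹ ∧ (T.d - T.c)⁻¹ ≤ σ * T.diam⁻¹ := by
  have hd := T.diam_pos
  have h1 : 0 < T.b - T.a := sub_pos.2 T.hab
  have h2 : 0 < T.d - T.c := sub_pos.2 T.hcd
  have hm : 0 < min (T.b - T.a) (T.d - T.c) := lt_min h1 h2
  have hσ : 0 < σ := by
    by_contra hcon
    rw [not_lt] at hcon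
    nlinarith [mul_nonpos_of_nonpos_of_nonneg hcon hm.le]
  refine ⟨hσ, ?_, ?_⟩
  · rw [← div_eq_mul_inv, inv_eq_one_div, div_le_div_iff₀ h1 hd]
    nlinarith [mul_le_mul_of_nonneg_left (min_le_left (T.b - T.a) (T.d - T.c)) hσ.le]
  · rw [← div_eq_mul_inv, inv_eq_one_div, div_le_div_iff₀ h2 hd]
    nlinarith [mul_le_mul_of_nonneg_left (min_le_right (T.b - T.a) (T.d - T.c)) hσ.le]

/-- The inverse trace inequality on the vertical edges. -/
theorem exists_integral_sq_edge_le (k : ℕ) : ∃ C : ℝ, 0 < C ∧ ∀ (a b c d : ℝ), a < b → c < d →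
    ∀ {i j : ℕ} {q : ℝ × ℝ → ℝ}, i ≤ k → q ∈ Q i j →
      (∫ y in c..d, q (a, y) ^ 2) ≤ C * (b - a)⁻¹ * ∫ y in c..d, ∫ x in a..b, q (x, y) ^ 2 ∧
      (∫ y in c..d, q (b, y) ^ 2) ≤ C * (b - a)⁻¹ * ∫ y in c..d, ∫ x in a..b, q (x, y) ^ 2 := by
  obtain ⟨C, hC, hCb⟩ := exists_sq_eval_le k
  refine ⟨C, hC, fun a b c d hab hcd i j q hi hq => ?_⟩
  have cq := (contDiff_of_mem_Q hq).continuous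
  have cI := continuous_integral_fst (F := fun p => q p ^ 2) (cq.pow 2) a b
  rw [← intervalIntegral.integral_const_mul (C * (b - a)⁻¹) fun y => ∫ x in a..b, q (x, y) ^ 2]
  have hs : ∀ x, IntervalIntegrable (fun y => q (x, y) ^ 2) volume c d := fun x =>
    Continuous.intervalIntegrable (by fun_prop) _ _
  constructor <;> refine intervalIntegral.integral_mono_on hcd.le (hs _)
    ((cI.const_mul _).intervalIntegrable _ _) fun y _ => ?_
  · obtain ⟨p, hp, hpe⟩ := slice_fst_of_mem_Q hq y
    simpa only [hpe] using (hCb a b hab p (hp.trans hi)).1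
  · obtain ⟨p, hp, hpe⟩ := slice_fst_of_mem_Q hq y
    simpa only [hpe] using (hCb a b hab p (hp.trans hi)).2

/-- The gradient of `v_0` is controlled by the discrete weak gradient and the jumps. -/
theorem exists_integral_sq_grad_le {k : ℕ} (hk : 1 ≤ k) (σ : ℝ) : ∃ C : ℝ, 0 < C ∧ ∀ T : Rect,
    T.diam ≤ σ * min (T.b - T.a) (T.d - T.c) → ∀ v : WeakFunction, v.1 T ∈ Q k k →
      (∀ i, Continuous (v.2 (T.side i))) →
      (∫ p in T.toSet, dx (v.1 T) p ^ 2) + (∫ p in T.toSet, dy (v.1 T) p ^ 2) ≤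
        C * (gradSq k T v + T.diam⁻¹ * jumpSq T v) := by
  obtain ⟨C, hC, hCb⟩ := exists_integral_sq_edge_le k
  refine ⟨2 + 4 * C * |σ|, by positivity, fun T hT v hv hvb => ?_⟩
  obtain ⟨hσ, hinv1, hinv2⟩ := inv_sub_le_of_shapeRegular hT
  rw [abs_of_pos hσ]
  have sv : ContDiff ℝ ∞ (v.1 T) := contDiff_of_mem_Q hv
  have c5 := (contDiff_dx sv).continuous
  have c6 := (contDiff_dy sv).continuous
  have hg := isDiscreteWeakGrad_discreteWeakGrad (k := k) sv.continuous hvb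
  -- The field `∇v₀` is admissible as `q`. With Green this gives `‖∇v₀‖² = (∇_w v, ∇v₀) + ⟨v₀ - v_b,
  -- ∂_n v₀⟩`, and the inverse trace inequality bounds `∂_n v₀` on the edges by `‖∇v₀‖`.
  have h1 := hg.2 (dx (v.1 T), dy (v.1 T)) ⟨dx_mem_Q hv, dy_mem_Q hv⟩
  have h2 := green_rect sv (contDiff_dx sv) (contDiff_dy sv) T
  have hvs : ∀ i, Continuous fun t => v.1 T ((T.side i).point t) := fun i =>
    sv.continuous.comp (T.side i).continuous_point
  have h3 := flux_add (T := T) hvs hvb c5 c6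
  have g1 := (contDiff_of_mem_Q hg.1.1).continuous
  have g2 := (contDiff_of_mem_Q hg.1.2).continuous
  set g := discreteWeakGrad k T v with hgdef
  have hG : (∫ p in T.toSet, dx (v.1 T) p ^ 2) + (∫ p in T.toSet, dy (v.1 T) p ^ 2) =
      ∫ p in T.toSet, (dx (v.1 T) p * dx (v.1 T) p + dy (v.1 T) p * dy (v.1 T) p) := by
    rw [← integral_add (integrableOn_rect (by fun_prop)) (integrableOn_rect (by fun_prop))]
    simp only [sq]
  have hx0 : 0 ≤ ∫ p in T.toSet, dx (v.1 T) p ^ 2 := integral_nonneg fun _ => sq_nonneg _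
  have hy0 : 0 ≤ ∫ p in T.toSet, dy (v.1 T) p ^ 2 := integral_nonneg fun _ => sq_nonneg _
  set X := ∫ p in T.toSet, dx (v.1 T) p ^ 2 with hX
  set Y := ∫ p in T.toSet, dy (v.1 T) p ^ 2 with hY
  have hid : X + Y = (∫ p in T.toSet, (g.1 p * dx (v.1 T) p + g.2 p * dy (v.1 T) p)) +
      flux T (fun i t => v.1 T ((T.side i).point t) - v.2 (T.side i) t)
        (dx (v.1 T)) (dy (v.1 T)) := by
    rw [h3, h1, h2, hG]
    unfold flux
    ring
  have hCS : (∫ p in T.toSet, (g.1 p * dx (v.1 T) p + g.2 p * dy (v.1 T) p)) ^ 2 ≤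
      gradSq k T v * (X + Y) := by
    rw [hG, gradSq, ← hgdef]
    refine sq_integral_le_mul_integral (integrableOn_rect (by fun_prop))
      (integrableOn_rect (by fun_prop))
      (.of_forall fun _ => add_nonneg (mul_self_nonneg _) (mul_self_nonneg _))
      (.of_forall fun _ => add_nonneg (mul_self_nonneg _) (mul_self_nonneg _))
      (.of_forall fun p => ?_)
    nlinarith [sq_nonneg (g.1 p * dy (v.1 T) p - g.2 p * dx (v.1 T) p)]
  have hfl := sq_flux_le (T := T) sv.continuous hvb c5 c6
  obtain ⟨ex1, ex2⟩ := hCb T.a T.b T.c T.d T.hab T.hcd (by omega) (dx_mem_Q hv)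
  obtain ⟨ey1, ey2⟩ := hCb T.c T.d T.a T.b T.hcd T.hab (by omega)
    (comp_swap_mem_Q (dy_mem_Q hv))
  simp only [Function.comp_apply, Prod.swap_prod_mk] at ey1 ey2
  rw [← setIntegral_rect' (F := fun p => dx (v.1 T) p ^ 2) (by fun_prop), ← hX] at ex1 ex2
  rw [← setIntegral_rect (F := fun p => dy (v.1 T) p ^ 2) (by fun_prop), ← hY] at ey1 ey2
  have hJ := jumpSq_nonneg T v
  have hW := gradSq_nonneg k T v
  have bx : C * (T.b - T.a)⁻¹ * X ≤ C * (σ * T.diam⁻¹) * X := by gcongr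
  have bY : C * (T.d - T.c)⁻¹ * Y ≤ C * (σ * T.diam⁻¹) * Y := by gcongr
  have hfl2 : flux T (fun i t => v.1 T ((T.side i).point t) - v.2 (T.side i) t)
        (dx (v.1 T)) (dy (v.1 T)) ^ 2 ≤ jumpSq T v * (2 * C * (σ * T.diam⁻¹) * (X + Y)) := by
    refine hfl.trans (mul_le_mul_of_nonneg_left ?_ hJ)
    linarith
  -- Both contributions contain one factor `‖∇v₀‖² = X + Y` after squaring, which is divided out
  -- below; the case where it vanishes is treated separately.
  have hsq : (X + Y) ^ 2 ≤ (2 * gradSq k T v + 4 * C * σ * (T.diam⁻¹ * jumpSq T v)) * (X + Y) := by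
    conv_lhs => rw [hid]
    refine (two_sq_add_two_sq _ _).trans ?_
    nlinarith
  have hd := T.diam_pos
  have hJd : 0 ≤ T.diam⁻¹ * jumpSq T v := by positivity
  have hfin : X + Y ≤ 2 * gradSq k T v + 4 * C * σ * (T.diam⁻¹ * jumpSq T v) := by
    rcases (add_nonneg hx0 hy0).eq_or_lt with h0 | h0
    · rw [← h0]; positivity
    · rw [sq] at hsq
      exact le_of_mul_le_mul_right hsq h0
  have e1 : 0 ≤ C * σ * gradSq k T v := by positivity
  nlinarith

/-- Pure bookkeeping for the next theorem: `A` and `B` are the two volume terms, `F` is the boundary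
term, `W` and `J` stand for `gradSq` and `jumpSq`, and `p, r, s` for `h^{2k+2}, h^{2k-1}, h^{2k+1}`.
The four copies of `L` are the four edges; `L` is found by unification. -/
theorem consistency_arith {A B F X Y W J N p r s C₁ C₂ C₃ σ K L : ℝ} (h1 : 0 ≤ C₁) (h2 : 0 ≤ C₂)
    (h3 : 0 ≤ C₃) (hσ : 0 ≤ σ) (hN : 0 ≤ N) (hJ : 0 ≤ J) (hW : 0 ≤ W) (hp : 0 ≤ p) (hr : 0 ≤ r)
    (hA : A ^ 2 ≤ K * X) (hB : B ^ 2 ≤ K * Y)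
    (hK : K * (X + Y) ≤ 2 * C₁ * C₃ * (N * (p * W + s * J)))
    (hF : F ^ 2 ≤ J * (L + L + L + L)) (hL : L = C₂ * ((1 + σ) * ((r + s) * N)) := by rfl) :
    2 * (A + B) ^ 2 + 2 * F ^ 2 ≤
      (8 * C₁ * C₃ + 8 * C₂ * (1 + σ)) * N * (p * W + (r + s) * J) := by
  have e1 := two_sq_add_two_sq A B
  have p1 : 0 ≤ C₁ * C₃ * (N * (r * J)) := by positivity
  have p2 : 0 ≤ C₂ * (1 + σ) * (N * (p * W)) := by positivity
  subst hL
  linarith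

/-- The consistency error on one element. -/
theorem exists_sq_elementError_le {k : ℕ} (hk : 1 ≤ k) (σ : ℝ) : ∃ C : ℝ, 0 < C ∧ ∀ T : Rect,
    T.diam ≤ σ * min (T.b - T.a) (T.d - T.c) → ∀ v : WeakFunction, v.1 T ∈ Q k k →
      (∀ i, Continuous (v.2 (T.side i))) → ∀ φ : ℝ × ℝ → ℝ, ContDiff ℝ ∞ φ →
      elementError k T v φ (dx φ) (dy φ) (fun p => dx (dx φ) p + dy (dy φ) p) ^ 2 ≤
        C * sobolevSq T (k + 2) (fun i j => dx^[i] (dy^[j] φ)) *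
          (T.diam ^ (2 * k + 2) * gradSq k T v +
            (T.diam ^ (2 * k - 1) + T.diam ^ (2 * k + 1)) * jumpSq T v) := by
  obtain ⟨C₁, hC₁, H1⟩ := exists_sq_integral_interpError_mul_le hk
  obtain ⟨C₂, hC₂, H2⟩ := exists_integral_sq_interpError_edge_le hk
  obtain ⟨C₃, hC₃, H3⟩ := exists_integral_sq_grad_le hk σ
  refine ⟨8 * C₁ * C₃ + 8 * C₂ * (1 + |σ|), by positivity, fun T hT v hv hvb φ hφ => ?_⟩
  obtain ⟨hσ, hinv1, hinv2⟩ := inv_sub_le_of_shapeRegular hT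
  rw [abs_of_pos hσ]
  have hba : 0 < T.b - T.a := sub_pos.2 T.hab
  have hdc : 0 < T.d - T.c := sub_pos.2 T.hcd
  obtain ⟨hbh, hdh⟩ := T.sub_le_diam
  have hh := T.diam_pos
  have sv : ContDiff ℝ ∞ (v.1 T) := contDiff_of_mem_Q hv
  have c5 := (contDiff_dx sv).continuous
  have c6 := (contDiff_dy sv).continuous
  have sφ' := contDiff_comp_swap hφ
  set N := sobolevSq T (k + 2) (fun i j => dx^[i] (dy^[j] φ)) with hN
  have hN0 : 0 ≤ N := sobolevSq_nonneg _ _ _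
  have hJ := jumpSq_nonneg T v
  have hW := gradSq_nonneg k T v
  set h := T.diam with hh'
  have nn : ∀ {a b c d : ℝ}, a < b → c < d → ∀ F : ℝ × ℝ → ℝ,
      0 ≤ ∫ y in c..d, ∫ x in a..b, F (x, y) ^ 2 := fun hab hcd F =>
    intervalIntegral.integral_nonneg hcd.le fun y _ => integral_sq_nonneg hab.le
  have n1 : ∫ y in T.c..T.d, ∫ x in T.a..T.b, dx^[k + 2] φ (x, y) ^ 2 ≤ N := by
    rw [← setIntegral_rect' (F := fun p => dx^[k + 2] φ p ^ 2)
      ((contDiff_iterate_dx hφ _).continuous.pow 2)]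
    exact le_sobolevSq T (fun i j => dx^[i] (dy^[j] φ)) (i := k + 2) (j := 0) (by omega)
  have n2 : ∫ y in T.c..T.d, ∫ x in T.a..T.b, dx (dy^[k + 1] φ) (x, y) ^ 2 ≤ N := by
    rw [← setIntegral_rect' (F := fun p => dx (dy^[k + 1] φ) p ^ 2)
      ((contDiff_dx (contDiff_iterate_dy hφ _)).continuous.pow 2)]
    exact le_sobolevSq T (fun i j => dx^[i] (dy^[j] φ)) (i := 1) (j := k + 1) (by omega)
  have n3 : ∫ y in T.c..T.d, ∫ x in T.a..T.b, dx^[k + 1] φ (x, y) ^ 2 ≤ N := by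
    rw [← setIntegral_rect' (F := fun p => dx^[k + 1] φ p ^ 2)
      ((contDiff_iterate_dx hφ _).continuous.pow 2)]
    exact le_sobolevSq T (fun i j => dx^[i] (dy^[j] φ)) (i := k + 1) (j := 0) (by omega)
  -- From here on the bounds concern the reflected function; its derivatives are turned back into
  -- derivatives of `φ` of order at most `k + 2`.
  have n4 : ∫ x in T.a..T.b, ∫ y in T.c..T.d, dx^[k + 2] (φ ∘ Prod.swap) (y, x) ^ 2 ≤ N := by
    rw [iterate_dx_comp_swap hφ]
    have := setIntegral_rect (F := fun p => dy^[k + 2] φ p ^ 2)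
      ((contDiff_iterate_dy hφ _).continuous.pow 2) T
    refine this.symm.le.trans ?_
    exact le_sobolevSq T (fun i j => dx^[i] (dy^[j] φ)) (i := 0) (j := k + 2) (by omega)
  have n5 : ∫ x in T.a..T.b, ∫ y in T.c..T.d,
      dx (dy^[k + 1] (φ ∘ Prod.swap)) (y, x) ^ 2 ≤ N := by
    rw [iterate_dy_comp_swap hφ, dx_comp_swap (contDiff_iterate_dx hφ _), ← iterate_dx_dy_comm hφ]
    have := setIntegral_rect (F := fun p => dx^[k + 1] (dy φ) p ^ 2)
      ((contDiff_iterate_dx (contDiff_dy hφ) _).continuous.pow 2) T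
    refine this.symm.le.trans ?_
    exact le_sobolevSq T (fun i j => dx^[i] (dy^[j] φ)) (i := k + 1) (j := 1) (by omega)
  have n6 : ∫ x in T.a..T.b, ∫ y in T.c..T.d, dx^[k + 1] (φ ∘ Prod.swap) (y, x) ^ 2 ≤ N := by
    rw [iterate_dx_comp_swap hφ]
    have := setIntegral_rect (F := fun p => dy^[k + 1] φ p ^ 2)
      ((contDiff_iterate_dy hφ _).continuous.pow 2) T
    refine this.symm.le.trans ?_
    exact le_sobolevSq T (fun i j => dx^[i] (dy^[j] φ)) (i := 0) (j := k + 1) (by omega)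
  have cX : Continuous fun p => dx φ p - dx (interpRect k φ T) p :=
    (contDiff_dx hφ).continuous.sub
      (contDiff_dx (contDiff_of_mem_Q (interpRect_mem_Q hk φ T))).continuous
  have cY : Continuous fun p => dy φ p - dy (interpRect k φ T) p :=
    (contDiff_dy hφ).continuous.sub
      (contDiff_dy (contDiff_of_mem_Q (interpRect_mem_Q hk φ T))).continuous
  have GX : 0 ≤ ∫ p in T.toSet, dx (v.1 T) p ^ 2 := integral_nonneg fun _ => sq_nonneg _
  have GY : 0 ≤ ∫ p in T.toSet, dy (v.1 T) p ^ 2 := integral_nonneg fun _ => sq_nonneg _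
  have ax : (∫ p in T.toSet, (dx φ p - dx (interpRect k φ T) p) * dx (v.1 T) p) ^ 2 ≤
      C₁ * (2 * (h ^ (2 * k + 2) * N)) * ∫ p in T.toSet, dx (v.1 T) p ^ 2 := by
    have := H1 T.a T.b T.c T.d T.hab T.hcd φ hφ (dx (v.1 T)) c5 (fun y => by
      obtain ⟨q, hq, hqe⟩ := slice_fst_of_mem_Q (dx_mem_Q hv) y
      exact ⟨q, by omega, hqe⟩)
    rw [setIntegral_rect' (F := fun p => (dx φ p - dx (interpRect k φ T) p) * dx (v.1 T) p)
      (cX.mul c5), setIntegral_rect' (F := fun p => dx (v.1 T) p ^ 2) (c5.pow 2)]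
    simp only [dx_sub_dx_interpRect hk]
    refine this.trans (mul_le_mul_of_nonneg_right (mul_le_mul_of_nonneg_left ?_ hC₁.le) ?_)
    · have t1 : (T.b - T.a) ^ (2 * k + 2) *
          (∫ y in T.c..T.d, ∫ x in T.a..T.b, dx^[k + 2] φ (x, y) ^ 2) ≤ h ^ (2 * k + 2) * N :=
        mul_le_mul (pow_le_pow_left₀ hba.le hbh _) n1 (nn T.hab T.hcd _) (by positivity)
      have t2 : (T.d - T.c) ^ (2 * k + 2) *
          (∫ y in T.c..T.d, ∫ x in T.a..T.b, dx (dy^[k + 1] φ) (x, y) ^ 2) ≤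
          h ^ (2 * k + 2) * N :=
        mul_le_mul (pow_le_pow_left₀ hdc.le hdh _) n2 (nn T.hab T.hcd _) (by positivity)
      linarith
    · exact intervalIntegral.integral_nonneg T.hcd.le fun y _ => integral_sq_nonneg T.hab.le
  have ay : (∫ p in T.toSet, (dy φ p - dy (interpRect k φ T) p) * dy (v.1 T) p) ^ 2 ≤
      C₁ * (2 * (h ^ (2 * k + 2) * N)) * ∫ p in T.toSet, dy (v.1 T) p ^ 2 := by
    have := H1 T.c T.d T.a T.b T.hcd T.hab (φ ∘ Prod.swap) sφ' (dy (v.1 T) ∘ Prod.swap)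
      (c6.comp continuous_swap) (fun y => by
      obtain ⟨q, hq, hqe⟩ := slice_fst_of_mem_Q (comp_swap_mem_Q (dy_mem_Q hv)) y
      exact ⟨q, by omega, hqe⟩)
    rw [setIntegral_rect (F := fun p => (dy φ p - dy (interpRect k φ T) p) * dy (v.1 T) p)
      (cY.mul c6), setIntegral_rect (F := fun p => dy (v.1 T) p ^ 2) (c6.pow 2)]
    simp only [dy_sub_dy_interpRect hk hφ]
    refine this.trans (mul_le_mul_of_nonneg_right (mul_le_mul_of_nonneg_left ?_ hC₁.le) ?_)
    · have t1 : (T.d - T.c) ^ (2 * k + 2) *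
          (∫ x in T.a..T.b, ∫ y in T.c..T.d, dx^[k + 2] (φ ∘ Prod.swap) (y, x) ^ 2) ≤
          h ^ (2 * k + 2) * N :=
        mul_le_mul (pow_le_pow_left₀ hdc.le hdh _) n4 (nn T.hcd T.hab _) (by positivity)
      have t2 : (T.b - T.a) ^ (2 * k + 2) *
          (∫ x in T.a..T.b, ∫ y in T.c..T.d, dx (dy^[k + 1] (φ ∘ Prod.swap)) (y, x) ^ 2) ≤
          h ^ (2 * k + 2) * N :=
        mul_le_mul (pow_le_pow_left₀ hba.le hbh _) n5 (nn T.hcd T.hab _) (by positivity)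
      linarith
    · exact intervalIntegral.integral_nonneg T.hab.le fun y _ => integral_sq_nonneg T.hcd.le
  -- Here `s` is the side normal to the edge and `t` the tangential one. Shape regularity replaces
  -- `s⁻¹` by `σ / h`, so `s⁻¹ t^{2k+2}` is of order `h^{2k+1}`.
  have hpow : ∀ {s t : ℝ}, 0 < s → 0 < t → s ≤ h → t ≤ h → s⁻¹ ≤ σ * h⁻¹ →
      ∀ {A B : ℝ}, A ≤ N → B ≤ N → 0 ≤ B →
      C₂ * (s ^ (2 * k - 1) * A + s⁻¹ * t ^ (2 * k + 2) * B) ≤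
        C₂ * ((1 + σ) * ((h ^ (2 * k - 1) + h ^ (2 * k + 1)) * N)) := by
    intro s t hs ht hsh hth hsi A B hA hB hB0
    refine mul_le_mul_of_nonneg_left ?_ hC₂.le
    have t1 : s ^ (2 * k - 1) * A ≤ h ^ (2 * k - 1) * N :=
      (mul_le_mul_of_nonneg_left hA (by positivity)).trans
        (mul_le_mul_of_nonneg_right (by gcongr) hN0)
    have t2 : s⁻¹ * t ^ (2 * k + 2) * B ≤ (σ * h⁻¹) * h ^ (2 * k + 2) * N := by gcongr
    have t3 : (σ * h⁻¹) * h ^ (2 * k + 2) * N = σ * (h ^ (2 * k + 1) * N) := by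
      rw [show 2 * k + 2 = 2 * k + 1 + 1 by ring, pow_succ h (2 * k + 1)]
      field_simp
    have t4 : 0 ≤ σ * (h ^ (2 * k - 1) * N) := by positivity
    have t5 : 0 ≤ h ^ (2 * k + 1) * N := by positivity
    nlinarith
  set M := (h ^ (2 * k - 1) + h ^ (2 * k + 1)) * N with hM
  have bx : ∀ x₀ ∈ Icc T.a T.b, ∫ t in T.c..T.d, (dx φ (x₀, t) -
      dx (interpRect k φ T) (x₀, t)) ^ 2 ≤ C₂ * ((1 + σ) * M) := by
    intro x₀ hx₀
    simp only [dx_sub_dx_interpRect hk]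
    exact (H2 T.a T.b T.c T.d T.hab T.hcd φ hφ x₀ hx₀).trans
      (hpow hba hdc hbh hdh hinv1 n3 n2 (nn T.hab T.hcd _))
  have bY : ∀ y₀ ∈ Icc T.c T.d, ∫ t in T.a..T.b, (dy φ (t, y₀) -
      dy (interpRect k φ T) (t, y₀)) ^ 2 ≤ C₂ * ((1 + σ) * M) := by
    intro y₀ hy₀
    simp only [dy_sub_dy_interpRect hk hφ]
    exact (H2 T.c T.d T.a T.b T.hcd T.hab (φ ∘ Prod.swap) sφ' y₀ hy₀).trans
      (hpow hdc hba hdh hbh hinv2 n6 n5 (nn T.hcd T.hab _))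
  have hfl := sq_flux_le (T := T) sv.continuous hvb cX cY
  have hfl2 := hfl.trans (mul_le_mul_of_nonneg_left
    (add_le_add (add_le_add (add_le_add (bY T.c (by simp [T.hcd.le])) (bY T.d (by simp [T.hcd.le])))
      (bx T.a (by simp [T.hab.le]))) (bx T.b (by simp [T.hab.le]))) hJ)
  have hG := H3 T hT v hv hvb
  rw [elementError_eq hk hv hvb hφ, integral_add (integrableOn_rect (by fun_prop))
    (integrableOn_rect (by fun_prop))]
  refine (two_sq_add_two_sq _ _).trans ?_
  rw [neg_sq]
  have e3 : C₁ * (2 * (h ^ (2 * k + 2) * N)) * (C₃ * (gradSq k T v + h⁻¹ * jumpSq T v)) =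
      2 * C₁ * C₃ * (N * (h ^ (2 * k + 2) * gradSq k T v + h ^ (2 * k + 1) * jumpSq T v)) := by
    rw [show 2 * k + 2 = 2 * k + 1 + 1 by ring, pow_succ h (2 * k + 1)]
    field_simp
  refine consistency_arith hC₁.le hC₂.le hC₃.le hσ.le hN0 hJ hW (by positivity)
    (by positivity) ax ay ?_ hfl2
  refine (mul_le_mul_of_nonneg_left hG ?_).trans e3.le
  positivity

section

/-! ### Weak derivatives -/

variable {Ω : Set (ℝ × ℝ)}

theorem IsTestFunction.dx {φ : ℝ × ℝ → ℝ} (h : IsTestFunction Ω φ) : IsTestFunction Ω (dx φ) :=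
  ⟨contDiff_dx h.1, h.2.1.fderiv_apply ℝ _, (tsupport_fderiv_apply_subset ℝ _).trans h.2.2⟩

theorem IsTestFunction.dy {φ : ℝ × ℝ → ℝ} (h : IsTestFunction Ω φ) : IsTestFunction Ω (dy φ) :=
  ⟨contDiff_dy h.1, h.2.1.fderiv_apply ℝ _, (tsupport_fderiv_apply_subset ℝ _).trans h.2.2⟩

theorem IsTestFunction.iterate {φ : ℝ × ℝ → ℝ} (h : IsTestFunction Ω φ) (i j : ℕ) :
    IsTestFunction Ω (WG.dx^[i] (WG.dy^[j] φ)) := by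
  have h1 : IsTestFunction Ω (WG.dy^[j] φ) := by
    induction j with
    | zero => exact h
    | succ n ih => rw [Function.iterate_succ_apply']; exact ih.dy
  induction i with
  | zero => exact h1
  | succ n ih => rw [Function.iterate_succ_apply']; exact ih.dx

theorem IsTestFunction.eq_zero {φ : ℝ × ℝ → ℝ} (h : IsTestFunction Ω φ) {p : ℝ × ℝ}
    (hp : p ∉ Ω) : φ p = 0 := image_eq_zero_of_notMem_tsupport fun hc => hp (h.2.2 hc)

theorem IsTestFunction.memLp {φ : ℝ × ℝ → ℝ} (h : IsTestFunction Ω φ) :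
    MemLp φ 2 (volume.restrict Ω) :=
  (h.1.continuous.memLp_of_hasCompactSupport h.2.1).restrict Ω

theorem IsTestFunction.setIntegral_mul {φ : ℝ × ℝ → ℝ} (h : IsTestFunction Ω φ) (u : ℝ × ℝ → ℝ) :
    ∫ p in Ω, u p * φ p = ∫ p, u p * φ p :=
  setIntegral_eq_integral_of_forall_compl_eq_zero fun p hp => by rw [h.eq_zero hp, mul_zero]

theorem integrable_mul_of_memLp {X : Type*} [MeasurableSpace X] {μ : Measure X} {u v : X → ℝ}
    (hu : MemLp u 2 μ) (hv : MemLp v 2 μ) : Integrable (fun p => u p * v p) μ :=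
  hu.integrable_mul hv

/-- The fundamental lemma of the calculus of variations. It yields both the uniqueness of weak
derivatives and the strong form of the equation. -/
theorem ae_eq_of_forall_testFunction (hΩ : IsOpen Ω) {w w' : ℝ × ℝ → ℝ}
    (hw : MemLp w 2 (volume.restrict Ω)) (hw' : MemLp w' 2 (volume.restrict Ω))
    (h : ∀ φ, IsTestFunction Ω φ → ∫ p in Ω, w p * φ p = ∫ p in Ω, w' p * φ p) :
    w =ᵐ[volume.restrict Ω] w' := by
  have h1 := hΩ.ae_eq_zero_of_integral_contDiff_smul_eq_zero (μ := volume)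
    (f := fun p => w p - w' p)
    (locallyIntegrableOn_of_locallyIntegrable_restrict
      ((hw.sub hw').locallyIntegrable (by norm_num))) (fun φ hφ hc hs => by
      have ht : IsTestFunction Ω φ := ⟨hφ, hc, hs⟩
      have := h φ ht
      rw [← sub_eq_zero, ← integral_sub (integrable_mul_of_memLp hw ht.memLp)
        (integrable_mul_of_memLp hw' ht.memLp)] at this
      rw [← this, ← setIntegral_eq_integral_of_forall_compl_eq_zero (s := Ω)
        (fun p hp => by rw [ht.eq_zero hp, zero_smul])]
      refine integral_congr_ae (.of_forall fun p => ?_)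
      simp only [smul_eq_mul]
      ring)
  rw [Filter.EventuallyEq, ae_restrict_iff' hΩ.measurableSet]
  filter_upwards [h1] with p hp hpΩ
  linarith [hp hpΩ]

theorem IsWeakDeriv.unique (hΩ : IsOpen Ω) {i j : ℕ} {u w w' : ℝ × ℝ → ℝ}
    (h : IsWeakDeriv Ω i j u w) (h' : IsWeakDeriv Ω i j u w') : w =ᵐ[volume.restrict Ω] w' := by
  refine ae_eq_of_forall_testFunction hΩ h.1 h'.1 fun φ hφ => ?_
  have h1 := h.2 φ hφ
  rw [h'.2 φ hφ] at h1
  have : ((-1 : ℝ)) ^ (i + j) ≠ 0 := pow_ne_zero _ (by norm_num)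
  exact (mul_left_cancel₀ this h1).symm

theorem isWeakDeriv_weakD {m : ℕ} {u : ℝ × ℝ → ℝ} (h : MemH Ω m u) {i j : ℕ} (hij : i + j ≤ m) :
    IsWeakDeriv Ω i j u (weakD Ω i j u) := by
  unfold weakD
  rw [dif_pos (h.2 i j hij)]
  exact (h.2 i j hij).choose_spec

theorem weakD_ae_eq (hΩ : IsOpen Ω) {i j : ℕ} {u w : ℝ × ℝ → ℝ} (h : IsWeakDeriv Ω i j u w) :
    weakD Ω i j u =ᵐ[volume.restrict Ω] w := by
  have hex : ∃ w, IsWeakDeriv Ω i j u w := ⟨w, h⟩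
  unfold weakD
  rw [dif_pos hex]
  exact hex.choose_spec.unique hΩ h

theorem isWeakDeriv_zero_zero {u : ℝ × ℝ → ℝ} (h : MemLp u 2 (volume.restrict Ω)) :
    IsWeakDeriv Ω 0 0 u u := ⟨h, fun φ _ => by simp⟩

theorem IsWeakDeriv.sub {i j : ℕ} {u u' w w' : ℝ × ℝ → ℝ}
    (hu : MemLp u 2 (volume.restrict Ω)) (hu' : MemLp u' 2 (volume.restrict Ω))
    (h : IsWeakDeriv Ω i j u w) (h' : IsWeakDeriv Ω i j u' w') :
    IsWeakDeriv Ω i j (u - u') (w - w') := by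
  refine ⟨h.1.sub h'.1, fun φ hφ => ?_⟩
  simp only [Pi.sub_apply, sub_mul]
  rw [integral_sub (integrable_mul_of_memLp hu (hφ.iterate i j).memLp)
    (integrable_mul_of_memLp hu' (hφ.iterate i j).memLp),
    integral_sub (integrable_mul_of_memLp h.1 hφ.memLp) (integrable_mul_of_memLp h'.1 hφ.memLp),
    h.2 φ hφ, h'.2 φ hφ]
  ring

theorem IsTestFunction.integral_mul_fderiv {φ ψ : ℝ × ℝ → ℝ} (h : IsTestFunction Ω φ)
    (h' : IsTestFunction Ω ψ) (e : ℝ × ℝ) :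
    ∫ p, φ p * fderiv ℝ ψ p e = -∫ p, fderiv ℝ φ p e * ψ p := by
  have c1 : Continuous fun p => fderiv ℝ φ p e :=
    ((h.1.fderiv_right (m := ∞) (by simp)).clm_apply contDiff_const).continuous
  have c2 : Continuous fun p => fderiv ℝ ψ p e :=
    ((h'.1.fderiv_right (m := ∞) (by simp)).clm_apply contDiff_const).continuous
  refine integral_mul_fderiv_eq_neg_fderiv_mul_of_integrable ?_ ?_ ?_
    (fun p _ => h.1.differentiable (by simp) p) (fun p _ => h'.1.differentiable (by simp) p)
  · exact (c1.mul h'.1.continuous).integrable_of_hasCompactSupport h'.2.1.mul_left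
  · exact (h.1.continuous.mul c2).integrable_of_hasCompactSupport h.2.1.mul_right
  · exact (h.1.continuous.mul h'.1.continuous).integrable_of_hasCompactSupport h.2.1.mul_right

theorem IsTestFunction.isWeakDeriv_dx {φ : ℝ × ℝ → ℝ} (h : IsTestFunction Ω φ) :
    IsWeakDeriv Ω 1 0 φ (WG.dx φ) := by
  refine ⟨h.dx.memLp, fun ψ hψ => ?_⟩
  have := h.integral_mul_fderiv hψ (1, 0)
  simp only [Function.iterate_one, Function.iterate_zero, id_eq, add_zero, pow_one, neg_mul, one_mul]
  rw [hψ.dx.setIntegral_mul, hψ.setIntegral_mul]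
  exact this

theorem IsTestFunction.isWeakDeriv_dy {φ : ℝ × ℝ → ℝ} (h : IsTestFunction Ω φ) :
    IsWeakDeriv Ω 0 1 φ (WG.dy φ) := by
  refine ⟨h.dy.memLp, fun ψ hψ => ?_⟩
  have := h.integral_mul_fderiv hψ (0, 1)
  simp only [Function.iterate_one, Function.iterate_zero, id_eq, zero_add, pow_one, neg_mul, one_mul]
  rw [hψ.dy.setIntegral_mul, hψ.setIntegral_mul]
  exact this

theorem IsTestFunction.memH_one {φ : ℝ × ℝ → ℝ} (h : IsTestFunction Ω φ) : MemH Ω 1 φ := by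
  refine ⟨h.memLp, fun i j hij => ?_⟩
  have : (i = 0 ∧ j = 0) ∨ (i = 1 ∧ j = 0) ∨ (i = 0 ∧ j = 1) := by omega
  rcases this with ⟨rfl, rfl⟩ | ⟨rfl, rfl⟩ | ⟨rfl, rfl⟩
  · exact ⟨_, isWeakDeriv_zero_zero h.memLp⟩
  · exact ⟨_, h.isWeakDeriv_dx⟩
  · exact ⟨_, h.isWeakDeriv_dy⟩

theorem sobolevNorm_one_sq (u : ℝ × ℝ → ℝ) : sobolevNorm Ω 1 u ^ 2 =
    (∫ p in Ω, weakD Ω 0 0 u p ^ 2) + (∫ p in Ω, weakD Ω 0 1 u p ^ 2) +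
      ∫ p in Ω, weakD Ω 1 0 u p ^ 2 := by
  unfold sobolevNorm
  rw [Real.sq_sqrt]
  · simp [Finset.sum_range_succ]
  · exact Finset.sum_nonneg fun _ _ => Finset.sum_nonneg fun _ _ =>
      integral_nonneg fun _ => sq_nonneg _

theorem IsTestFunction.memH10 (hΩ : IsOpen Ω) {φ : ℝ × ℝ → ℝ} (h : IsTestFunction Ω φ) :
    MemH10 Ω φ := by
  refine ⟨h.memH_one, fun ε hε => ⟨φ, h, ?_⟩⟩
  have h0 : ∀ i j, ∫ p in Ω, weakD Ω i j (φ - φ) p ^ 2 = 0 := by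
    intro i j
    have hz : IsWeakDeriv Ω i j (φ - φ) 0 := by
      refine ⟨MemLp.zero, fun ψ _ => ?_⟩
      simp
    have := weakD_ae_eq hΩ hz
    rw [← integral_zero (ℝ × ℝ) ℝ (μ := volume.restrict Ω)]
    refine integral_congr_ae ?_
    filter_upwards [this] with p hp
    rw [hp]
    simp
  have h1 : sobolevNorm Ω 1 (φ - φ) = 0 := by
    unfold sobolevNorm
    simp only [h0, Finset.sum_const_zero, Real.sqrt_zero]
  rw [h1]
  exact hε

/-- A weak solution in `H²` satisfies the equation almost everywhere. -/
theorem IsWeakSolution.ae_eq (hΩ : IsOpen Ω) {f u : ℝ × ℝ → ℝ} {m : ℕ} (hm : 2 ≤ m)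
    (hf : MemLp f 2 (volume.restrict Ω)) (h : IsWeakSolution Ω f u) (hu : MemH Ω m u) :
    f =ᵐ[volume.restrict Ω] fun p => -(weakD Ω 2 0 u p + weakD Ω 0 2 u p) := by
  have w20 := isWeakDeriv_weakD hu (i := 2) (j := 0) (by omega)
  have w02 := isWeakDeriv_weakD hu (i := 0) (j := 2) (by omega)
  have w10 := isWeakDeriv_weakD hu (i := 1) (j := 0) (by omega)
  have w01 := isWeakDeriv_weakD hu (i := 0) (j := 1) (by omega)
  refine ae_eq_of_forall_testFunction hΩ hf (w20.1.add w02.1).neg fun φ hφ => ?_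
  -- Test functions belong to `H^1_0`, so the weak formulation may be tested with them.
  have h1 := h.2 φ (hφ.memH10 hΩ)
  have d1 := weakD_ae_eq hΩ hφ.isWeakDeriv_dx
  have d2 := weakD_ae_eq hΩ hφ.isWeakDeriv_dy
  have h2 : ∫ p in Ω, (weakD Ω 1 0 u p * weakD Ω 1 0 φ p + weakD Ω 0 1 u p * weakD Ω 0 1 φ p) =
      ∫ p in Ω, (weakD Ω 1 0 u p * dx φ p + weakD Ω 0 1 u p * dy φ p) := by
    refine integral_congr_ae ?_
    filter_upwards [d1, d2] with p hp1 hp2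
    rw [hp1, hp2]
  rw [h2, integral_add (integrable_mul_of_memLp w10.1 hφ.dx.memLp)
    (integrable_mul_of_memLp w01.1 hφ.dy.memLp)] at h1
  -- All weak derivatives are derivatives of `u` itself. The integral of `u ∂_x² φ` therefore links
  -- `(u_x, ∂_x φ)` with `(u_xx, φ)`; likewise in `y`.
  have e1 := w10.2 (dx φ) hφ.dx
  have e2 := w01.2 (dy φ) hφ.dy
  have e3 := w20.2 φ hφ
  have e4 := w02.2 φ hφ
  simp only [Function.iterate_succ, Function.iterate_zero, Function.comp_apply, id_eq, add_zero,
    zero_add, pow_one, even_two, Even.neg_pow, one_pow, one_mul, neg_mul] at e1 e2 e3 e4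
  have h3 : ∫ p in Ω, -(weakD Ω 2 0 u p + weakD Ω 0 2 u p) * φ p =
      -((∫ p in Ω, weakD Ω 2 0 u p * φ p) + ∫ p in Ω, weakD Ω 0 2 u p * φ p) := by
    rw [← integral_add (integrable_mul_of_memLp w20.1 hφ.memLp)
      (integrable_mul_of_memLp w02.1 hφ.memLp), ← integral_neg]
    refine integral_congr_ae (.of_forall fun p => ?_)
    ring
  rw [h3, ← h1]
  linarith

end

section

/-! ### Mollification -/

/-- The convolution `f * ρ`. -/
def mollify (f ρ : ℝ × ℝ → ℝ) (x : ℝ × ℝ) : ℝ := ∫ y, f y * ρ (x - y)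

/-- A smooth nonnegative kernel of mass one supported in the ball of radius `r`. -/
structure IsMollifier (r : ℝ) (ρ : ℝ × ℝ → ℝ) : Prop where
  contDiff : ContDiff ℝ ∞ ρ
  nonneg : ∀ z, 0 ≤ ρ z
  integral_eq : ∫ z, ρ z = 1
  eq_zero : ∀ z, r ≤ ‖z‖ → ρ z = 0

theorem exists_isMollifier {r : ℝ} (hr : 0 < r) : ∃ ρ, IsMollifier r ρ := by
  let b : ContDiffBump (0 : ℝ × ℝ) := ⟨r / 2, r, by positivity, by linarith⟩
  refine ⟨b.normed volume, b.contDiff_normed, b.nonneg_normed, b.integral_normed, fun z hz => ?_⟩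
  have : z ∉ Function.support (b.normed volume) := by
    rw [b.support_normed_eq]
    simpa using hz
  simpa using this

namespace IsMollifier

variable {r : ℝ} {ρ : ℝ × ℝ → ℝ}

theorem hasCompactSupport (h : IsMollifier r ρ) : HasCompactSupport ρ := by
  refine HasCompactSupport.intro (isCompact_closedBall (0 : ℝ × ℝ) r) fun z hz => h.eq_zero z ?_
  simp only [Metric.mem_closedBall, dist_zero_right, not_le] at hz
  exact hz.le

theorem integral_sub (h : IsMollifier r ρ) (x : ℝ × ℝ) : ∫ y, ρ (x - y) = 1 := by
  rw [integral_sub_left_eq_self ρ volume x, h.integral_eq]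

end IsMollifier

theorem integrable_mollify {f ρ : ℝ × ℝ → ℝ} (hf : LocallyIntegrable f) (hρ : Continuous ρ)
    (hc : HasCompactSupport ρ) (x : ℝ × ℝ) : Integrable fun y => f y * ρ (x - y) :=
  (hc.convolutionExists_right (ContinuousLinearMap.lsmul ℝ ℝ) hf hρ x)

theorem contDiff_mollify {f ρ : ℝ × ℝ → ℝ} (hf : LocallyIntegrable f) (hρ : ContDiff ℝ ∞ ρ)
    (hc : HasCompactSupport ρ) : ContDiff ℝ ∞ (mollify f ρ) :=
  hc.contDiff_convolution_right (ContinuousLinearMap.lsmul ℝ ℝ) hf hρ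

theorem fderiv_mollify {f ρ : ℝ × ℝ → ℝ} (hf : LocallyIntegrable f) (hρ : ContDiff ℝ ∞ ρ)
    (hc : HasCompactSupport ρ) (x e : ℝ × ℝ) :
    fderiv ℝ (mollify f ρ) x e = mollify f (fun z => fderiv ℝ ρ z e) x := by
  have h := (hc.hasFDerivAt_convolution_right (ContinuousLinearMap.lsmul ℝ ℝ) hf
    (hρ.of_le (by simp)) x).fderiv
  have h2 : fderiv ℝ (mollify f ρ) x = _ := h
  rw [h2, convolution_precompR_apply _ hf (hc.fderiv ℝ) (hρ.continuous_fderiv (by simp))]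
  rfl

theorem iterate_mollify {f ρ : ℝ × ℝ → ℝ} (hf : LocallyIntegrable f) (hρ : ContDiff ℝ ∞ ρ)
    (hc : HasCompactSupport ρ) (i j : ℕ) :
    dx^[i] (dy^[j] (mollify f ρ)) = mollify f (dx^[i] (dy^[j] ρ)) := by
  have ht : IsTestFunction univ ρ := ⟨hρ, hc, subset_univ _⟩
  have h1 : dy^[j] (mollify f ρ) = mollify f (dy^[j] ρ) := by
    induction j with
    | zero => rfl
    | succ n ih =>
      rw [Function.iterate_succ_apply', ih, Function.iterate_succ_apply']
      have := ht.iterate 0 n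
      exact funext fun x => fderiv_mollify hf this.1 this.2.1 x _
  rw [h1]
  induction i with
  | zero => rfl
  | succ n ih =>
    rw [Function.iterate_succ_apply', ih, Function.iterate_succ_apply']
    have := ht.iterate n j
    exact funext fun x => fderiv_mollify hf this.1 this.2.1 x _

theorem fderiv_comp_affine {F : ℝ × ℝ → ℝ} (hF : Differentiable ℝ F) (c : ℝ × ℝ) (s : ℝ)
    (x e : ℝ × ℝ) : fderiv ℝ (fun x => F (c + s • x)) x e = s * fderiv ℝ F (c + s • x) e := by
  have h1 : HasFDerivAt (fun x : ℝ × ℝ => c + s • x) (s • ContinuousLinearMap.id ℝ (ℝ × ℝ)) x :=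
    ((hasFDerivAt_id x).const_smul s).const_add c
  have h2 := ((hF (c + s • x)).hasFDerivAt.comp x h1).fderiv
  have h3 : fderiv ℝ (fun x => F (c + s • x)) x = _ := h2
  rw [h3]
  simp

/-- This serves twice: with `s = 1 - δ` for the contraction of a mollified function, and with `s =
-1` for the kernel `y ↦ ρ (p - y)` used as a test function. -/
theorem iterate_comp_affine {F : ℝ × ℝ → ℝ} (hF : ContDiff ℝ ∞ F) (c : ℝ × ℝ) (s : ℝ) (i j : ℕ) :
    dx^[i] (dy^[j] fun x => F (c + s • x)) =
      fun x => s ^ (i + j) * (dx^[i] (dy^[j] F)) (c + s • x) := by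
  have h1 : dy^[j] (fun x => F (c + s • x)) = fun x => s ^ j * (dy^[j] F) (c + s • x) := by
    induction j with
    | zero => funext x; simp
    | succ n ih =>
      rw [Function.iterate_succ_apply', ih, Function.iterate_succ_apply']
      funext x
      have hd : Differentiable ℝ (dy^[n] F) := (contDiff_iterate_dy hF n).differentiable (by simp)
      have h2 : DifferentiableAt ℝ (fun x => (dy^[n] F) (c + s • x)) x :=
        (hd _).comp x (by fun_prop)
      show fderiv ℝ (fun x => s ^ n * (dy^[n] F) (c + s • x)) x (0, 1) = _
      rw [fderiv_const_mul h2, smul_apply, fderiv_comp_affine hd,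
        smul_eq_mul, pow_succ, mul_assoc]
      rfl
  rw [h1]
  induction i with
  | zero => simp
  | succ n ih =>
    rw [Function.iterate_succ_apply', ih, Function.iterate_succ_apply']
    funext x
    have hd : Differentiable ℝ (dx^[n] (dy^[j] F)) :=
      (contDiff_iterate_dx (contDiff_iterate_dy hF j) n).differentiable (by simp)
    have h2 : DifferentiableAt ℝ (fun x => (dx^[n] (dy^[j] F)) (c + s • x)) x :=
      (hd _).comp x (by fun_prop)
    show fderiv ℝ (fun x => s ^ (n + j) * (dx^[n] (dy^[j] F)) (c + s • x)) x (1, 0) = _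
    rw [fderiv_const_mul h2, smul_apply, fderiv_comp_affine hd,
      smul_eq_mul, show n + 1 + j = n + j + 1 by omega, pow_succ, mul_assoc]
    rfl

/-- A mollification is an average over the ball of radius `r`, so it is as close to `c` as the
averaged values are. -/
theorem abs_mollify_sub_le {r : ℝ} {ρ g : ℝ × ℝ → ℝ} (hρ : IsMollifier r ρ) (hg : Continuous g)
    {p : ℝ × ℝ} {c η : ℝ} (h : ∀ y, ‖p - y‖ < r → |g y - c| ≤ η) :
    |mollify g ρ p - c| ≤ η := by
  have i1 := integrable_mollify hg.locallyIntegrable hρ.contDiff.continuous hρ.hasCompactSupport p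
  have i2 := integrable_mollify (f := fun _ => (1 : ℝ)) continuous_const.locallyIntegrable
    hρ.contDiff.continuous hρ.hasCompactSupport p
  simp only [one_mul] at i2
  have e : mollify g ρ p - c = ∫ y, (g y - c) * ρ (p - y) := by
    simp only [sub_mul]
    rw [integral_sub i1 (i2.const_mul c), integral_const_mul, hρ.integral_sub, mul_one]
    rfl
  rw [e, ← Real.norm_eq_abs]
  calc _ ≤ ∫ y, η * ρ (p - y) := by
        refine norm_integral_le_of_norm_le (i2.const_mul η) (.of_forall fun y => ?_)
        rw [norm_mul, Real.norm_eq_abs, Real.norm_eq_abs, abs_of_nonneg (hρ.nonneg _)]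
        by_cases hy : ‖p - y‖ < r
        · exact mul_le_mul_of_nonneg_right (h y hy) (hρ.nonneg _)
        · rw [hρ.eq_zero _ (not_lt.1 hy)]
          simp
    _ = η := by rw [integral_const_mul, hρ.integral_sub, mul_one]

/-- Jensen's inequality, obtained as Cauchy–Schwarz with respect to the probability density `ρ (x -
·)`. -/
theorem sq_mollify_le {r : ℝ} {ρ f : ℝ × ℝ → ℝ} (hρ : IsMollifier r ρ) (hf : MemLp f 2)
    (x : ℝ × ℝ) : mollify f ρ x ^ 2 ≤ mollify (fun y => f y ^ 2) ρ x := by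
  have i2 := integrable_mollify (f := fun _ => (1 : ℝ)) continuous_const.locallyIntegrable
    hρ.contDiff.continuous hρ.hasCompactSupport x
  simp only [one_mul] at i2
  have i1 := integrable_mollify hf.integrable_sq.locallyIntegrable hρ.contDiff.continuous
    hρ.hasCompactSupport x
  have := sq_integral_le_mul_integral (F := fun y => f y * ρ (x - y)) i1 i2
    (.of_forall fun y => mul_nonneg (sq_nonneg _) (hρ.nonneg _))
    (.of_forall fun y => hρ.nonneg _) (.of_forall fun y => le_of_eq (by ring))
  rwa [hρ.integral_sub, mul_one] at this

/-- By Jensen it suffices to mollify `f²`, which preserves the integral. The substitution `c + s x`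
in the plane costs `s⁻² ≤ 4`. Uniformity in `ρ`, `c` and `s` is what the density argument needs. -/
theorem integral_sq_mollify_comp_le {r : ℝ} {ρ f : ℝ × ℝ → ℝ} (hρ : IsMollifier r ρ)
    (hf : MemLp f 2) (c : ℝ × ℝ) {s : ℝ} (hs : 1 / 2 ≤ s) :
    Integrable (fun x => mollify f ρ (c + s • x) ^ 2) ∧
    ∫ x, mollify f ρ (c + s • x) ^ 2 ≤ 4 * ∫ x, f x ^ 2 := by
  have iρ : Integrable ρ :=
    hρ.contDiff.continuous.integrable_of_hasCompactSupport hρ.hasCompactSupport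
  have i0 : Integrable (mollify (fun y => f y ^ 2) ρ) :=
    hf.integrable_sq.integrable_convolution (ContinuousLinearMap.lsmul ℝ ℝ) iρ
  have e0 : ∫ x, mollify (fun y => f y ^ 2) ρ x = ∫ x, f x ^ 2 := by
    have := integral_convolution (ContinuousLinearMap.lsmul ℝ ℝ) hf.integrable_sq iρ
    rw [hρ.integral_eq] at this
    refine Eq.trans ?_ (this.trans (by simp))
    rfl
  have hs0 : s ≠ 0 := by linarith
  have i1 : Integrable (fun x => mollify (fun y => f y ^ 2) ρ (c + s • x)) :=
    (i0.comp_add_left c).comp_smul hs0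
  have e1 : ∫ x, mollify (fun y => f y ^ 2) ρ (c + s • x) = (s ^ 2)⁻¹ * ∫ x, f x ^ 2 := by
    rw [Measure.integral_comp_smul volume (fun x => mollify (fun y => f y ^ 2) ρ (c + x)) s,
      integral_add_left_eq_self (μ := volume) (mollify (fun y => f y ^ 2) ρ) c, e0]
    simp
  have hl : LocallyIntegrable f := hf.locallyIntegrable (by norm_num)
  have hcont : Continuous fun x => mollify f ρ (c + s • x) ^ 2 :=
    ((contDiff_mollify hl hρ.contDiff hρ.hasCompactSupport).continuous.comp
      (by fun_prop)).pow 2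
  have i2 : Integrable fun x => mollify f ρ (c + s • x) ^ 2 := by
    refine i1.mono' hcont.aestronglyMeasurable (.of_forall fun x => ?_)
    rw [Real.norm_eq_abs, abs_of_nonneg (sq_nonneg _)]
    exact sq_mollify_le hρ hf _
  refine ⟨i2, (integral_mono i2 i1 fun x => sq_mollify_le hρ hf _).trans ?_⟩
  rw [e1]
  refine mul_le_mul_of_nonneg_right ?_ (integral_nonneg fun x => sq_nonneg _)
  rw [inv_le_comm₀ (by positivity) (by norm_num)]
  nlinarith

theorem mollify_sub {f g ρ : ℝ × ℝ → ℝ} (hf : LocallyIntegrable f) (hg : LocallyIntegrable g)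
    (hρ : Continuous ρ) (hc : HasCompactSupport ρ) (x : ℝ × ℝ) :
    mollify (fun y => f y - g y) ρ x = mollify f ρ x - mollify g ρ x := by
  unfold mollify
  simp only [sub_mul]
  exact integral_sub (integrable_mollify hf hρ hc x) (integrable_mollify hg hρ hc x)

open Filter Topology in
/-- Dilated mollifications of an `L²` function converge to it. -/
theorem tendsto_integral_sq_mollify_sub {f : ℝ × ℝ → ℝ} (hf : MemLp f 2) {K : Set (ℝ × ℝ)}
    (hK : IsCompact K) (c : ℝ × ℝ) (n : ℕ) {s : ℝ} {ρ : ℝ → ℝ × ℝ → ℝ}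
    (hρ : ∀ δ > 0, IsMollifier (δ * s) (ρ δ)) :
    Tendsto (fun δ : ℝ => ∫ x in K,
      ((1 - δ) ^ n * mollify f (ρ δ) (δ • c + (1 - δ) • x) - f x) ^ 2) (𝓝[>] 0) (𝓝 0) := by
  rw [Metric.tendsto_nhds]
  intro ε hε
  -- The function is replaced by a uniformly continuous `g`. The replacement costs `3·4·ε/60` inside
  -- the mollification and `3·ε/60` outside; with the `ε/4` allotted to `g`, the total is `ε/2`.
  obtain ⟨g, hgc, hge, hg, hg2⟩ := MemLp.exists_hasCompactSupport_integral_rpow_sub_le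
    (p := 2) (by norm_num) (f := f) (by simpa using hf) (show 0 < ε / 60 by positivity)
  replace hg2 : MemLp g 2 := by simpa using hg2
  have hge' : ∫ x, (f x - g x) ^ 2 ≤ ε / 60 := by
    refine le_trans (le_of_eq ?_) hge
    refine integral_congr_ae (.of_forall fun x => ?_)
    simp
  set M := volume.real K with hM
  have hM0 : 0 ≤ M := measureReal_nonneg
  obtain ⟨η, hη, hηM⟩ : ∃ η > 0, 3 * (η ^ 2 * M) ≤ ε / 4 := by
    refine ⟨Real.sqrt (ε / (12 * (M + 1))), by positivity, ?_⟩
    rw [Real.sq_sqrt (by positivity), div_mul_eq_mul_div, ← mul_div_assoc,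
      div_le_div_iff₀ (by positivity) (by positivity)]
    nlinarith
  obtain ⟨B, hB⟩ := hgc.exists_bound_of_continuous hg
  have hu := hgc.uniformContinuous_of_continuous hg
  rw [Metric.uniformContinuous_iff] at hu
  obtain ⟨θ, hθ, hgθ⟩ := hu (η / 2) (by positivity)
  obtain ⟨D, hD⟩ := hK.exists_bound_of_continuousOn (f := fun x : ℝ × ℝ => x - c) (by fun_prop)
  have t1 : Tendsto (fun δ : ℝ => δ * (D + s)) (𝓝[>] 0) (𝓝 0) := by
    have : Tendsto (fun δ : ℝ => δ * (D + s)) (𝓝 0) (𝓝 (0 * (D + s))) :=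
      tendsto_id.mul_const _
    rw [zero_mul] at this
    exact this.mono_left nhdsWithin_le_nhds
  have t2 : Tendsto (fun δ : ℝ => |(1 - δ) ^ n - 1| * B) (𝓝[>] 0) (𝓝 0) := by
    have : Continuous fun δ : ℝ => |(1 - δ) ^ n - 1| * B := by fun_prop
    have := this.tendsto 0
    simp only [sub_zero, one_pow, sub_self, abs_zero, zero_mul] at this
    exact this.mono_left nhdsWithin_le_nhds
  have hη2 : 0 < η / 2 := by positivity
  filter_upwards [t1.eventually (gt_mem_nhds hθ), t2.eventually (gt_mem_nhds hη2),
    Ioo_mem_nhdsGT (show (0 : ℝ) < 1 / 2 by norm_num)] with δ hδ1 hδ2 hδ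
  have hm := hρ δ hδ.1
  have hlf : LocallyIntegrable f := hf.locallyIntegrable (by norm_num)
  have hlg : LocallyIntegrable g := hg.locallyIntegrable
  have hpow : |(1 - δ) ^ n| ≤ 1 := by
    rw [abs_pow]
    exact pow_le_one₀ (abs_nonneg _) (abs_le.2 ⟨by linarith [hδ.2], by linarith [hδ.1]⟩)
  have hfg : MemLp (fun y => f y - g y) 2 := hf.sub hg2
  obtain ⟨i1, e1⟩ := integral_sq_mollify_comp_le hm hfg (δ • c) (s := 1 - δ) (by linarith [hδ.2])
  have i2 := hfg.integrable_sq
  -- Three errors: mollification of `f - g`, the displacement and rescaling of `g` (at most `η`),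
  -- and `f - g` itself.
  have key : ∀ x ∈ K, ((1 - δ) ^ n * mollify f (ρ δ) (δ • c + (1 - δ) • x) - f x) ^ 2 ≤
      3 * mollify (fun y => f y - g y) (ρ δ) (δ • c + (1 - δ) • x) ^ 2 + 3 * η ^ 2 +
        3 * (f x - g x) ^ 2 := by
    intro x hx
    set p := δ • c + (1 - δ) • x with hp
    have h1 := mollify_sub hlf hlg hm.contDiff.continuous hm.hasCompactSupport p
    have h2 : |mollify g (ρ δ) p - g x| ≤ η / 2 := by
      refine abs_mollify_sub_le hm hg fun y hy => ?_
      have hpx : ‖x - p‖ ≤ δ * D := by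
        have : x - p = δ • (x - c) := by rw [hp]; module
        rw [this, norm_smul, Real.norm_eq_abs, abs_of_pos hδ.1]
        exact mul_le_mul_of_nonneg_left (hD x hx) hδ.1.le
      have : dist y x < θ := by
        rw [dist_eq_norm, norm_sub_rev]
        calc ‖x - y‖ ≤ ‖x - p‖ + ‖p - y‖ := norm_sub_le_norm_sub_add_norm_sub _ _ _
          _ < θ := by linarith
      exact (hgθ this).le
    have h3 : |(1 - δ) ^ n * mollify g (ρ δ) p - g x| ≤ η := by
      have : (1 - δ) ^ n * mollify g (ρ δ) p - g x =
        (1 - δ) ^ n * (mollify g (ρ δ) p - g x) + ((1 - δ) ^ n - 1) * g x := by ring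
      rw [this]
      refine (abs_add_le _ _).trans ?_
      rw [abs_mul, abs_mul]
      have hb : |g x| ≤ B := hB x
      have : |(1 - δ) ^ n - 1| * |g x| ≤ |(1 - δ) ^ n - 1| * B :=
        mul_le_mul_of_nonneg_left hb (abs_nonneg _)
      have : |(1 - δ) ^ n| * |mollify g (ρ δ) p - g x| ≤ 1 * (η / 2) :=
        mul_le_mul hpow h2 (abs_nonneg _) zero_le_one
      linarith
    have h4 : ((1 - δ) ^ n * mollify g (ρ δ) p - g x) ^ 2 ≤ η ^ 2 := by
      rw [← sq_abs]
      exact pow_le_pow_left₀ (abs_nonneg _) h3 2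
    have h5 : ((1 - δ) ^ n * mollify (fun y => f y - g y) (ρ δ) p) ^ 2 ≤
        mollify (fun y => f y - g y) (ρ δ) p ^ 2 := by
      rw [mul_pow]
      have : ((1 - δ) ^ n) ^ 2 ≤ 1 := by
        rw [← sq_abs]
        exact pow_le_one₀ (abs_nonneg _) hpow
      nlinarith [sq_nonneg (mollify (fun y => f y - g y) (ρ δ) p)]
    rw [h1] at h5 ⊢
    set X := (1 - δ) ^ n * (mollify f (ρ δ) p - mollify g (ρ δ) p) with hX
    set Y := (1 - δ) ^ n * mollify g (ρ δ) p - g x with hY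
    have e : (1 - δ) ^ n * mollify f (ρ δ) p - f x = X + Y - (f x - g x) := by
      rw [hX, hY]; ring
    rw [e]
    nlinarith [sq_nonneg (X - Y), sq_nonneg (X + (f x - g x)), sq_nonneg (Y + (f x - g x))]
  have iK : IntegrableOn (fun _ : ℝ × ℝ => 3 * η ^ 2) K :=
    integrableOn_const hK.measure_lt_top.ne
  have iS := (((i1.integrableOn (s := K)).const_mul 3).add iK).add
    ((i2.integrableOn (s := K)).const_mul 3)
  have h0 : 0 ≤ ∫ x in K, ((1 - δ) ^ n * mollify f (ρ δ) (δ • c + (1 - δ) • x) - f x) ^ 2 :=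
    integral_nonneg fun _ => sq_nonneg _
  rw [Real.dist_eq, sub_zero, abs_of_nonneg h0]
  calc _ ≤ ∫ x in K, (3 * mollify (fun y => f y - g y) (ρ δ) (δ • c + (1 - δ) • x) ^ 2 +
        3 * η ^ 2 + 3 * (f x - g x) ^ 2) := by
        refine integral_mono_of_nonneg (.of_forall fun _ => sq_nonneg _) iS ?_
        filter_upwards [ae_restrict_mem hK.measurableSet] with x hx using key x hx
    _ = 3 * (∫ x in K, mollify (fun y => f y - g y) (ρ δ) (δ • c + (1 - δ) • x) ^ 2) +
        3 * η ^ 2 * M + 3 * ∫ x in K, (f x - g x) ^ 2 := by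
        have a1 := integral_add (((i1.integrableOn (s := K)).const_mul 3).add iK)
          ((i2.integrableOn (s := K)).const_mul 3)
        have a2 := integral_add ((i1.integrableOn (s := K)).const_mul 3) iK
        simp only [Pi.add_apply] at a1
        rw [a1, a2, setIntegral_const, smul_eq_mul, integral_const_mul, integral_const_mul, ← hM]
        ring
    _ < ε := by
        have b1 := setIntegral_le_integral i1 (s := K) (.of_forall fun _ => sq_nonneg _)
        have b2 := setIntegral_le_integral i2 (s := K) (.of_forall fun _ => sq_nonneg _)
        nlinarith

open Filter Topology in
/-- Functions smooth up to the boundary are dense in `H^m` of a rectangle. -/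
theorem exists_contDiff_forall_integral_sq_lt {Ω : Set (ℝ × ℝ)} {m : ℕ}
    {u : ℝ × ℝ → ℝ} (hu : MemH Ω m u) {R : Rect} (hR : R.openSet ⊆ Ω) {ε : ℝ} (hε : 0 < ε) :
    ∃ φ : ℝ × ℝ → ℝ, ContDiff ℝ ∞ φ ∧ ∀ i j, i + j ≤ m →
      ∫ p in R.toSet, ((dx^[i] (dy^[j] φ)) p - weakD Ω i j u p) ^ 2 < ε := by
  -- Contracting by `1 - δ` towards the centre moves every point of the open rectangle farther than
  -- `δ s` from the boundary. A kernel of radius `δ s` therefore never looks outside.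
  set s := min (R.b - R.a) (R.d - R.c) / 2 with hs
  have hs0 : 0 < s := by
    have := R.hab; have := R.hcd
    have : 0 < min (R.b - R.a) (R.d - R.c) := lt_min (by linarith) (by linarith)
    positivity
  have hs1 : s ≤ (R.b - R.a) / 2 := div_le_div_of_nonneg_right (min_le_left _ _) (by norm_num)
  have hs2 : s ≤ (R.d - R.c) / 2 := div_le_div_of_nonneg_right (min_le_right _ _) (by norm_num)
  have hex : ∀ δ : ℝ, ∃ ρ, 0 < δ → IsMollifier (δ * s) ρ := fun δ => by
    by_cases h : 0 < δ
    · obtain ⟨ρ, hρ⟩ := exists_isMollifier (mul_pos h hs0)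
      exact ⟨ρ, fun _ => hρ⟩
    · exact ⟨0, fun h' => absurd h' h⟩
  choose ρ hρ using hex
  set c : ℝ × ℝ := ((R.a + R.b) / 2, (R.c + R.d) / 2) with hc
  have hRm : MeasurableSet R.openSet := R.isOpen_openSet.measurableSet
  have hmem : ∀ w : ℝ × ℝ → ℝ, MemLp w 2 (volume.restrict Ω) → MemLp (R.openSet.indicator w) 2 :=
    fun w hw => (memLp_indicator_iff_restrict hRm).2 (hw.mono_measure (Measure.restrict_mono_set _ hR))
  have hev : ∀ᶠ δ in 𝓝[>] (0 : ℝ), ∀ q ∈ Finset.range (m + 1) ×ˢ Finset.range (m + 1),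
      q.1 + q.2 ≤ m → ∫ x in R.toSet, ((1 - δ) ^ (q.1 + q.2) *
        mollify (R.openSet.indicator (weakD Ω q.1 q.2 u)) (ρ δ) (δ • c + (1 - δ) • x) -
          R.openSet.indicator (weakD Ω q.1 q.2 u) x) ^ 2 < ε := by
    rw [Finset.eventually_all]
    rintro ⟨i, j⟩ -
    by_cases hij : i + j ≤ m
    · have := tendsto_integral_sq_mollify_sub (hmem _ (isWeakDeriv_weakD hu hij).1)
        R.isCompact_toSet c (i + j) hρ
      filter_upwards [this.eventually (gt_mem_nhds hε)] with δ hδ _ using hδ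
    · exact .of_forall fun δ h => absurd h hij
  obtain ⟨δ, hδ, hδ01⟩ := (hev.and (Ioo_mem_nhdsGT (show (0 : ℝ) < 1 / 2 by norm_num))).exists
  have hm := hρ δ hδ01.1
  have hlu : LocallyIntegrable (R.openSet.indicator u) :=
    (hmem u hu.1).locallyIntegrable (by norm_num)
  have hsm := contDiff_mollify hlu hm.contDiff hm.hasCompactSupport
  refine ⟨fun x => mollify (R.openSet.indicator u) (ρ δ) (δ • c + (1 - δ) • x),
    hsm.comp (by fun_prop), fun i j hij => ?_⟩
  refine lt_of_le_of_lt (le_of_eq ?_) (hδ (i, j) (by simp; omega) hij)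
  rw [R.restrict_toSet_eq]
  refine setIntegral_congr_fun hRm fun x hx => ?_
  simp only
  rw [indicator_of_mem hx, iterate_comp_affine hsm]
  simp only
  rw [iterate_mollify hlu hm.contDiff hm.hasCompactSupport]
  congr 3
  set p := δ • c + (1 - δ) • x with hp
  -- The reflected and shifted kernel is a test function in the rectangle. Inserting it in the
  -- definition of the weak derivative shows that differentiating the mollification at `p` is the
  -- same as mollifying the weak derivative.
  set ψ : ℝ × ℝ → ℝ := fun y => ρ δ (p + (-1 : ℝ) • y) with hψ
  have hps : ∀ y, p + (-1 : ℝ) • y = p - y := fun y => by module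
  have hsub : Metric.closedBall p (δ * s) ⊆ R.openSet := by
    intro y hy
    rw [Metric.mem_closedBall, dist_eq_norm, Prod.norm_def, max_le_iff] at hy
    simp only [hp, hc, Rect.openSet, mem_prod, mem_Ioo, Prod.fst_sub, Prod.snd_sub, Prod.fst_add,
      Prod.snd_add, Prod.smul_fst, Prod.smul_snd, smul_eq_mul, Real.norm_eq_abs, abs_le] at hy hx ⊢
    obtain ⟨⟨h1, h2⟩, h3, h4⟩ := hy
    obtain ⟨⟨h5, h6⟩, h7, h8⟩ := hx
    have d1 : δ * s ≤ δ * ((R.b - R.a) / 2) := mul_le_mul_of_nonneg_left hs1 hδ01.1.le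
    have d2 : δ * s ≤ δ * ((R.d - R.c) / 2) := mul_le_mul_of_nonneg_left hs2 hδ01.1.le
    have hl : 0 < 1 - δ := by linarith [hδ01.2]
    refine ⟨⟨?_, ?_⟩, ?_, ?_⟩
    · nlinarith [mul_lt_mul_of_pos_left h5 hl]
    · nlinarith [mul_lt_mul_of_pos_left h6 hl]
    · nlinarith [mul_lt_mul_of_pos_left h7 hl]
    · nlinarith [mul_lt_mul_of_pos_left h8 hl]
  have hsupp : tsupport ψ ⊆ Metric.closedBall p (δ * s) := by
    refine closure_minimal (fun y hy => ?_) Metric.isClosed_closedBall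
    by_contra hcon
    rw [Metric.mem_closedBall, dist_comm, dist_eq_norm, not_le] at hcon
    refine hy ?_
    simp only [hψ]
    rw [hps]
    exact hm.eq_zero _ hcon.le
  have ht : IsTestFunction R.openSet ψ :=
    ⟨hm.contDiff.comp (by fun_prop),
      (isCompact_closedBall p (δ * s)).of_isClosed_subset (isClosed_tsupport _) hsupp,
      hsupp.trans hsub⟩
  have htΩ : IsTestFunction Ω ψ := ⟨ht.1, ht.2.1, ht.2.2.trans hR⟩
  have key := (isWeakDeriv_weakD hu hij).2 ψ htΩ
  have hind : ∀ (w χ : ℝ × ℝ → ℝ), IsTestFunction R.openSet χ →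
      ∫ y, R.openSet.indicator w y * χ y = ∫ y in Ω, w y * χ y := by
    intro w χ hχ
    have hχΩ : IsTestFunction Ω χ := ⟨hχ.1, hχ.2.1, hχ.2.2.trans hR⟩
    rw [hχΩ.setIntegral_mul]
    refine integral_congr_ae (.of_forall fun y => ?_)
    by_cases hy : y ∈ R.openSet
    · simp only [indicator_of_mem hy]
    · simp only [hχ.eq_zero hy, mul_zero]
  rw [← hind _ _ (ht.iterate i j), ← hind _ _ ht, hψ, iterate_comp_affine hm.contDiff] at key
  have hl : ∫ y, R.openSet.indicator u y *
      ((-1) ^ (i + j) * (dx^[i] (dy^[j] (ρ δ))) (p + (-1 : ℝ) • y)) =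
      (-1) ^ (i + j) * mollify (R.openSet.indicator u) (dx^[i] (dy^[j] (ρ δ))) p := by
    unfold mollify
    rw [← integral_const_mul]
    refine integral_congr_ae (.of_forall fun y => ?_)
    simp only [hps]
    ring
  rw [hl] at key
  have h1 : ((-1 : ℝ)) ^ (i + j) ≠ 0 := pow_ne_zero _ (by norm_num)
  rw [mul_left_cancel₀ h1 key]
  unfold mollify
  simp only [hps]

end


/-! ### Trace inequalities and continuous representatives on a rectangle -/

/-- Average `g(x)² ≤ 2 g(t)² + 2 (g(x) - g(t))²` over `t` and bound the increment by the derivative.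
-/
theorem mul_sq_le_integral_sq_add {g g' : ℝ → ℝ} {a b x : ℝ}
    (hg : ∀ t, HasDerivAt g (g' t) t) (hg' : Continuous g') (hx : x ∈ Icc a b) :
    (b - a) * g x ^ 2 ≤
      2 * (∫ t in a..b, g t ^ 2) + 2 * (b - a) ^ 2 * ∫ t in a..b, g' t ^ 2 := by
  have hab : a ≤ b := hx.1.trans hx.2
  have hc : Continuous g := continuous_iff_continuousAt.2 fun t => (hg t).continuousAt
  set D := ∫ t in a..b, g' t ^ 2 with hD
  have h : ∫ _t in a..b, g x ^ 2 ≤ ∫ t in a..b, (2 * g t ^ 2 + 2 * ((b - a) * D)) := by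
    refine intervalIntegral.integral_mono_on hab (by simp)
      (Continuous.intervalIntegrable (by fun_prop) _ _) fun t ht => ?_
    have h1 := sq_sub_le_integral_sq_deriv hg hg' hx ht
    have h2 := two_sq_add_two_sq (g t) (g x - g t)
    rw [add_sub_cancel] at h2
    linarith
  rw [intervalIntegral.integral_add (Continuous.intervalIntegrable (by fun_prop) _ _) (by simp),
    intervalIntegral.integral_const_mul, intervalIntegral.integral_const,
    intervalIntegral.integral_const, smul_eq_mul, smul_eq_mul] at h
  linarith

theorem trace_vert_le {φ : ℝ × ℝ → ℝ} (hφ : ContDiff ℝ ∞ φ) (R : Rect) {x : ℝ}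
    (hx : x ∈ Icc R.a R.b) :
    (R.b - R.a) * (∫ t in R.c..R.d, φ (x, t) ^ 2) ≤
      2 * (∫ p in R.toSet, φ p ^ 2) + 2 * (R.b - R.a) ^ 2 * ∫ p in R.toSet, dx φ p ^ 2 := by
  have c0 := hφ.continuous
  have c1 := (contDiff_dx hφ).continuous
  have k0 : Continuous fun p => φ p ^ 2 := by fun_prop
  have k1 : Continuous fun p => dx φ p ^ 2 := by fun_prop
  rw [setIntegral_rect' k0, setIntegral_rect' k1, ← intervalIntegral.integral_const_mul,
    ← intervalIntegral.integral_const_mul, ← intervalIntegral.integral_const_mul,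
    ← intervalIntegral.integral_add]
  · refine intervalIntegral.integral_mono_on R.hcd.le
      (Continuous.intervalIntegrable (by fun_prop) _ _)
      (Continuous.intervalIntegrable ?_ _ _) fun t _ => ?_
    · exact (continuous_const.mul (continuous_integral_fst k0 _ _)).add
        (continuous_const.mul (continuous_integral_fst k1 _ _))
    · exact mul_sq_le_integral_sq_add (g := fun s => φ (s, t)) (g' := fun s => dx φ (s, t))
        (fun s => hasDerivAt_slice_fst hφ s t) (by fun_prop) hx
  · exact (continuous_const.mul (continuous_integral_fst k0 _ _)).intervalIntegrable _ _
  · exact (continuous_const.mul (continuous_integral_fst k1 _ _)).intervalIntegrable _ _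

theorem trace_horiz_le {φ : ℝ × ℝ → ℝ} (hφ : ContDiff ℝ ∞ φ) (R : Rect) {y : ℝ}
    (hy : y ∈ Icc R.c R.d) :
    (R.d - R.c) * (∫ t in R.a..R.b, φ (t, y) ^ 2) ≤
      2 * (∫ p in R.toSet, φ p ^ 2) + 2 * (R.d - R.c) ^ 2 * ∫ p in R.toSet, dy φ p ^ 2 := by
  have c0 := hφ.continuous
  have c1 := (contDiff_dy hφ).continuous
  have k0 : Continuous fun p => φ p ^ 2 := by fun_prop
  have k1 : Continuous fun p => dy φ p ^ 2 := by fun_prop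
  rw [setIntegral_rect k0, setIntegral_rect k1, ← intervalIntegral.integral_const_mul,
    ← intervalIntegral.integral_const_mul, ← intervalIntegral.integral_const_mul,
    ← intervalIntegral.integral_add]
  · refine intervalIntegral.integral_mono_on R.hab.le
      (Continuous.intervalIntegrable (by fun_prop) _ _)
      (Continuous.intervalIntegrable ?_ _ _) fun t _ => ?_
    · exact (continuous_const.mul (continuous_integral_snd k0 _ _)).add
        (continuous_const.mul (continuous_integral_snd k1 _ _))
    · exact mul_sq_le_integral_sq_add (g := fun s => φ (t, s)) (g' := fun s => dy φ (t, s))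
        (fun s => hasDerivAt_slice_snd hφ t s) (by fun_prop) hy
  · exact (continuous_const.mul (continuous_integral_snd k0 _ _)).intervalIntegrable _ _
  · exact (continuous_const.mul (continuous_integral_snd k1 _ _)).intervalIntegrable _ _

/-- The constant may depend on `R` in any way: this bound is only used to pass to limits on a fixed
rectangle, so no scaling is tracked. -/
theorem exists_trace_le (R : Rect) : ∃ K : ℝ, 0 ≤ K ∧ ∀ φ : ℝ × ℝ → ℝ, ContDiff ℝ ∞ φ → ∀ i,
    ∫ t in (R.side i).lo..(R.side i).hi, φ ((R.side i).point t) ^ 2 ≤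
      K * ((∫ p in R.toSet, φ p ^ 2) + (∫ p in R.toSet, dx φ p ^ 2) +
        ∫ p in R.toSet, dy φ p ^ 2) := by
  have hL := sub_pos.2 R.hab
  have hM := sub_pos.2 R.hcd
  set L := R.b - R.a
  set M := R.d - R.c
  refine ⟨2 / L + 2 * L + (2 / M + 2 * M), by positivity, fun φ hφ i => ?_⟩
  have n0 : 0 ≤ ∫ p in R.toSet, φ p ^ 2 := integral_nonneg fun _ => sq_nonneg _
  have n1 : 0 ≤ ∫ p in R.toSet, dx φ p ^ 2 := integral_nonneg fun _ => sq_nonneg _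
  have n2 : 0 ≤ ∫ p in R.toSet, dy φ p ^ 2 := integral_nonneg fun _ => sq_nonneg _
  have hv := fun x hx => trace_vert_le hφ R (x := x) hx
  have hh := fun y hy => trace_horiz_le hφ R (y := y) hy
  set A := ∫ p in R.toSet, φ p ^ 2
  set B := ∫ p in R.toSet, dx φ p ^ 2
  set D := ∫ p in R.toSet, dy φ p ^ 2
  have aux : ∀ L M I B D : ℝ, 0 < L → 0 < M → 0 ≤ B → 0 ≤ D → L * I ≤ 2 * A + 2 * L ^ 2 * B →
      I ≤ (2 / L + 2 * L + (2 / M + 2 * M)) * (A + B + D) := by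
    intro L M I B D hL hM hB hD h
    have h1 : I ≤ (2 / L) * A + 2 * L * B := by
      have : (2 / L) * A + 2 * L * B = (2 * A + 2 * L ^ 2 * B) / L := by field_simp
      rw [this, le_div_iff₀ hL]
      linarith
    have p1 : 0 ≤ (2 / L) * (B + D) := by positivity
    have p2 : 0 ≤ 2 * L * (A + D) := by positivity
    have p3 : 0 ≤ (2 / M + 2 * M) * (A + B + D) := by positivity
    linarith
  have hab := R.hab.le
  have hcd := R.hcd.le
  fin_cases i
  · have := aux M L _ D B hM hL n2 n1 (hh R.c ⟨le_rfl, hcd⟩)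
    simp only [Rect.side, Edge.lo, Edge.hi, Edge.point, Fin.zero_eta, Matrix.cons_val]
    linarith
  · have := aux M L _ D B hM hL n2 n1 (hh R.d ⟨hcd, le_rfl⟩)
    simp only [Rect.side, Edge.lo, Edge.hi, Edge.point, Fin.mk_one, Matrix.cons_val]
    linarith
  · have := aux L M _ B D hL hM n1 n2 (hv R.a ⟨le_rfl, hab⟩)
    simp only [Rect.side, Edge.lo, Edge.hi, Edge.point, Fin.reduceFinMk, Matrix.cons_val]
    linarith
  · have := aux L M _ B D hL hM n1 n2 (hv R.b ⟨hab, le_rfl⟩)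
    simp only [Rect.side, Edge.lo, Edge.hi, Edge.point, Fin.reduceFinMk, Matrix.cons_val]
    linarith

/-- A Sobolev inequality on a rectangle. -/
theorem exists_sq_le_mul (R : Rect) : ∃ K : ℝ, 0 ≤ K ∧ ∀ φ : ℝ × ℝ → ℝ, ContDiff ℝ ∞ φ →
    ∀ p ∈ R.toSet, φ p ^ 2 ≤ K * ∑ i ∈ Finset.range 2, ∑ j ∈ Finset.range 2,
      ∫ p in R.toSet, (dx^[i] (dy^[j] φ)) p ^ 2 := by
  have hL := sub_pos.2 R.hab
  have hM := sub_pos.2 R.hcd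
  set L := R.b - R.a with hLd
  set M := R.d - R.c with hMd
  refine ⟨(4 + 4 * M ^ 2 + 4 * L ^ 2 + 4 * L ^ 2 * M ^ 2) / (L * M), by positivity,
    fun φ hφ p hp => ?_⟩
  obtain ⟨x, y⟩ := p
  -- The point value is bounded along a horizontal line, and the line integrals of `φ` and `∂_x φ`
  -- by the trace inequality in `y`. Thus only derivatives of order at most one in each variable
  -- occur.
  have h1 := mul_sq_le_integral_sq_add (g := fun s => φ (s, y)) (g' := fun s => dx φ (s, y))
    (fun s => hasDerivAt_slice_fst hφ s y) (contDiff_slice_fst (contDiff_dx hφ) y).continuous hp.1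
  have h2 := trace_horiz_le hφ R hp.2
  have h3 := trace_horiz_le (contDiff_dx hφ) R hp.2
  rw [← dx_dy_comm hφ] at h3
  simp only [Finset.sum_range_succ, Finset.sum_range_zero, zero_add, Function.iterate_zero, id_eq,
    Function.iterate_one, ← hLd, ← hMd] at h1 h2 h3 ⊢
  have n0 : 0 ≤ ∫ p in R.toSet, φ p ^ 2 := integral_nonneg fun _ => sq_nonneg _
  have n1 : 0 ≤ ∫ p in R.toSet, dx φ p ^ 2 := integral_nonneg fun _ => sq_nonneg _
  have n2 : 0 ≤ ∫ p in R.toSet, dy φ p ^ 2 := integral_nonneg fun _ => sq_nonneg _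
  have n3 : 0 ≤ ∫ p in R.toSet, dx (dy φ) p ^ 2 := integral_nonneg fun _ => sq_nonneg _
  set A := ∫ p in R.toSet, φ p ^ 2
  set B := ∫ p in R.toSet, dx φ p ^ 2
  set D := ∫ p in R.toSet, dy φ p ^ 2
  set E := ∫ p in R.toSet, dx (dy φ) p ^ 2
  rw [div_mul_eq_mul_div, le_div_iff₀ (by positivity)]
  have e1 := mul_le_mul_of_nonneg_left h1 hM.le
  have e3 := mul_le_mul_of_nonneg_left h3 (show 0 ≤ 2 * L ^ 2 by positivity)
  have e : φ (x, y) ^ 2 * (L * M) ≤ 4 * A + 4 * M ^ 2 * D + 4 * L ^ 2 * B +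
      4 * L ^ 2 * M ^ 2 * E := by
    linarith
  refine e.trans ?_
  have q1 : 0 ≤ M ^ 2 := by positivity
  have q2 : 0 ≤ L ^ 2 := by positivity
  have q3 : 0 ≤ L ^ 2 * M ^ 2 := by positivity
  nlinarith [mul_nonneg q1 n0, mul_nonneg q1 n1, mul_nonneg q1 n3, mul_nonneg q2 n0,
    mul_nonneg q2 n2, mul_nonneg q2 n3, mul_nonneg q3 n0, mul_nonneg q3 n1, mul_nonneg q3 n2]

theorem integral_sq_sub_le {X : Type*} [MeasurableSpace X] {μ : Measure X} {f g h : X → ℝ}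
    (hf : MemLp f 2 μ) (hg : MemLp g 2 μ) (hh : MemLp h 2 μ) :
    ∫ x, (f x - g x) ^ 2 ∂μ ≤ 2 * (∫ x, (f x - h x) ^ 2 ∂μ) + 2 * ∫ x, (g x - h x) ^ 2 ∂μ := by
  have i1 := (hf.sub hh).integrable_sq
  have i2 := (hg.sub hh).integrable_sq
  have i3 := (hf.sub hg).integrable_sq
  simp only [Pi.sub_apply] at i1 i2 i3
  rw [← integral_const_mul, ← integral_const_mul,
    ← integral_add (i1.const_mul 2) (i2.const_mul 2)]
  refine integral_mono i3 ((i1.const_mul 2).add (i2.const_mul 2)) fun x => ?_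
  have := two_sq_add_two_sq (f x - h x) (h x - g x)
  simp only [sub_add_sub_cancel] at this
  nlinarith

theorem memLp_rect {R : Rect} {F : ℝ × ℝ → ℝ} (hF : ContinuousOn F R.toSet) :
    MemLp F 2 (volume.restrict R.toSet) := by
  have hm : AEStronglyMeasurable F (volume.restrict R.toSet) :=
    (integrableOn_rect hF).aestronglyMeasurable
  exact (memLp_two_iff_integrable_sq hm).2 (integrableOn_rect (hF.pow 2))

open Filter Topology in
-- Applied to differences, the Sobolev inequality makes `L²` convergence of the mixed derivatives
-- uniform. The limits `w` are kept abstract so that the lemma applies to a function and to its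
-- first derivatives alike.
theorem exists_tendstoUniformlyOn {R : Rect} {ψ : ℕ → ℝ × ℝ → ℝ} (hψ : ∀ n, ContDiff ℝ ∞ (ψ n))
    {w : ℕ → ℕ → ℝ × ℝ → ℝ}
    (hw : ∀ i ≤ 1, ∀ j ≤ 1, MemLp (w i j) 2 (volume.restrict R.toSet))
    (h : ∀ i ≤ 1, ∀ j ≤ 1, Tendsto (fun n => ∫ p in R.toSet,
      ((dx^[i] (dy^[j] (ψ n))) p - w i j p) ^ 2) atTop (𝓝 0)) :
    ∃ U : ℝ × ℝ → ℝ, TendstoUniformlyOn ψ U atTop R.toSet ∧ ContinuousOn U R.toSet ∧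
      U =ᵐ[volume.restrict R.toSet] w 0 0 := by
  obtain ⟨K, hK0, hK⟩ := exists_sq_le_mul R
  set e : ℕ → ℝ := fun n => ∑ i ∈ Finset.range 2, ∑ j ∈ Finset.range 2,
    ∫ p in R.toSet, ((dx^[i] (dy^[j] (ψ n))) p - w i j p) ^ 2 with he
  have hsm : ∀ n i j, ContDiff ℝ ∞ (dx^[i] (dy^[j] (ψ n))) := fun n i j =>
    contDiff_iterate_dx (contDiff_iterate_dy (hψ n) j) i
  have he0 : Tendsto e atTop (𝓝 0) := by
    have : Tendsto e atTop (𝓝 (∑ i ∈ Finset.range 2, ∑ j ∈ Finset.range 2, (0 : ℝ))) :=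
      tendsto_finsetSum _ fun i hi => tendsto_finsetSum _ fun j hj =>
        h i (by simp at hi; omega) j (by simp at hj; omega)
    simpa using this
  have hdiff : ∀ n m, ∀ p ∈ R.toSet, (ψ n p - ψ m p) ^ 2 ≤ K * (2 * (e n + e m)) := by
    intro n m p hp
    refine (hK (ψ n - ψ m) ((hψ n).sub (hψ m)) p hp).trans (mul_le_mul_of_nonneg_left ?_ hK0)
    rw [mul_add, he]
    simp only [Finset.mul_sum, ← Finset.sum_add_distrib]
    refine Finset.sum_le_sum fun i hi => Finset.sum_le_sum fun j hj => ?_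
    have hi' : i ≤ 1 := by simp at hi; omega
    have hj' : j ≤ 1 := by simp at hj; omega
    rw [iterate_dy_sub (hψ n) (hψ m), iterate_dx_sub (contDiff_iterate_dy (hψ n) j)
      (contDiff_iterate_dy (hψ m) j)]
    exact integral_sq_sub_le (memLp_rect (hsm n i j).continuous.continuousOn)
      (memLp_rect (hsm m i j).continuous.continuousOn) (hw i hi' j hj')
  have hC : UniformCauchySeqOn ψ atTop R.toSet := by
    rw [Metric.uniformCauchySeqOn_iff]
    intro ε hε
    have hη : 0 < ε ^ 2 / (4 * K + 1) := by positivity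
    obtain ⟨N, hN⟩ := eventually_atTop.1 (he0.eventually (gt_mem_nhds hη))
    refine ⟨N, fun m hm n hn x hx => ?_⟩
    rw [Real.dist_eq]
    apply abs_lt_of_sq_lt_sq _ hε.le
    have h1 := hdiff m n x hx
    have h2 := hN m hm
    have h3 := hN n hn
    have h4 : K * (2 * (e m + e n)) ≤ K * (4 * (ε ^ 2 / (4 * K + 1))) :=
      mul_le_mul_of_nonneg_left (by linarith) hK0
    have h5 : K * (4 * (ε ^ 2 / (4 * K + 1))) < ε ^ 2 := by
      rw [← mul_div_assoc, ← mul_div_assoc, div_lt_iff₀ (by positivity)]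
      nlinarith [sq_pos_of_pos hε]
    linarith
  have hlim : ∀ x, ∃ l, x ∈ R.toSet → Tendsto (fun n => ψ n x) atTop (𝓝 l) := by
    intro x
    by_cases hx : x ∈ R.toSet
    · obtain ⟨l, hl⟩ := cauchySeq_tendsto_of_complete (hC.cauchy_map hx)
      exact ⟨l, fun _ => hl⟩
    · exact ⟨0, fun h => absurd h hx⟩
  choose U hU using hlim
  have hun : TendstoUniformlyOn ψ U atTop R.toSet := hC.tendstoUniformlyOn_of_tendsto hU
  have hcU : ContinuousOn U R.toSet :=
    hun.continuousOn (Frequently.of_forall fun n => (hψ n).continuous.continuousOn)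
  refine ⟨U, hun, hcU, ?_⟩
  have hmU := memLp_rect hcU
  have hw0 := hw 0 (by norm_num) 0 (by norm_num)
  have hM : (0 : ℝ) ≤ volume.real R.toSet := measureReal_nonneg
  have hz : ∫ p in R.toSet, (U p - w 0 0 p) ^ 2 = 0 := by
    refine le_antisymm ?_ (integral_nonneg fun _ => sq_nonneg _)
    have hle : ∀ n, ∫ p in R.toSet, (U p - w 0 0 p) ^ 2 ≤
        2 * (volume.real R.toSet * (K * (2 * e n))) +
          2 * ∫ p in R.toSet, (ψ n p - w 0 0 p) ^ 2 := by
      intro n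
      have mψ := memLp_rect (hψ n).continuous.continuousOn (R := R)
      have h1 := integral_sq_sub_le hmU hw0 mψ
      have h2 : ∫ p in R.toSet, (U p - ψ n p) ^ 2 ≤ volume.real R.toSet * (K * (2 * e n)) := by
        have : ∫ p in R.toSet, (U p - ψ n p) ^ 2 ≤ ∫ _p in R.toSet, K * (2 * e n) := by
          refine setIntegral_mono_on (hmU.sub mψ).integrable_sq
            (integrableOn_const R.isCompact_toSet.measure_lt_top.ne) R.measurableSet_toSet
            fun p hp => ?_
          have l1 : Tendsto (fun m => (ψ m p - ψ n p) ^ 2) atTop (𝓝 ((U p - ψ n p) ^ 2)) :=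
            ((hU p hp).sub_const _).pow 2
          have l2 : Tendsto (fun m => K * (2 * (e m + e n))) atTop (𝓝 (K * (2 * (0 + e n)))) :=
            ((he0.add_const _).const_mul 2).const_mul K
          rw [zero_add] at l2
          exact le_of_tendsto_of_tendsto' l1 l2 fun m => hdiff m n p hp
        rwa [setIntegral_const, smul_eq_mul] at this
      have h3 : ∫ p in R.toSet, (w 0 0 p - ψ n p) ^ 2 = ∫ p in R.toSet, (ψ n p - w 0 0 p) ^ 2 :=
        integral_congr_ae (.of_forall fun p => by ring)
      linarith
    have l : Tendsto (fun n => 2 * (volume.real R.toSet * (K * (2 * e n))) +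
          2 * ∫ p in R.toSet, (ψ n p - w 0 0 p) ^ 2) atTop
        (𝓝 (2 * (volume.real R.toSet * (K * (2 * 0))) + 2 * 0)) :=
      ((((he0.const_mul 2).const_mul K).const_mul _).const_mul 2).add
        ((h 0 (by norm_num) 0 (by norm_num)).const_mul 2)
    simp only [mul_zero, add_zero] at l
    exact ge_of_tendsto' l hle
  have hint := (hmU.sub hw0).integrable_sq
  have := (integral_eq_zero_iff_of_nonneg (fun p => sq_nonneg _) hint).1 hz
  filter_upwards [this] with p hp
  simpa [sub_eq_zero] using hp

open Filter Topology in
/-- Smooth approximations of an `H³` function on a rectangle, and continuous representatives of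
the function and its gradient. -/
theorem exists_approx {Ω : Set (ℝ × ℝ)} {m : ℕ} (hm : 3 ≤ m) {u : ℝ × ℝ → ℝ}
    (hu : MemH Ω m u) {R : Rect} (hR : R.openSet ⊆ Ω) :
    ∃ (φ : ℕ → ℝ × ℝ → ℝ) (U Ux Uy : ℝ × ℝ → ℝ), (∀ n, ContDiff ℝ ∞ (φ n)) ∧
      (∀ i j, i + j ≤ m → Tendsto (fun n => ∫ p in R.toSet,
        ((dx^[i] (dy^[j] (φ n))) p - weakD Ω i j u p) ^ 2) atTop (𝓝 0)) ∧
      (TendstoUniformlyOn φ U atTop R.toSet ∧ ContinuousOn U R.toSet ∧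
        U =ᵐ[volume.restrict R.toSet] weakD Ω 0 0 u) ∧
      (TendstoUniformlyOn (fun n => dx (φ n)) Ux atTop R.toSet ∧ ContinuousOn Ux R.toSet ∧
        Ux =ᵐ[volume.restrict R.toSet] weakD Ω 1 0 u) ∧
      (TendstoUniformlyOn (fun n => dy (φ n)) Uy atTop R.toSet ∧ ContinuousOn Uy R.toSet ∧
        Uy =ᵐ[volume.restrict R.toSet] weakD Ω 0 1 u) := by
  choose φ hφ h using fun n : ℕ => exists_contDiff_forall_integral_sq_lt hu hR
    (show (0 : ℝ) < 1 / ((n : ℝ) + 1) by positivity)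
  have hlim : ∀ i j, i + j ≤ m → Tendsto (fun n => ∫ p in R.toSet,
      ((dx^[i] (dy^[j] (φ n))) p - weakD Ω i j u p) ^ 2) atTop (𝓝 0) := fun i j hij =>
    squeeze_zero (fun n => integral_nonneg fun _ => sq_nonneg _) (fun n => (h n i j hij).le)
      tendsto_one_div_add_atTop_nhds_zero_nat
  have hmem : ∀ i j, i + j ≤ m → MemLp (weakD Ω i j u) 2 (volume.restrict R.toSet) := by
    intro i j hij
    rw [R.restrict_toSet_eq]
    exact (isWeakDeriv_weakD hu hij).1.mono_measure (Measure.restrict_mono_set _ hR)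
  obtain ⟨U, hU⟩ := exists_tendstoUniformlyOn hφ (w := fun i j => weakD Ω i j u) (R := R)
    (fun i hi j hj => hmem i j (by omega)) (fun i hi j hj => hlim i j (by omega))
  -- For the gradient, the mixed derivatives needed have order up to three; this is where `3 ≤ m`
  -- enters.
  obtain ⟨Ux, hUx⟩ := exists_tendstoUniformlyOn (fun n => contDiff_dx (hφ n))
    (w := fun i j => weakD Ω (i + 1) j u) (R := R)
    (fun i hi j hj => hmem _ j (by omega)) (fun i hi j hj => by
      have := hlim (i + 1) j (by omega)
      simp only [Function.iterate_succ_apply] at this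
      simpa only [← dx_iterate_dy_comm (hφ _)] using this)
  obtain ⟨Uy, hUy⟩ := exists_tendstoUniformlyOn (fun n => contDiff_dy (hφ n))
    (w := fun i j => weakD Ω i (j + 1) u) (R := R)
    (fun i hi j hj => hmem _ _ (by omega)) (fun i hi j hj => hlim i (j + 1) (by omega))
  exact ⟨φ, U, Ux, Uy, hφ, hlim, hU, hUx, hUy⟩


/-! ### The consistency error for Sobolev functions -/

theorem Rect.point_mem_toSet (T : Rect) (i : Fin 4) {t : ℝ}
    (ht : t ∈ Icc (T.side i).lo (T.side i).hi) : (T.side i).point t ∈ T.toSet := by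
  have h1 := T.hab.le
  have h2 := T.hcd.le
  fin_cases i <;>
    simp_all [Rect.side, Edge.lo, Edge.hi, Edge.point, Rect.toSet]

open Filter Topology in
theorem tendsto_integral_mul_of_tendsto {X : Type*} [MeasurableSpace X] {μ : Measure X}
    {f : ℕ → X → ℝ} {g w : X → ℝ} (hf : ∀ n, MemLp (f n) 2 μ) (hg : MemLp g 2 μ)
    (hw : MemLp w 2 μ) (h : Tendsto (fun n => ∫ x, (f n x - g x) ^ 2 ∂μ) atTop (𝓝 0)) :
    Tendsto (fun n => ∫ x, f n x * w x ∂μ) atTop (𝓝 (∫ x, g x * w x ∂μ)) := by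
  rw [tendsto_iff_dist_tendsto_zero]
  have hb : ∀ n, dist (∫ x, f n x * w x ∂μ) (∫ x, g x * w x ∂μ) ≤
      Real.sqrt ((∫ x, (f n x - g x) ^ 2 ∂μ) * ∫ x, w x ^ 2 ∂μ) := by
    intro n
    rw [Real.dist_eq, ← integral_sub (integrable_mul_of_memLp (hf n) hw)
      (integrable_mul_of_memLp hg hw)]
    simp only [← sub_mul]
    apply Real.abs_le_sqrt
    exact sq_integral_mul_le ((hf n).sub hg).integrable_sq hw.integrable_sq
  refine squeeze_zero (fun _ => dist_nonneg) hb ?_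
  have := (h.mul_const (∫ x, w x ^ 2 ∂μ)).sqrt
  simpa using this

open Filter Topology in
theorem tendsto_integral_sq_of_tendsto {X : Type*} [MeasurableSpace X] {μ : Measure X}
    {f : ℕ → X → ℝ} {g : X → ℝ} (hf : ∀ n, MemLp (f n) 2 μ) (hg : MemLp g 2 μ)
    (h : Tendsto (fun n => ∫ x, (f n x - g x) ^ 2 ∂μ) atTop (𝓝 0)) :
    Tendsto (fun n => ∫ x, f n x ^ 2 ∂μ) atTop (𝓝 (∫ x, g x ^ 2 ∂μ)) := by
  have h1 := tendsto_integral_mul_of_tendsto hf hg hg h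
  have h2 := (h.add (h1.const_mul 2)).sub_const (∫ x, g x ^ 2 ∂μ)
  have e : ∀ n, (∫ x, (f n x - g x) ^ 2 ∂μ) + 2 * (∫ x, f n x * g x ∂μ) - ∫ x, g x ^ 2 ∂μ =
      ∫ x, f n x ^ 2 ∂μ := by
    intro n
    have i1 := ((hf n).sub hg).integrable_sq
    have i2 := integrable_mul_of_memLp (hf n) hg
    have i3 := hg.integrable_sq
    simp only [Pi.sub_apply] at i1
    rw [← integral_const_mul, ← integral_add i1 (i2.const_mul 2), sub_eq_iff_eq_add,
      ← integral_add (hf n).integrable_sq i3]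
    refine integral_congr_ae (.of_forall fun x => ?_)
    ring
  simp only [e] at h2
  convert h2 using 2
  have : ∀ x, g x * g x = g x ^ 2 := fun x => by ring
  simp only [this]
  ring

open Filter Topology in
theorem tendsto_intervalIntegral_mul {w : ℝ → ℝ} (hw : Continuous w) {a b : ℝ} (hab : a ≤ b)
    {F : ℕ → ℝ → ℝ} {f : ℝ → ℝ} (hF : ∀ n, Continuous (F n))
    (h : TendstoUniformlyOn F f atTop (Icc a b)) :
    Tendsto (fun n => ∫ t in a..b, w t * F n t) atTop (𝓝 (∫ t in a..b, w t * f t)) := by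
  obtain ⟨B, hB⟩ := isCompact_Icc.exists_bound_of_continuousOn (s := Icc a b) hw.continuousOn
  have hB0 : 0 ≤ B := (norm_nonneg _).trans (hB a ⟨le_rfl, hab⟩)
  refine TendstoUniformlyOn.tendsto_intervalIntegral_of_continuousOn
    (.of_forall fun n => (hw.mul (hF n)).continuousOn) ?_
  rw [uIcc_of_le hab, Metric.tendstoUniformlyOn_iff]
  intro ε hε
  filter_upwards [Metric.tendstoUniformlyOn_iff.1 h (ε / (B + 1)) (by positivity)] with n hn t ht
  have h1 := hn t ht
  have h2 := hB t ht
  rw [Real.dist_eq] at h1 ⊢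
  rw [← mul_sub, abs_mul]
  rw [lt_div_iff₀ (by positivity)] at h1
  rw [Real.norm_eq_abs] at h2
  nlinarith [abs_nonneg (f t - F n t), abs_nonneg (w t)]

/-- The integral is a finite linear combination of nodal values. Pointwise convergence at the nodes
therefore suffices to pass to the limit, without derivatives of the limit function. -/
theorem exists_integral_grad_interpRect_eq (k : ℕ) (T : Rect) {g : VField}
    (h1 : Continuous g.1) (h2 : Continuous g.2) : ∃ c : ℝ → ℝ → ℝ, ∀ u : ℝ × ℝ → ℝ,
    ∫ p in T.toSet, (dx (interpRect k u T) p * g.1 p + dy (interpRect k u T) p * g.2 p) =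
      ∑ ζ ∈ lobattoNodes k, ∑ η ∈ lobattoNodes k,
        u (fromRef T.a T.b ζ, fromRef T.c T.d η) * c ζ η := by
  set B : ℝ → ℝ → ℝ × ℝ → ℝ := fun ζ η p => (lobattoBasis k ζ).eval (toRef T.a T.b p.1) *
    (lobattoBasis k η).eval (toRef T.c T.d p.2) with hB
  have hBs : ∀ ζ η, ContDiff ℝ ∞ (B ζ η) := by
    intro ζ η
    have e1 : ContDiff ℝ ∞ fun p : ℝ × ℝ => toRef T.a T.b p.1 := by
      unfold toRef
      exact ((contDiff_const.mul contDiff_fst).sub contDiff_const |>.sub contDiff_const).div_const _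
    have e2 : ContDiff ℝ ∞ fun p : ℝ × ℝ => toRef T.c T.d p.2 := by
      unfold toRef
      exact ((contDiff_const.mul contDiff_snd).sub contDiff_const |>.sub contDiff_const).div_const _
    have e3 : ∀ q : ℝ[X], ContDiff ℝ ∞ fun t : ℝ => q.eval t := fun q => by
      simpa using q.contDiff_aeval (𝕜 := ℝ) ∞ (R := ℝ)
    exact ((e3 _).comp e1).mul ((e3 _).comp e2)
  have hd : ∀ (u : ℝ × ℝ → ℝ) (p e : ℝ × ℝ), fderiv ℝ (interpRect k u T) p e =
      ∑ ζ ∈ lobattoNodes k, ∑ η ∈ lobattoNodes k,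
        u (fromRef T.a T.b ζ, fromRef T.c T.d η) * fderiv ℝ (B ζ η) p e := by
    intro u p e
    have hI : interpRect k u T = fun p => ∑ ζ ∈ lobattoNodes k, ∑ η ∈ lobattoNodes k,
        u (fromRef T.a T.b ζ, fromRef T.c T.d η) * B ζ η p := by
      funext p
      simp only [interpRect, hB, mul_assoc]
    have hD : ∀ ζ η, DifferentiableAt ℝ (B ζ η) p := fun ζ η =>
      (hBs ζ η).differentiable (by simp) p
    rw [hI, fderiv_fun_sum fun ζ _ => DifferentiableAt.fun_sum fun η _ => (hD ζ η).const_mul _]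
    rw [sum_apply]
    refine Finset.sum_congr rfl fun ζ _ => ?_
    rw [fderiv_fun_sum fun η _ => (hD ζ η).const_mul _, sum_apply]
    refine Finset.sum_congr rfl fun η _ => ?_
    rw [fderiv_const_mul (hD ζ η), smul_apply, smul_eq_mul]
  refine ⟨fun ζ η => ∫ p in T.toSet, (dx (B ζ η) p * g.1 p + dy (B ζ η) p * g.2 p), fun u => ?_⟩
  have hint : ∀ ζ η, IntegrableOn (fun p => u (fromRef T.a T.b ζ, fromRef T.c T.d η) *
      (dx (B ζ η) p * g.1 p + dy (B ζ η) p * g.2 p)) T.toSet := fun ζ η =>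
    integrableOn_rect (continuous_const.mul (((contDiff_dx (hBs ζ η)).continuous.mul h1).add
      ((contDiff_dy (hBs ζ η)).continuous.mul h2))).continuousOn
  simp only [← integral_const_mul]
  rw [← setIntegral_congr_fun T.measurableSet_toSet (f := fun p => ∑ ζ ∈ lobattoNodes k,
    ∑ η ∈ lobattoNodes k, u (fromRef T.a T.b ζ, fromRef T.c T.d η) *
      (dx (B ζ η) p * g.1 p + dy (B ζ η) p * g.2 p))]
  · rw [integral_finsetSum _ fun ζ _ => integrable_finsetSum _ fun η _ => hint ζ η]
    exact Finset.sum_congr rfl fun ζ _ => integral_finsetSum _ fun η _ => hint ζ η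
  · intro p _
    simp only [dx, dy, hd, Finset.sum_mul, ← Finset.sum_add_distrib]
    refine Finset.sum_congr rfl fun ζ _ => Finset.sum_congr rfl fun η _ => ?_
    ring

theorem eqOn_rect_of_ae_eq {R : Rect} {f g : ℝ × ℝ → ℝ} (hf : ContinuousOn f R.toSet)
    (hg : ContinuousOn g R.toSet) (h : f =ᵐ[volume.restrict R.toSet] g) : EqOn f g R.toSet := by
  refine Measure.eqOn_of_ae_eq h hf hg ?_
  rw [← R.closure_openSet]
  exact closure_mono (R.isOpen_openSet.subset_interior_iff.2 subset_closure)

/-- All Lobatto nodes and all edges lie in the closed element, so values elsewhere do not matter. -/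
theorem elementError_congr {k : ℕ} (hk : 1 ≤ k) {T : Rect} (v : WeakFunction)
    {u u' gx gx' gy gy' : ℝ × ℝ → ℝ} (lap : ℝ × ℝ → ℝ) (h : EqOn u u' T.toSet)
    (hx : EqOn gx gx' T.toSet) (hy : EqOn gy gy' T.toSet) :
    elementError k T v u gx gy lap = elementError k T v u' gx' gy' lap := by
  have h1 : interpRect k u T = interpRect k u' T := by
    funext p
    unfold interpRect
    refine Finset.sum_congr rfl fun ζ hζ => Finset.sum_congr rfl fun η hη => ?_
    rw [h ⟨fromRef_mem_Icc T.hab (lobattoNodes_subset_Icc hk hζ),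
      fromRef_mem_Icc T.hcd (lobattoNodes_subset_Icc hk hη)⟩]
  have h2 : flux T (fun i => v.2 (T.side i)) gx gy = flux T (fun i => v.2 (T.side i)) gx' gy' := by
    unfold flux
    refine Finset.sum_congr rfl fun i _ => intervalIntegral.integral_congr fun t ht => ?_
    rw [uIcc_of_le (T.lo_le_hi i)] at ht
    have := T.point_mem_toSet i ht
    simp only [hx this, hy this]
  unfold elementError
  rw [h1, h2]

open Filter Topology in
-- The limit of the smooth estimate along approximations in `H^{k+2}(T)`: nodal values and edge
-- fluxes converge because `φ` and its gradient converge uniformly, the remaining integrals because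
-- all derivatives up to order `k + 2` converge in `L²`. The constant is that of the smooth case.
theorem exists_sq_elementError_weakD_le {k : ℕ} (hk : 1 ≤ k) (σ : ℝ) : ∃ C : ℝ, 0 < C ∧
    ∀ (Ω : Set (ℝ × ℝ)) (u : ℝ × ℝ → ℝ), MemH Ω (k + 2) u → ∀ T : Rect, T.openSet ⊆ Ω →
    T.diam ≤ σ * min (T.b - T.a) (T.d - T.c) → ∀ v : WeakFunction, v.1 T ∈ Q k k →
      (∀ i, Continuous (v.2 (T.side i))) → ∀ U Ux Uy : ℝ × ℝ → ℝ,
      ContinuousOn U T.toSet → ContinuousOn Ux T.toSet → ContinuousOn Uy T.toSet →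
      U =ᵐ[volume.restrict T.toSet] weakD Ω 0 0 u →
      Ux =ᵐ[volume.restrict T.toSet] weakD Ω 1 0 u →
      Uy =ᵐ[volume.restrict T.toSet] weakD Ω 0 1 u →
      elementError k T v U Ux Uy (fun p => weakD Ω 2 0 u p + weakD Ω 0 2 u p) ^ 2 ≤
        C * sobolevSq T (k + 2) (fun i j => weakD Ω i j u) *
          (T.diam ^ (2 * k + 2) * gradSq k T v +
            (T.diam ^ (2 * k - 1) + T.diam ^ (2 * k + 1)) * jumpSq T v) := by
  obtain ⟨C, hC, H⟩ := exists_sq_elementError_le hk σ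
  refine ⟨C, hC, fun Ω u hu T hT hσ v hv hvb U Ux Uy cU cUx cUy eU eUx eUy => ?_⟩
  obtain ⟨φ, V, Vx, Vy, hφ, hlim, ⟨tV, cV, eV⟩, ⟨tVx, cVx, eVx⟩, tVy, cVy, eVy⟩ :=
    exists_approx (by omega) hu hT
  -- The given representatives agree everywhere on the closed element with the limits of the
  -- approximations, since both are continuous.
  rw [elementError_congr hk v _ (eqOn_rect_of_ae_eq cU cV (eU.trans eV.symm))
    (eqOn_rect_of_ae_eq cUx cVx (eUx.trans eVx.symm))
    (eqOn_rect_of_ae_eq cUy cVy (eUy.trans eVy.symm))]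
  have hsm : ∀ n i j, ContDiff ℝ ∞ (dx^[i] (dy^[j] (φ n))) := fun n i j =>
    contDiff_iterate_dx (contDiff_iterate_dy (hφ n) j) i
  have mφ : ∀ n i j, MemLp (dx^[i] (dy^[j] (φ n))) 2 (volume.restrict T.toSet) := fun n i j =>
    memLp_rect (hsm n i j).continuous.continuousOn
  have mw : ∀ i j, i + j ≤ k + 2 → MemLp (weakD Ω i j u) 2 (volume.restrict T.toSet) := by
    intro i j hij
    rw [T.restrict_toSet_eq]
    exact (isWeakDeriv_weakD hu hij).1.mono_measure (Measure.restrict_mono_set _ hT)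
  have cv : Continuous (v.1 T) := (contDiff_of_mem_Q hv).continuous
  have hg := (isDiscreteWeakGrad_discreteWeakGrad (k := k) cv hvb).1
  have mv : MemLp (v.1 T) 2 (volume.restrict T.toSet) := memLp_rect cv.continuousOn
  have tS : Tendsto (fun n => sobolevSq T (k + 2) (fun i j => dx^[i] (dy^[j] (φ n)))) atTop
      (𝓝 (sobolevSq T (k + 2) (fun i j => weakD Ω i j u))) := by
    unfold sobolevSq
    refine tendsto_finsetSum _ fun i hi => tendsto_finsetSum _ fun j hj => ?_
    rw [Finset.mem_range] at hi hj
    exact tendsto_integral_sq_of_tendsto (fun n => mφ n i j) (mw i j (by omega))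
      (hlim i j (by omega))
  have t1 : Tendsto (fun n => ∫ p in T.toSet,
      (dx (interpRect k (φ n) T) p * (discreteWeakGrad k T v).1 p +
        dy (interpRect k (φ n) T) p * (discreteWeakGrad k T v).2 p)) atTop
      (𝓝 (∫ p in T.toSet, (dx (interpRect k V T) p * (discreteWeakGrad k T v).1 p +
        dy (interpRect k V T) p * (discreteWeakGrad k T v).2 p))) := by
    obtain ⟨c, hc⟩ := exists_integral_grad_interpRect_eq k T (contDiff_of_mem_Q hg.1).continuous
      (contDiff_of_mem_Q hg.2).continuous
    simp only [hc]
    refine tendsto_finsetSum _ fun ζ hζ => tendsto_finsetSum _ fun η hη => Tendsto.mul_const _ ?_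
    exact tV.tendsto_at ⟨fromRef_mem_Icc T.hab (lobattoNodes_subset_Icc hk hζ),
      fromRef_mem_Icc T.hcd (lobattoNodes_subset_Icc hk hη)⟩
  have t2 : Tendsto (fun n => ∫ p in T.toSet, (dx (dx (φ n)) p + dy (dy (φ n)) p) * v.1 T p) atTop
      (𝓝 (∫ p in T.toSet, (weakD Ω 2 0 u p + weakD Ω 0 2 u p) * v.1 T p)) := by
    have a1 := tendsto_integral_mul_of_tendsto (fun n => mφ n 2 0) (mw 2 0 (by omega)) mv
      (hlim 2 0 (by omega))
    have a2 := tendsto_integral_mul_of_tendsto (fun n => mφ n 0 2) (mw 0 2 (by omega)) mv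
      (hlim 0 2 (by omega))
    have a3 := a1.add a2
    simp only [add_mul]
    rw [integral_add (integrable_mul_of_memLp (mw 2 0 (by omega)) mv)
      (integrable_mul_of_memLp (mw 0 2 (by omega)) mv)]
    refine a3.congr fun n => ?_
    exact (integral_add (integrable_mul_of_memLp (mφ n 2 0) mv)
      (integrable_mul_of_memLp (mφ n 0 2) mv)).symm
  have t3 : Tendsto (fun n => flux T (fun i => v.2 (T.side i)) (dx (φ n)) (dy (φ n))) atTop
      (𝓝 (flux T (fun i => v.2 (T.side i)) Vx Vy)) := by
    unfold flux
    simp only [sum_side_normal]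
    have side : ∀ (i : Fin 4) (F : ℕ → ℝ × ℝ → ℝ) (f : ℝ × ℝ → ℝ), (∀ n, Continuous (F n)) →
        TendstoUniformlyOn F f atTop T.toSet →
        Tendsto (fun n => ∫ t in (T.side i).lo..(T.side i).hi,
          v.2 (T.side i) t * F n ((T.side i).point t)) atTop
          (𝓝 (∫ t in (T.side i).lo..(T.side i).hi, v.2 (T.side i) t * f ((T.side i).point t))) := by
      intro i F f hF hf
      refine tendsto_intervalIntegral_mul (hvb i) (T.lo_le_hi i)
        (fun n => (hF n).comp (T.side i).continuous_point)
        ((hf.comp (T.side i).point).mono fun t ht => T.point_mem_toSet i ht)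
    have s0 := side 0 _ _ (fun n => (contDiff_dy (hφ n)).continuous) tVy
    have s1 := side 1 _ _ (fun n => (contDiff_dy (hφ n)).continuous) tVy
    have s2 := side 2 _ _ (fun n => (contDiff_dx (hφ n)).continuous) tVx
    have s3 := side 3 _ _ (fun n => (contDiff_dx (hφ n)).continuous) tVx
    exact ((s0.neg.add s1).sub s2).add s3
  refine le_of_tendsto_of_tendsto' (((t1.add t2).sub t3).pow 2)
    ((tS.const_mul C).mul_const _) fun n => H T hσ v hv hvb (φ n) (hφ n)

/-! ### Vanishing boundary values -/

open Filter Topology in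
theorem tendsto_intervalIntegral_sq {a b : ℝ} (hab : a ≤ b)
    {F : ℕ → ℝ → ℝ} {f : ℝ → ℝ} (hF : ∀ n, Continuous (F n))
    (h : TendstoUniformlyOn F f atTop (Icc a b)) :
    Tendsto (fun n => ∫ t in a..b, F n t ^ 2) atTop (𝓝 (∫ t in a..b, f t ^ 2)) := by
  have hf : ContinuousOn f (Icc a b) :=
    h.continuousOn (Frequently.of_forall fun n => (hF n).continuousOn)
  obtain ⟨B, hB⟩ := isCompact_Icc.exists_bound_of_continuousOn hf
  have hB0 : 0 ≤ B := (norm_nonneg _).trans (hB a ⟨le_rfl, hab⟩)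
  refine TendstoUniformlyOn.tendsto_intervalIntegral_of_continuousOn
    (.of_forall fun n => ((hF n).pow 2).continuousOn) ?_
  rw [uIcc_of_le hab, Metric.tendstoUniformlyOn_iff]
  intro ε hε
  have hδ : 0 < min 1 (ε / (2 * B + 2)) := lt_min one_pos (by positivity)
  filter_upwards [Metric.tendstoUniformlyOn_iff.1 h _ hδ] with n hn t ht
  have h1 := hn t ht
  have h2 := hB t ht
  rw [Real.dist_eq, lt_min_iff, lt_div_iff₀ (by positivity)] at h1
  rw [Real.dist_eq, sq_sub_sq, abs_mul]
  rw [Real.norm_eq_abs] at h2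
  have h3 : |f t + F n t| ≤ 2 * B + 1 := by
    have : f t + F n t = 2 * f t - (f t - F n t) := by ring
    rw [this]
    refine (abs_sub _ _).trans ?_
    rw [abs_mul, abs_two]
    linarith [h1.1]
  nlinarith [abs_nonneg (f t - F n t), abs_nonneg (f t + F n t), h1.2]

open Filter Topology in
-- Compare a smooth approximation `φ n` of `u` on `R` with a test function `χ` close to `u` in
-- `H¹(Ω)`. Since `χ` vanishes on a side outside `Ω`, the trace inequality for `φ n - χ` bounds `φ
-- n` on that side by the two approximation errors, and both can be sent to zero.
theorem eq_zero_of_memH10 {Ω : Set (ℝ × ℝ)} (hΩ : IsOpen Ω) {m : ℕ} (hm : 3 ≤ m) {u : ℝ × ℝ → ℝ}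
    (hu : MemH Ω m u) (hu0 : MemH10 Ω u) {R : Rect} (hR : R.openSet ⊆ Ω) {i : Fin 4}
    (hi : Disjoint (R.side i).openSet Ω) {U : ℝ × ℝ → ℝ} (cU : ContinuousOn U R.toSet)
    (eU : U =ᵐ[volume.restrict R.toSet] weakD Ω 0 0 u) :
    ∀ t ∈ Icc (R.side i).lo (R.side i).hi, U ((R.side i).point t) = 0 := by
  obtain ⟨φ, V, -, -, hφ, hlim, ⟨tV, cV, eV⟩, -, -⟩ := exists_approx hm hu hR
  obtain ⟨K, hK0, hK⟩ := exists_trace_le R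
  have hlt : (R.side i).lo < (R.side i).hi := by
    fin_cases i <;> simp [Rect.side, Edge.lo, Edge.hi, R.hab, R.hcd]
  have cP := (R.side i).continuous_point
  have mw : ∀ i j, i + j ≤ m → MemLp (weakD Ω i j u) 2 (volume.restrict Ω) := fun i j hij =>
    (isWeakDeriv_weakD hu hij).1
  have mwR : ∀ i j, i + j ≤ m → MemLp (weakD Ω i j u) 2 (volume.restrict R.toSet) := by
    intro i j hij
    rw [R.restrict_toSet_eq]
    exact (mw i j hij).mono_measure (Measure.restrict_mono_set _ hR)
  set e : ℕ → ℝ := fun n => (∫ p in R.toSet, (φ n p - weakD Ω 0 0 u p) ^ 2) +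
    (∫ p in R.toSet, (dx (φ n) p - weakD Ω 1 0 u p) ^ 2) +
    ∫ p in R.toSet, (dy (φ n) p - weakD Ω 0 1 u p) ^ 2 with he
  have he0 : Tendsto e atTop (𝓝 0) := by
    have := ((hlim 0 0 (by omega)).add (hlim 1 0 (by omega))).add (hlim 0 1 (by omega))
    simpa using this
  have key : ∀ n, ∀ ε > 0, ∫ t in (R.side i).lo..(R.side i).hi, φ n ((R.side i).point t) ^ 2 ≤
      K * (2 * (e n + ε ^ 2)) := by
    intro n ε hε
    obtain ⟨χ, hχ, hχε⟩ := hu0.2 ε hε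
    have hχ0 : ∀ t ∈ Icc (R.side i).lo (R.side i).hi, χ ((R.side i).point t) = 0 := by
      have h1 : EqOn (fun t => χ ((R.side i).point t)) (fun _ => 0)
          (Ioo (R.side i).lo (R.side i).hi) := fun t ht =>
        hχ.eq_zero (hi.notMem_of_mem_left ⟨t, ht, rfl⟩)
      have h2 := h1.closure (hχ.1.continuous.comp cP) continuous_const
      rw [closure_Ioo hlt.ne] at h2
      exact h2
    have h1 := hK (φ n - χ) ((hφ n).sub hχ.1) i
    rw [dx_sub (hφ n) hχ.1, dy_sub (hφ n) hχ.1] at h1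
    have h2 : ∫ t in (R.side i).lo..(R.side i).hi, (φ n - χ) ((R.side i).point t) ^ 2 =
        ∫ t in (R.side i).lo..(R.side i).hi, φ n ((R.side i).point t) ^ 2 := by
      refine intervalIntegral.integral_congr fun t ht => ?_
      rw [uIcc_of_le hlt.le] at ht
      simp only [Pi.sub_apply, hχ0 t ht, sub_zero]
    rw [h2] at h1
    refine h1.trans (mul_le_mul_of_nonneg_left ?_ hK0)
    -- The derivative of `φ n - χ` is measured through that of `u`: the first error lives on `R`,
    -- the second is dominated by its value on all of `Ω`.
    have part : ∀ (i j : ℕ) (D E : ℝ × ℝ → ℝ), i + j ≤ m → Continuous D → Continuous E →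
        IsWeakDeriv Ω i j χ E →
        ∫ p in R.toSet, (D - E) p ^ 2 ≤ 2 * (∫ p in R.toSet, (D p - weakD Ω i j u p) ^ 2) +
          2 * ∫ p in Ω, weakD Ω i j (u - χ) p ^ 2 := by
      intro i j D E hij cD cE hE
      refine (integral_sq_sub_le (memLp_rect cD.continuousOn) (memLp_rect cE.continuousOn)
        (mwR i j hij)).trans ?_
      have hs := weakD_ae_eq hΩ ((isWeakDeriv_weakD hu hij).sub hu.1 hχ.memLp hE)
      have e1 : ∫ p in Ω, weakD Ω i j (u - χ) p ^ 2 = ∫ p in Ω, (E p - weakD Ω i j u p) ^ 2 := by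
        refine integral_congr_ae ?_
        filter_upwards [hs] with p hp
        rw [hp]
        simp only [Pi.sub_apply]
        ring
      have e2 : ∫ p in R.toSet, (E p - weakD Ω i j u p) ^ 2 ≤
          ∫ p in Ω, (E p - weakD Ω i j u p) ^ 2 := by
        rw [R.restrict_toSet_eq]
        exact setIntegral_mono_set (hE.1.sub (mw i j hij)).integrable_sq
          (.of_forall fun _ => sq_nonneg _) hR.eventuallyLE
      rw [e1]
      linarith
    have p0 := part 0 0 (φ n) χ (by omega) (hφ n).continuous hχ.1.continuous
      (isWeakDeriv_zero_zero hχ.memLp)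
    have p1 := part 1 0 (dx (φ n)) (dx χ) (by omega) (contDiff_dx (hφ n)).continuous
      (contDiff_dx hχ.1).continuous hχ.isWeakDeriv_dx
    have p2 := part 0 1 (dy (φ n)) (dy χ) (by omega) (contDiff_dy (hφ n)).continuous
      (contDiff_dy hχ.1).continuous hχ.isWeakDeriv_dy
    have hs : sobolevNorm Ω 1 (u - χ) ^ 2 ≤ ε ^ 2 :=
      pow_le_pow_left₀ (Real.sqrt_nonneg _) hχε.le 2
    rw [sobolevNorm_one_sq] at hs
    simp only [he]
    linarith
  have key2 : ∀ n, ∫ t in (R.side i).lo..(R.side i).hi, φ n ((R.side i).point t) ^ 2 ≤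
      K * (2 * e n) := by
    intro n
    have l : Tendsto (fun ε : ℝ => K * (2 * (e n + ε ^ 2))) (𝓝[>] 0) (𝓝 (K * (2 * e n))) := by
      have : Continuous fun ε : ℝ => K * (2 * (e n + ε ^ 2)) := by fun_prop
      have := this.tendsto 0
      simp only [ne_eq, OfNat.ofNat_ne_zero, not_false_eq_true, zero_pow, add_zero] at this
      exact this.mono_left nhdsWithin_le_nhds
    exact ge_of_tendsto l (eventually_mem_nhdsWithin.mono fun ε hε => key n ε hε)
  have hz : ∫ t in (R.side i).lo..(R.side i).hi, V ((R.side i).point t) ^ 2 ≤ 0 := by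
    have l1 := tendsto_intervalIntegral_sq hlt.le (F := fun n t => φ n ((R.side i).point t))
      (fun n => (hφ n).continuous.comp cP)
      ((tV.comp (R.side i).point).mono fun t ht => R.point_mem_toSet i ht)
    have l2 := (he0.const_mul 2).const_mul K
    simp only [mul_zero] at l2
    exact le_of_tendsto_of_tendsto' l1 l2 key2
  have cVP : ContinuousOn (fun t => V ((R.side i).point t)) (Icc (R.side i).lo (R.side i).hi) :=
    cV.comp cP.continuousOn fun t ht => R.point_mem_toSet i ht
  have hz' : ∫ t in Icc (R.side i).lo (R.side i).hi, V ((R.side i).point t) ^ 2 = 0 := by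
    rw [integral_Icc_eq_integral_Ioc, ← intervalIntegral.integral_of_le hlt.le]
    exact le_antisymm hz (integral_sq_nonneg hlt.le)
  have hae := (integral_eq_zero_iff_of_nonneg (fun t => sq_nonneg _)
    ((cVP.pow 2).integrableOn_compact isCompact_Icc)).1 hz'
  have heq : EqOn (fun t => V ((R.side i).point t)) (fun _ => 0) (Icc (R.side i).lo (R.side i).hi) := by
    refine Measure.eqOn_Icc_of_ae_eq (μ := volume) hlt.ne ?_ cVP continuousOn_const
    filter_upwards [hae] with t ht
    simpa using ht
  intro t ht
  rw [eqOn_rect_of_ae_eq cU cV (eU.trans eV.symm) (R.point_mem_toSet i ht)]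
  exact heq ht

section

/-! ### Gluing continuous representatives -/

/-- `U` is a continuous representative of `w` on the closed rectangle `R`. -/
def IsRep (w : ℝ × ℝ → ℝ) (R : Rect) (U : ℝ × ℝ → ℝ) : Prop :=
  ContinuousOn U R.toSet ∧ U =ᵐ[volume.restrict R.toSet] w

/-- `w` has a continuous representative on every rectangle whose interior lies in `Ω`. -/
def HasReps (Ω : Set (ℝ × ℝ)) (w : ℝ × ℝ → ℝ) : Prop :=
  ∀ R : Rect, R.openSet ⊆ Ω → ∃ U, IsRep w R U

variable {Ω : Set (ℝ × ℝ)} {w : ℝ × ℝ → ℝ}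

/-- Both functions agree almost everywhere on the open intersection, hence everywhere there by
continuity, hence on its closure. -/
theorem IsRep.eq_of_mem_closure {R₁ R₂ : Rect} {U₁ U₂ : ℝ × ℝ → ℝ} (h₁ : IsRep w R₁ U₁)
    (h₂ : IsRep w R₂ U₂) {p : ℝ × ℝ} (hp : p ∈ closure (R₁.openSet ∩ R₂.openSet)) :
    U₁ p = U₂ p := by
  have s1 : closure (R₁.openSet ∩ R₂.openSet) ⊆ R₁.toSet := by
    rw [← R₁.closure_openSet]; exact closure_mono inter_subset_left
  have s2 : closure (R₁.openSet ∩ R₂.openSet) ⊆ R₂.toSet := by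
    rw [← R₂.closure_openSet]; exact closure_mono inter_subset_right
  have hO : IsOpen (R₁.openSet ∩ R₂.openSet) := R₁.isOpen_openSet.inter R₂.isOpen_openSet
  have a1 := ae_restrict_of_ae_restrict_of_subset (subset_closure.trans s1) h₁.2
  have a2 := ae_restrict_of_ae_restrict_of_subset (subset_closure.trans s2) h₂.2
  have hae : U₁ =ᵐ[volume.restrict (R₁.openSet ∩ R₂.openSet)] U₂ := by
    filter_upwards [a1, a2] with q h1 h2
    rw [h1, h2]
  have h := Measure.eqOn_open_of_ae_eq hae hO (h₁.1.mono (subset_closure.trans s1))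
    (h₂.1.mono (subset_closure.trans s2))
  exact h.of_subset_closure (h₁.1.mono s1) (h₂.1.mono s2) subset_closure subset_rfl hp

theorem exists_rect_subset (hΩ : IsOpen Ω) {p : ℝ × ℝ} (hp : p ∈ Ω) :
    ∃ S : Rect, p ∈ S.openSet ∧ S.openSet ⊆ Ω := by
  obtain ⟨ε, hε, hb⟩ := Metric.isOpen_iff.1 hΩ p hp
  refine ⟨⟨p.1 - ε, p.1 + ε, p.2 - ε, p.2 + ε, by linarith, by linarith⟩, ?_, ?_⟩
  · simp [Rect.openSet, hε]
  · refine fun q hq => hb ?_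
    rw [Metric.mem_ball, Prod.dist_eq, max_lt_iff, Real.dist_eq, Real.dist_eq, abs_lt, abs_lt]
    simp only [Rect.openSet, mem_prod, mem_Ioo] at hq
    refine ⟨⟨?_, ?_⟩, ?_, ?_⟩ <;> linarith [hq.1.1, hq.1.2, hq.2.1, hq.2.2]

/-- Two rectangles may meet at `p` without overlapping. A small rectangle around `p` inside `Ω`
overlaps both, with `p` in the closure of each overlap, and its representative mediates. -/
theorem IsRep.eq_of_mem (hΩ : IsOpen Ω) (hw : HasReps Ω w) {R₁ R₂ : Rect} {U₁ U₂ : ℝ × ℝ → ℝ}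
    (h₁ : IsRep w R₁ U₁) (h₂ : IsRep w R₂ U₂) {p : ℝ × ℝ} (hp : p ∈ Ω) (hp₁ : p ∈ R₁.toSet)
    (hp₂ : p ∈ R₂.toSet) : U₁ p = U₂ p := by
  obtain ⟨S, hpS, hS⟩ := exists_rect_subset hΩ hp
  obtain ⟨V, hV⟩ := hw S hS
  have aux : ∀ R : Rect, p ∈ R.toSet → p ∈ closure (R.openSet ∩ S.openSet) := by
    intro R hR
    rw [← R.closure_openSet] at hR
    rw [inter_comm]
    exact S.isOpen_openSet.inter_closure ⟨hpS, hR⟩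
  rw [h₁.eq_of_mem_closure hV (aux _ hp₁), h₂.eq_of_mem_closure hV (aux _ hp₂)]

theorem Rect.lo_lt_hi (R : Rect) (i : Fin 4) : (R.side i).lo < (R.side i).hi := by
  fin_cases i <;> simp [Rect.side, Edge.lo, Edge.hi, R.hab, R.hcd]

/-- Representatives on two rectangles agree on a common side inside `Ω`. -/
theorem IsRep.eq_on_side (hΩ : IsOpen Ω) (hw : HasReps Ω w) {R₁ R₂ : Rect} {U₁ U₂ : ℝ × ℝ → ℝ}
    (h₁ : IsRep w R₁ U₁) (h₂ : IsRep w R₂ U₂) {i j : Fin 4} (hij : R₁.side i = R₂.side j)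
    (he : (R₁.side i).openSet ⊆ Ω) {t : ℝ} (ht : t ∈ Icc (R₁.side i).lo (R₁.side i).hi) :
    U₁ ((R₁.side i).point t) = U₂ ((R₁.side i).point t) := by
  have cP := (R₁.side i).continuous_point
  have m1 : MapsTo (R₁.side i).point (Icc (R₁.side i).lo (R₁.side i).hi) R₁.toSet :=
    fun t ht => R₁.point_mem_toSet i ht
  have m2 : MapsTo (R₁.side i).point (Icc (R₁.side i).lo (R₁.side i).hi) R₂.toSet := by
    rw [hij]; exact fun t ht => R₂.point_mem_toSet j ht
  have h : EqOn (fun t => U₁ ((R₁.side i).point t)) (fun t => U₂ ((R₁.side i).point t))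
      (Ioo (R₁.side i).lo (R₁.side i).hi) := fun t ht =>
    h₁.eq_of_mem hΩ hw h₂ (he ⟨t, ht, rfl⟩) (m1 (Ioo_subset_Icc_self ht))
      (m2 (Ioo_subset_Icc_self ht))
  exact h.of_subset_closure (h₁.1.comp cP.continuousOn m1) (h₂.1.comp cP.continuousOn m2)
    Ioo_subset_Icc_self (by rw [closure_Ioo (R₁.lo_lt_hi i).ne]) ht

/-- The four squares of side length `δ` with corner `p`, in counterclockwise order. -/
def quad (p : ℝ × ℝ) {δ : ℝ} (hδ : 0 < δ) : Fin 4 → Rect :=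
  ![⟨p.1, p.1 + δ, p.2, p.2 + δ, by linarith, by linarith⟩,
    ⟨p.1 - δ, p.1, p.2, p.2 + δ, by linarith, by linarith⟩,
    ⟨p.1 - δ, p.1, p.2 - δ, p.2, by linarith, by linarith⟩,
    ⟨p.1, p.1 + δ, p.2 - δ, p.2, by linarith, by linarith⟩]

open Filter Topology in
theorem eventually_forall_notMem (F : Finset ℝ) (x : ℝ) :
    ∀ᶠ δ in 𝓝[>] (0 : ℝ), ∀ z ∈ F, z ∉ Ioo x (x + δ) ∧ z ∉ Ioo (x - δ) x := by
  rw [Finset.eventually_all]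
  intro z _
  rcases eq_or_ne z x with rfl | hz
  · exact .of_forall fun δ => by simp
  · have : 0 < |z - x| := abs_pos.2 (sub_ne_zero.2 hz)
    filter_upwards [Ioo_mem_nhdsGT this] with δ hδ
    constructor
    · rintro ⟨h1, h2⟩
      have := hδ.2
      rw [abs_of_pos (by linarith)] at this
      linarith
    · rintro ⟨h1, h2⟩
      have := hδ.2
      rw [abs_of_neg (by linarith)] at this
      linarith

/-- If no defining rectangle cuts through the coordinate sets of a cell, a rectangle that contains
one point of the cell contains all of it. -/
theorem subset_or_disjoint_of_cell {F : Finset Rect} {I J : Set ℝ}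
    (hI : ∀ R ∈ F, ∀ s ∈ I, s ∈ Ioo R.a R.b → I ⊆ Ioo R.a R.b)
    (hJ : ∀ R ∈ F, ∀ s ∈ J, s ∈ Ioo R.c R.d → J ⊆ Ioo R.c R.d) :
    I ×ˢ J ⊆ (⋃ R ∈ F, R.openSet) ∨ Disjoint (I ×ˢ J) (⋃ R ∈ F, R.openSet) := by
  by_cases h : Disjoint (I ×ˢ J) (⋃ R ∈ F, R.openSet)
  · exact Or.inr h
  · left
    rw [not_disjoint_iff] at h
    obtain ⟨q, hq, hq'⟩ := h
    simp only [mem_iUnion, exists_prop] at hq'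
    obtain ⟨R, hR, hqR⟩ := hq'
    intro r hr
    simp only [mem_iUnion, exists_prop]
    exact ⟨R, hR, hI R hR q.1 hq.1 hqR.1 hr.1, hJ R hR q.2 hq.2 hqR.2 hr.2⟩

theorem Ioo_cell {a b x δ : ℝ} (ha : a ∉ Ioo x (x + δ) ∧ a ∉ Ioo (x - δ) x)
    (hb : b ∉ Ioo x (x + δ) ∧ b ∉ Ioo (x - δ) x) {I : Set ℝ}
    (hI : I = Ioo x (x + δ) ∨ I = Ioo (x - δ) x ∨ I = {x}) {s : ℝ} (hs : s ∈ I)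
    (h : s ∈ Ioo a b) : I ⊆ Ioo a b := by
  simp only [mem_Ioo, not_and, not_lt] at ha hb
  rcases hI with rfl | rfl | rfl
  · intro t ht
    have hax : a ≤ x := not_lt.1 fun hc => by linarith [ha.1 hc, h.1, hs.2]
    have hxb : x + δ ≤ b := hb.1 (hs.1.trans h.2)
    exact ⟨hax.trans_lt ht.1, ht.2.trans_le hxb⟩
  · intro t ht
    have hxb : x ≤ b := not_lt.1 fun hc => by
      have := hb.2 (by linarith [hs.1, h.2])
      linarith
    have hax : a ≤ x - δ := not_lt.1 fun hc => by
      have := ha.2 hc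
      linarith [hs.2, h.1]
    exact ⟨hax.trans_lt ht.1, ht.2.trans_le hxb⟩
  · intro t ht
    rw [mem_singleton_iff] at ht hs
    rwa [ht, ← hs]

open Filter Topology in
/-- Near each of its points the plane splits into cells that lie in `Ω` or outside `Ω`. -/
theorem exists_cells (F : Finset Rect) (p : ℝ × ℝ) : ∃ δ : ℝ, 0 < δ ∧ ∀ I J : Set ℝ,
    (I = Ioo p.1 (p.1 + δ) ∨ I = Ioo (p.1 - δ) p.1 ∨ I = {p.1}) →
    (J = Ioo p.2 (p.2 + δ) ∨ J = Ioo (p.2 - δ) p.2 ∨ J = {p.2}) →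
    I ×ˢ J ⊆ (⋃ R ∈ F, R.openSet) ∨ Disjoint (I ×ˢ J) (⋃ R ∈ F, R.openSet) := by
  classical
  -- There are finitely many side coordinates, so for small `δ` none lies strictly between `p ± δ`
  -- and `p` in either variable.
  obtain ⟨δ, ⟨⟨⟨⟨h1, h2⟩, h3⟩, h4⟩, hδ⟩⟩ := ((((eventually_forall_notMem (F.image Rect.a) p.1).and
    (eventually_forall_notMem (F.image Rect.b) p.1)).and
    (eventually_forall_notMem (F.image Rect.c) p.2)).and
    (eventually_forall_notMem (F.image Rect.d) p.2)).and
    (eventually_mem_nhdsWithin (a := (0 : ℝ)) (s := Ioi 0)) |>.exists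
  refine ⟨δ, hδ, fun I J hI hJ => subset_or_disjoint_of_cell ?_ ?_⟩
  · exact fun R hR s hs h => Ioo_cell (h1 _ (Finset.mem_image_of_mem _ hR))
      (h2 _ (Finset.mem_image_of_mem _ hR)) hI hs h
  · exact fun R hR s hs h => Ioo_cell (h3 _ (Finset.mem_image_of_mem _ hR))
      (h4 _ (Finset.mem_image_of_mem _ hR)) hJ hs h

/-- `w` vanishes, in the sense of traces, on the sides outside `Ω`. -/
def VanishesOnBoundary (Ω : Set (ℝ × ℝ)) (w : ℝ × ℝ → ℝ) : Prop :=
  ∀ R : Rect, R.openSet ⊆ Ω → ∀ i, Disjoint (R.side i).openSet Ω → ∀ U, IsRep w R U →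
    ∀ t ∈ Icc (R.side i).lo (R.side i).hi, U ((R.side i).point t) = 0

/-- Two adjacent squares at a corner are either joined through a side inside `Ω`, and then their
representatives agree, or separated by a side outside `Ω`, and then both vanish on it. In the first
case an open set around the side forces both squares into `Ω`. -/
theorem corner_cases (hΩ : IsOpen Ω) (hw : HasReps Ω w) (hb : VanishesOnBoundary Ω w)
    {R₁ R₂ : Rect} (h₁ : R₁.openSet ⊆ Ω ∨ Disjoint R₁.openSet Ω)
    (h₂ : R₂.openSet ⊆ Ω ∨ Disjoint R₂.openSet Ω) (i j : Fin 4) (hij : R₁.side i = R₂.side j)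
    (he : (R₁.side i).openSet ⊆ Ω ∨ Disjoint (R₁.side i).openSet Ω) {t : ℝ}
    (ht : t ∈ Icc (R₁.side i).lo (R₁.side i).hi) {p : ℝ × ℝ} (hp : (R₁.side i).point t = p) :
    (R₁.openSet ⊆ Ω ∧ R₂.openSet ⊆ Ω ∧ ∀ U₁ U₂, IsRep w R₁ U₁ → IsRep w R₂ U₂ → U₁ p = U₂ p) ∨
    ((R₁.openSet ⊆ Ω → ∀ U, IsRep w R₁ U → U p = 0) ∧
      (R₂.openSet ⊆ Ω → ∀ U, IsRep w R₂ U → U p = 0)) := by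
  subst hp
  rcases he with he | he
  · left
    have aux : ∀ (R : Rect) (k : Fin 4), R.side k = R₁.side i →
        (R.openSet ⊆ Ω ∨ Disjoint R.openSet Ω) → R.openSet ⊆ Ω := by
      intro R k hk h
      refine h.resolve_right fun hd => ?_
      obtain ⟨s, hs⟩ := nonempty_Ioo.2 (R.lo_lt_hi k)
      have hq : (R.side k).point s ∈ Ω := by
        rw [hk] at hs ⊢
        exact he ⟨s, hs, rfl⟩
      have hq' := R.point_mem_toSet k (Ioo_subset_Icc_self hs)
      rw [← R.closure_openSet] at hq'
      obtain ⟨z, hz1, hz2⟩ := mem_closure_iff.1 hq' Ω hΩ hq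
      exact hd.notMem_of_mem_left hz2 hz1
    exact ⟨aux R₁ i rfl h₁, aux R₂ j hij.symm h₂, fun U₁ U₂ r₁ r₂ =>
      r₁.eq_on_side hΩ hw r₂ hij he ht⟩
  · right
    refine ⟨fun h U hU => hb R₁ h i he U hU t ht, fun h U hU => ?_⟩
    rw [hij] at he ht ⊢
    exact hb R₂ h j he U hU t ht

/-- In each coordinate the rectangle extends to the right of `p` or, if `p` is at its upper end, to
the left; the two directions select the square. -/
theorem exists_mem_closure_quad (p : ℝ × ℝ) {δ : ℝ} (hδ : 0 < δ) {R : Rect} (hp : p ∈ R.toSet) :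
    ∃ i, p ∈ closure (R.openSet ∩ (quad p hδ i).openSet) := by
  have right : ∀ a b x : ℝ, a ≤ x → x < b → x ∈ closure (Ioo a b ∩ Ioo x (x + δ)) := by
    intro a b x h1 h2
    rw [Ioo_inter_Ioo, sup_of_le_right h1, closure_Ioo (lt_inf_iff.2 ⟨h2, by linarith⟩).ne]
    exact ⟨le_rfl, (lt_inf_iff.2 ⟨h2, by linarith⟩).le⟩
  have left : ∀ a b x : ℝ, a < x → x ≤ b → x ∈ closure (Ioo a b ∩ Ioo (x - δ) x) := by
    intro a b x h1 h2
    rw [Ioo_inter_Ioo, inf_of_le_right h2, closure_Ioo (sup_lt_iff.2 ⟨h1, by linarith⟩).ne]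
    exact ⟨(sup_lt_iff.2 ⟨h1, by linarith⟩).le, le_rfl⟩
  have hab := R.hab
  have hcd := R.hcd
  obtain ⟨⟨h1, h2⟩, h3, h4⟩ := hp
  have comb : ∀ i, p.1 ∈ closure (Ioo R.a R.b ∩ Ioo (quad p hδ i).a (quad p hδ i).b) →
      p.2 ∈ closure (Ioo R.c R.d ∩ Ioo (quad p hδ i).c (quad p hδ i).d) →
      p ∈ closure (R.openSet ∩ (quad p hδ i).openSet) := by
    intro i k1 k2
    unfold Rect.openSet
    rw [prod_inter_prod, closure_prod_eq]
    exact ⟨k1, k2⟩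
  rcases h2.lt_or_eq with k1 | k1 <;> rcases h4.lt_or_eq with k2 | k2
  · exact ⟨0, comb 0 (right _ _ _ h1 k1) (right _ _ _ h3 k2)⟩
  · exact ⟨3, comb 3 (right _ _ _ h1 k1) (left _ _ _ (by linarith) h4)⟩
  · exact ⟨1, comb 1 (left _ _ _ (by linarith) h2) (right _ _ _ h3 k2)⟩
  · exact ⟨2, comb 2 (left _ _ _ (by linarith) h2) (left _ _ _ (by linarith) h4)⟩

theorem Edge.openSet_vert (x c d : ℝ) : (Edge.vert x c d).openSet = {x} ×ˢ Ioo c d := by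
  ext ⟨s, t⟩
  simp only [Edge.openSet, Edge.point, Edge.lo, Edge.hi, mem_image, mem_Ioo, mem_prod,
    mem_singleton_iff, Prod.mk.injEq]
  constructor
  · rintro ⟨r, hr, rfl, rfl⟩; exact ⟨rfl, hr⟩
  · rintro ⟨rfl, hr⟩; exact ⟨t, hr, rfl, rfl⟩

theorem Edge.openSet_horiz (a b y : ℝ) : (Edge.horiz a b y).openSet = Ioo a b ×ˢ {y} := by
  ext ⟨s, t⟩
  simp only [Edge.openSet, Edge.point, Edge.lo, Edge.hi, mem_image, mem_Ioo, mem_prod,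
    mem_singleton_iff, Prod.mk.injEq]
  constructor
  · rintro ⟨r, hr, rfl, rfl⟩; exact ⟨hr, rfl⟩
  · rintro ⟨hr, rfl⟩; exact ⟨s, hr, rfl, rfl⟩

/-- Around `p` the four squares form a cycle. If all four ties are interior, the values agree along
the cycle. A single tie through the boundary makes its two neighbours zero, and zero then spreads
through the remaining ties of either kind. This covers slits and corners where opposite squares
meet. -/
theorem exists_common_value {F : Finset Rect} (hΩ : Ω = ⋃ R ∈ F, R.openSet) (hw : HasReps Ω w)
    (hb : VanishesOnBoundary Ω w) (p : ℝ × ℝ) :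
    ∃ c : ℝ, ∀ R : Rect, R.openSet ⊆ Ω → p ∈ R.toSet → ∀ U, IsRep w R U → U p = c := by
  have hO : IsOpen Ω := by
    rw [hΩ]; exact isOpen_biUnion fun R _ => R.isOpen_openSet
  obtain ⟨δ, hδ, hcell⟩ := exists_cells F p
  rw [← hΩ] at hcell
  have hq : ∀ i, (quad p hδ i).openSet ⊆ Ω ∨ Disjoint (quad p hδ i).openSet Ω := by
    intro i
    fin_cases i
    · exact hcell _ _ (Or.inl rfl) (Or.inl rfl)
    · exact hcell _ _ (Or.inr (Or.inl rfl)) (Or.inl rfl)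
    · exact hcell _ _ (Or.inr (Or.inl rfl)) (Or.inr (Or.inl rfl))
    · exact hcell _ _ (Or.inl rfl) (Or.inr (Or.inl rfl))
  have hrep : ∀ i, ∃ V, (quad p hδ i).openSet ⊆ Ω → IsRep w (quad p hδ i) V := by
    intro i
    by_cases h : (quad p hδ i).openSet ⊆ Ω
    · obtain ⟨V, hV⟩ := hw _ h
      exact ⟨V, fun _ => hV⟩
    · exact ⟨0, fun h' => absurd h' h⟩
  choose V hV using hrep
  -- Any rectangle through `p` overlaps one of the four squares near `p`. That square then meets
  -- `Ω`, so it lies in `Ω`, and the two values coincide.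
  have hred : (∃ c, ∀ i, (quad p hδ i).openSet ⊆ Ω → V i p = c) →
      ∃ c : ℝ, ∀ R : Rect, R.openSet ⊆ Ω → p ∈ R.toSet → ∀ U, IsRep w R U → U p = c := by
    rintro ⟨c, hc⟩
    refine ⟨c, fun R hR hpR U hU => ?_⟩
    obtain ⟨i, hi⟩ := exists_mem_closure_quad p hδ hpR
    have hne : (R.openSet ∩ (quad p hδ i).openSet).Nonempty :=
      closure_nonempty_iff.1 ⟨p, hi⟩
    obtain ⟨z, hz1, hz2⟩ := hne
    have hg : (quad p hδ i).openSet ⊆ Ω :=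
      (hq i).resolve_right fun hd => hd.notMem_of_mem_left hz2 (hR hz1)
    rw [hU.eq_of_mem_closure (hV i hg) hi, hc i hg]
  apply hred
  have e0 : ((quad p hδ 0).side 2).openSet ⊆ Ω ∨ Disjoint ((quad p hδ 0).side 2).openSet Ω := by
    have : (quad p hδ 0).side 2 = Edge.vert p.1 p.2 (p.2 + δ) := rfl
    rw [this, Edge.openSet_vert]
    exact hcell _ _ (Or.inr (Or.inr rfl)) (Or.inl rfl)
  have e1 : ((quad p hδ 1).side 0).openSet ⊆ Ω ∨ Disjoint ((quad p hδ 1).side 0).openSet Ω := by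
    have : (quad p hδ 1).side 0 = Edge.horiz (p.1 - δ) p.1 p.2 := rfl
    rw [this, Edge.openSet_horiz]
    exact hcell _ _ (Or.inr (Or.inl rfl)) (Or.inr (Or.inr rfl))
  have e2 : ((quad p hδ 2).side 3).openSet ⊆ Ω ∨ Disjoint ((quad p hδ 2).side 3).openSet Ω := by
    have : (quad p hδ 2).side 3 = Edge.vert p.1 (p.2 - δ) p.2 := rfl
    rw [this, Edge.openSet_vert]
    exact hcell _ _ (Or.inr (Or.inr rfl)) (Or.inr (Or.inl rfl))
  have e3 : ((quad p hδ 3).side 1).openSet ⊆ Ω ∨ Disjoint ((quad p hδ 3).side 1).openSet Ω := by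
    have : (quad p hδ 3).side 1 = Edge.horiz p.1 (p.1 + δ) p.2 := rfl
    rw [this, Edge.openSet_horiz]
    exact hcell _ _ (Or.inl rfl) (Or.inr (Or.inr rfl))
  have c0 := corner_cases hO hw hb (hq 0) (hq 1) 2 3 rfl e0 (t := p.2) (p := p)
    ⟨le_rfl, (show p.2 ≤ p.2 + δ by linarith)⟩ rfl
  have c1 := corner_cases hO hw hb (hq 1) (hq 2) 0 1 rfl e1 (t := p.1) (p := p)
    ⟨(show p.1 - δ ≤ p.1 by linarith), le_rfl⟩ rfl
  have c2 := corner_cases hO hw hb (hq 2) (hq 3) 3 2 rfl e2 (t := p.2) (p := p)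
    ⟨(show p.2 - δ ≤ p.2 by linarith), le_rfl⟩ rfl
  have c3 := corner_cases hO hw hb (hq 3) (hq 0) 1 0 rfl e3 (t := p.1) (p := p)
    ⟨le_rfl, (show p.1 ≤ p.1 + δ by linarith)⟩ rfl
  have red : ∀ i j, ((quad p hδ i).openSet ⊆ Ω ∧ (quad p hδ j).openSet ⊆ Ω ∧
      ∀ U₁ U₂, IsRep w (quad p hδ i) U₁ → IsRep w (quad p hδ j) U₂ → U₁ p = U₂ p) ∨
      (((quad p hδ i).openSet ⊆ Ω → ∀ U, IsRep w (quad p hδ i) U → U p = 0) ∧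
      ((quad p hδ j).openSet ⊆ Ω → ∀ U, IsRep w (quad p hδ j) U → U p = 0)) →
      ((quad p hδ i).openSet ⊆ Ω ∧ (quad p hδ j).openSet ⊆ Ω ∧ V i p = V j p) ∨
      (((quad p hδ i).openSet ⊆ Ω → V i p = 0) ∧ ((quad p hδ j).openSet ⊆ Ω → V j p = 0)) := by
    rintro i j (⟨h1, h2, h3⟩ | ⟨h1, h2⟩)
    · exact Or.inl ⟨h1, h2, h3 _ _ (hV i h1) (hV j h2)⟩
    · exact Or.inr ⟨fun h => h1 h _ (hV i h), fun h => h2 h _ (hV j h)⟩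
  replace c0 := red 0 1 c0
  replace c1 := red 1 2 c1
  replace c2 := red 2 3 c2
  replace c3 := red 3 0 c3
  have hfin : ∀ c : ℝ, ((quad p hδ 0).openSet ⊆ Ω → V 0 p = c) →
      ((quad p hδ 1).openSet ⊆ Ω → V 1 p = c) → ((quad p hδ 2).openSet ⊆ Ω → V 2 p = c) →
      ((quad p hδ 3).openSet ⊆ Ω → V 3 p = c) →
      ∃ c, ∀ i, (quad p hδ i).openSet ⊆ Ω → V i p = c := by
    intro c h0 h1 h2 h3
    refine ⟨c, fun i => ?_⟩
    fin_cases i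
    · exact h0
    · exact h1
    · exact h2
    · exact h3
  clear hred red hcell hq e0 e1 e2 e3 hV
  generalize V 0 p = v0 at *
  generalize V 1 p = v1 at *
  generalize V 2 p = v2 at *
  generalize V 3 p = v3 at *
  generalize ((quad p hδ 0).openSet ⊆ Ω) = g0 at *
  generalize ((quad p hδ 1).openSet ⊆ Ω) = g1 at *
  generalize ((quad p hδ 2).openSet ⊆ Ω) = g2 at *
  generalize ((quad p hδ 3).openSet ⊆ Ω) = g3 at *
  -- If some value at a square in `Ω` is nonzero, no tie can be of the boundary kind, so all four
  -- squares lie in `Ω` with the value `v0`.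
  by_cases hz : (g0 → v0 = 0) ∧ (g1 → v1 = 0) ∧ (g2 → v2 = 0) ∧ (g3 → v3 = 0)
  · exact hfin 0 hz.1 hz.2.1 hz.2.2.1 hz.2.2.2
  · refine hfin v0 (fun _ => rfl) ?_ ?_ ?_ <;> grind

theorem exists_continuous_rep {F : Finset Rect} (hΩ : Ω = ⋃ R ∈ F, R.openSet)
    (hw : HasReps Ω w) (hb : VanishesOnBoundary Ω w) :
    ∃ uc : ℝ × ℝ → ℝ, ContinuousOn uc (closure Ω) ∧ uc =ᵐ[volume.restrict Ω] w ∧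
      ∀ R : Rect, R.openSet ⊆ Ω → IsRep w R uc := by
  choose uc huc using exists_common_value hΩ hw hb
  have hrep : ∀ R : Rect, R.openSet ⊆ Ω → IsRep w R uc := by
    intro R hR
    obtain ⟨U, hU⟩ := hw R hR
    have heq : EqOn uc U R.toSet := fun p hp => (huc p R hR hp U hU).symm
    refine ⟨hU.1.congr heq, ?_⟩
    filter_upwards [hU.2, ae_restrict_mem R.measurableSet_toSet] with p h1 h2
    rw [heq h2, h1]
  have hsub : ∀ R ∈ F, R.openSet ⊆ Ω := fun R hR => by
    rw [hΩ]; exact subset_biUnion_of_mem (u := fun R : Rect => R.openSet) hR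
  refine ⟨uc, ?_, ?_, hrep⟩
  -- The closure is a finite union of closed rectangles on each of which the function is continuous.
  · have hcl : closure Ω = ⋃ R : F, R.1.toSet := by
      rw [hΩ, Finset.closure_biUnion]
      simp only [Rect.closure_openSet]
      rw [iUnion_subtype]
    rw [hcl]
    exact (locallyFinite_of_finite _).continuousOn_iUnion
      (fun R => R.1.isCompact_toSet.isClosed) fun R => (hrep R.1 (hsub R.1 R.2)).1
  · rw [Filter.EventuallyEq, hΩ, ae_restrict_biUnion_finset_iff]
    intro R hR
    have := (hrep R (hsub R hR)).2
    rwa [R.restrict_toSet_eq] at this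

end

section

/-! ### Rectangular meshes -/

theorem Edge.subset_line (e : Edge) :
    (∃ x, e.toSet ⊆ {p | p.1 = x}) ∨ ∃ y, e.toSet ⊆ {p | p.2 = y} := by
  cases e with
  | horiz a b y => right; refine ⟨y, ?_⟩; rintro _ ⟨t, _, rfl⟩; rfl
  | vert x c d => left; refine ⟨x, ?_⟩; rintro _ ⟨t, _, rfl⟩; rfl

namespace IsMesh

variable {Ω : Set (ℝ × ℝ)} {𝒯 : Finset Rect}

/-- Overlapping interiors would contain a small rectangle, but conforming elements meet in nothing,
a point or a segment. The points `m1` and `m2` differ in both coordinates, so no point or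
axis-parallel line contains both. -/
theorem disjoint_openSet (h : IsMesh Ω 𝒯) {T T' : Rect} (hT : T ∈ 𝒯) (hT' : T' ∈ 𝒯)
    (hne : T ≠ T') : Disjoint T.openSet T'.openSet := by
  rw [disjoint_iff_inter_eq_empty]
  by_contra hcon
  obtain ⟨q, hq⟩ := nonempty_iff_ne_empty.2 hcon
  obtain ⟨S, -, hS⟩ := exists_rect_subset (T.isOpen_openSet.inter T'.isOpen_openSet) hq
  have hS' : S.openSet ⊆ T.toSet ∩ T'.toSet :=
    hS.trans (inter_subset_inter T.openSet_subset T'.openSet_subset)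
  have hab := S.hab
  have hcd := S.hcd
  have m1 : ((2 * S.a + S.b) / 3, (2 * S.c + S.d) / 3) ∈ S.openSet := by
    refine ⟨⟨?_, ?_⟩, ?_, ?_⟩ <;> simp only <;> linarith
  have m2 : ((S.a + 2 * S.b) / 3, (S.c + 2 * S.d) / 3) ∈ S.openSet := by
    refine ⟨⟨?_, ?_⟩, ?_, ?_⟩ <;> simp only <;> linarith
  rcases h.conforming T hT T' hT' hne with h0 | ⟨p, -, hp⟩ | ⟨i, -, -, hi⟩
  · rw [h0] at hS'
    exact hS' m1
  · rw [hp] at hS'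
    have := congrArg Prod.fst ((hS' m1).trans (hS' m2).symm)
    simp only at this
    linarith
  · rw [hi] at hS'
    rcases (T.side i).subset_line with ⟨x, hx⟩ | ⟨y, hy⟩
    · have := (hx (hS' m1)).trans (hx (hS' m2)).symm
      simp only at this
      linarith
    · have := (hy (hS' m1)).trans (hy (hS' m2)).symm
      simp only at this
      linarith

/-- Two elements with the same edge in the same position lie on the same side of it, so their
interiors overlap. This makes the pairing of edges an involution. -/
theorem eq_of_side_eq (h : IsMesh Ω 𝒯) {T T' : Rect} (hT : T ∈ 𝒯) (hT' : T' ∈ 𝒯) {i : Fin 4}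
    (hi : T.side i = T'.side i) : T = T' := by
  by_contra hne
  have hd := h.disjoint_openSet hT hT' hne
  have key : ∃ q, q ∈ T.openSet ∧ q ∈ T'.openSet := by
    have h1 := T.hab; have h2 := T.hcd; have h3 := T'.hab; have h4 := T'.hcd
    fin_cases i <;> simp only [Rect.side, Fin.zero_eta, Fin.mk_one, Fin.reduceFinMk,
      Matrix.cons_val, Edge.horiz.injEq, Edge.vert.injEq] at hi
    · obtain ⟨e1, e2, e3⟩ := hi
      obtain ⟨y, hy1, hy2⟩ := exists_between (lt_min h2 (e3 ▸ h4))
      rw [lt_min_iff] at hy2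
      exact ⟨((T.a + T.b) / 2, y), ⟨⟨by simp only; linarith, by simp only; linarith⟩, hy1, hy2.1⟩,
        ⟨by simp only; linarith, by simp only; linarith⟩, by simp only; linarith, hy2.2⟩
    · obtain ⟨e1, e2, e3⟩ := hi
      obtain ⟨y, hy1, hy2⟩ := exists_between (max_lt h2 (e3 ▸ h4))
      rw [max_lt_iff] at hy1
      exact ⟨((T.a + T.b) / 2, y), ⟨⟨by simp only; linarith, by simp only; linarith⟩, hy1.1, hy2⟩,
        ⟨by simp only; linarith, by simp only; linarith⟩, hy1.2, by simp only; linarith⟩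
    · obtain ⟨e1, e2, e3⟩ := hi
      obtain ⟨x, hx1, hx2⟩ := exists_between (lt_min h1 (e1 ▸ h3))
      rw [lt_min_iff] at hx2
      exact ⟨(x, (T.c + T.d) / 2), ⟨⟨hx1, hx2.1⟩, by simp only; linarith, by simp only; linarith⟩,
        ⟨by simp only; linarith, hx2.2⟩, by simp only; linarith, by simp only; linarith⟩
    · obtain ⟨e1, e2, e3⟩ := hi
      obtain ⟨x, hx1, hx2⟩ := exists_between (max_lt h1 (e1 ▸ h3))
      rw [max_lt_iff] at hx1
      exact ⟨(x, (T.c + T.d) / 2), ⟨⟨hx1.1, hx2⟩, by simp only; linarith, by simp only; linarith⟩,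
        ⟨hx1.2, by simp only; linarith⟩, by simp only; linarith, by simp only; linarith⟩
  obtain ⟨q, q1, q2⟩ := key
  exact hd.notMem_of_mem_left q1 q2

end IsMesh

/-- The opposite side. -/
def opp : Fin 4 → Fin 4 := ![1, 0, 3, 2]

theorem opp_opp (i : Fin 4) : opp (opp i) = i := by fin_cases i <;> rfl

theorem opp_ne (i : Fin 4) : opp i ≠ i := by fin_cases i <;> decide

theorem normal_opp (i : Fin 4) : normal (opp i) = -normal i := by
  fin_cases i <;> simp [normal, opp]

namespace IsMesh

variable {Ω : Set (ℝ × ℝ)} {𝒯 : Finset Rect}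

open Filter Topology in
-- Leave the midpoint `m` of the edge along the outward normal. The nearby points lie in `Ω`, hence
-- in elements; as these are finitely many and closed, one of them contains such points arbitrarily
-- close to `m`, and `m` too. Conformity then leaves only a whole common edge.
theorem exists_neighbour (h : IsMesh Ω 𝒯) (hΩ : IsOpen Ω) {T : Rect} (hT : T ∈ 𝒯) {i : Fin 4}
    (hi : (T.side i).openSet ⊆ Ω) : ∃ T' ∈ 𝒯, T'.side (opp i) = T.side i := by
  have h1 := T.hab
  have h2 := T.hcd
  set m := (T.side i).point (((T.side i).lo + (T.side i).hi) / 2) with hm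
  have hlt := T.lo_lt_hi i
  have hmΩ : m ∈ Ω := hi ⟨_, ⟨by linarith, by linarith⟩, rfl⟩
  have hcont : Tendsto (fun s : ℝ => m + s • normal i) (𝓝[>] 0) (𝓝 m) := by
    have : Continuous fun s : ℝ => m + s • normal i := by fun_prop
    have := this.tendsto 0
    simp only [zero_smul, add_zero] at this
    exact this.mono_left nhdsWithin_le_nhds
  have hex : ∃ T' ∈ 𝒯, ∃ᶠ s in 𝓝[>] (0 : ℝ), m + s • normal i ∈ T'.toSet := by
    by_contra hcon
    push Not at hcon
    have hall : ∀ᶠ s in 𝓝[>] (0 : ℝ), ∀ T' ∈ 𝒯, m + s • normal i ∉ T'.toSet := by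
      rw [Finset.eventually_all]
      exact fun T' hT' => hcon T' hT'
    obtain ⟨s, hs1, hs2⟩ := (hall.and (hcont.eventually (hΩ.mem_nhds hmΩ))).exists
    have := subset_closure hs2
    rw [← h.cover] at this
    simp only [mem_iUnion, exists_prop] at this
    obtain ⟨T', hT', hm'⟩ := this
    exact hs1 T' hT' hm'
  obtain ⟨T', hT', hfr⟩ := hex
  have hmT' : m ∈ T'.toSet := T'.isCompact_toSet.isClosed.mem_of_frequently_of_tendsto hfr hcont
  have hmT : m ∈ T.toSet := T.point_mem_toSet i ⟨by linarith, by linarith⟩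
  obtain ⟨s, hs1, hs2⟩ := (hfr.and_eventually eventually_mem_nhdsWithin).exists
  rw [mem_Ioi] at hs2
  refine ⟨T', hT', ?_⟩
  -- Points beyond the edge in the outward direction are not in `T`.
  have hne : T ≠ T' := by
    rintro rfl
    fin_cases i <;>
      simp [hm, Rect.side, Edge.point, Edge.lo, Edge.hi, normal, Rect.toSet] at hs1 <;> linarith
  rcases h.conforming T hT T' hT' hne with h0 | ⟨p, hp, hp'⟩ | ⟨i', j, hij, hi'⟩
  · have : m ∈ T.toSet ∩ T'.toSet := ⟨hmT, hmT'⟩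
    rw [h0] at this
    exact this.elim
  · have : m ∈ T.toSet ∩ T'.toSet := ⟨hmT, hmT'⟩
    rw [hp', mem_singleton_iff] at this
    have hv := hp.1
    rw [← this] at hv
    exfalso
    fin_cases i <;>
      simp [hm, Rect.side, Edge.point, Edge.lo, Edge.hi, Rect.vertices] at hv <;>
      grind
  · have : m ∈ T.toSet ∩ T'.toSet := ⟨hmT, hmT'⟩
    rw [hi'] at this
    have hii : i' = i := by
      obtain ⟨t, ht, hmt⟩ := this
      fin_cases i <;> fin_cases i' <;>
        simp [hm, Rect.side, Edge.point, Edge.lo, Edge.hi] at hmt ht ⊢ <;> grind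
    subst hii
    -- The element contains a point beyond the edge, so it lies on the far side and the edge
    -- occupies the opposite position in it.
    have hj : j = opp i' := by
      fin_cases i' <;> fin_cases j <;>
        simp [hm, Rect.side, Edge.point, Edge.lo, Edge.hi, opp, normal, Rect.toSet] at hij hs1 ⊢ <;>
        linarith
    rw [← hj, hij]

open Classical in
/-- The fluxes of a field that is continuous across the interior edges cancel. -/
theorem sum_flux_eq_zero (h : IsMesh Ω 𝒯) (hΩ : IsOpen Ω) {b : Edge → ℝ → ℝ}
    (hb : ∀ e, IsMeshEdge 𝒯 e → e.toSet ⊆ frontier Ω → b e = 0) (G : Rect → VField)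
    (hG : ∀ T ∈ 𝒯, ∀ T' ∈ 𝒯, ∀ i j, T.side i = T'.side j → (T.side i).openSet ⊆ Ω →
      ∀ t ∈ Icc (T.side i).lo (T.side i).hi,
        (G T).1 ((T.side i).point t) = (G T').1 ((T.side i).point t) ∧
        (G T).2 ((T.side i).point t) = (G T').2 ((T.side i).point t)) :
    ∑ T ∈ 𝒯, flux T (fun i => b (T.side i)) (G T).1 (G T).2 = 0 := by
  unfold flux
  rw [← Finset.sum_product']
  set f : Rect × Fin 4 → ℝ := fun x => ∫ t in (x.1.side x.2).lo..(x.1.side x.2).hi,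
    b (x.1.side x.2) t * ((G x.1).1 ((x.1.side x.2).point t) * (normal x.2).1 +
      (G x.1).2 ((x.1.side x.2).point t) * (normal x.2).2) with hf
  -- Each pair of an element and a side is sent to the neighbour with the opposite side, or to
  -- itself if there is no neighbour. In the latter case the edge is on the boundary and contributes
  -- nothing. A boundary edge may also have a neighbour, along a slit; then both terms vanish
  -- because `b` does.
  have hnb : ∀ x : Rect × Fin 4, ∃ y : Rect × Fin 4,
      (y.1 ∈ 𝒯 ∧ y.2 = opp x.2 ∧ y.1.side (opp x.2) = x.1.side x.2) ∨
      (y = x ∧ ¬ ∃ T' ∈ 𝒯, T'.side (opp x.2) = x.1.side x.2) := by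
    intro x
    by_cases hx : ∃ T' ∈ 𝒯, T'.side (opp x.2) = x.1.side x.2
    · obtain ⟨T', hT', hs⟩ := hx
      exact ⟨(T', opp x.2), Or.inl ⟨hT', rfl, hs⟩⟩
    · exact ⟨x, Or.inr ⟨rfl, hx⟩⟩
  choose g hg using hnb
  have hfr : ∀ x : Rect × Fin 4, x.1 ∈ 𝒯 → (x.1.side x.2).toSet ⊆ frontier Ω → f x = 0 := by
    intro x hx hxf
    simp only [hf, hb _ ⟨x.1, hx, x.2, rfl⟩ hxf, Pi.zero_apply, zero_mul,
      intervalIntegral.integral_zero]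
  have hno : ∀ x : Rect × Fin 4, x.1 ∈ 𝒯 →
      (¬ ∃ T' ∈ 𝒯, T'.side (opp x.2) = x.1.side x.2) → f x = 0 := by
    intro x hx hn
    rcases h.edges _ ⟨x.1, hx, x.2, rfl⟩ with he | he
    · exact absurd (h.exists_neighbour hΩ hx he) hn
    · exact hfr x hx he
  refine Finset.sum_involution (fun x _ => g x) ?_ ?_ ?_ ?_
  · intro x hx
    have hx1 : x.1 ∈ 𝒯 := (Finset.mem_product.1 hx).1
    rcases hg x with ⟨g1, g2, g3⟩ | ⟨g1, g2⟩
    · have hs : (g x).1.side (g x).2 = x.1.side x.2 := by rw [g2, g3]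
      rcases h.edges _ ⟨x.1, hx1, x.2, rfl⟩ with he | he
      · have hsum : ∀ t ∈ Icc (x.1.side x.2).lo (x.1.side x.2).hi,
            b (x.1.side x.2) t * ((G (g x).1).1 ((x.1.side x.2).point t) * (normal (g x).2).1 +
            (G (g x).1).2 ((x.1.side x.2).point t) * (normal (g x).2).2) =
            -(b (x.1.side x.2) t * ((G x.1).1 ((x.1.side x.2).point t) * (normal x.2).1 +
            (G x.1).2 ((x.1.side x.2).point t) * (normal x.2).2)) := by
          intro t ht
          obtain ⟨a1, a2⟩ := hG x.1 hx1 (g x).1 g1 x.2 (g x).2 hs.symm he t ht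
          rw [← a1, ← a2, g2, normal_opp]
          simp only [Prod.fst_neg, Prod.snd_neg]
          ring
        have : f (g x) = -f x := by
          simp only [hf, hs]
          rw [← intervalIntegral.integral_neg]
          refine intervalIntegral.integral_congr fun t ht => hsum t ?_
          rwa [uIcc_of_le (x.1.lo_le_hi x.2)] at ht
        show f x + f (g x) = 0
        rw [this, add_neg_cancel]
      · show f x + f (g x) = 0
        rw [hfr x hx1 he, hfr (g x) g1 (by rw [hs]; exact he), add_zero]
    · show f x + f (g x) = 0
      rw [g1, hno x hx1 g2, add_zero]
  · intro x hx hfx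
    have hx1 : x.1 ∈ 𝒯 := (Finset.mem_product.1 hx).1
    rcases hg x with ⟨g1, g2, g3⟩ | ⟨g1, g2⟩
    · intro hc
      rw [hc] at g2
      exact opp_ne x.2 g2.symm
    · exact absurd (hno x hx1 g2) hfx
  · intro x hx
    have hx1 : x.1 ∈ 𝒯 := (Finset.mem_product.1 hx).1
    rcases hg x with ⟨g1, g2, g3⟩ | ⟨g1, g2⟩
    · exact Finset.mem_product.2 ⟨g1, Finset.mem_univ _⟩
    · simp only [g1]
      exact hx
  · intro x hx
    have hx1 : x.1 ∈ 𝒯 := (Finset.mem_product.1 hx).1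
    rcases hg x with ⟨g1, g2, g3⟩ | ⟨g1, g2⟩
    · have hs : (g x).1.side (g x).2 = x.1.side x.2 := by rw [g2, g3]
      have hback : x.1.side (opp (g x).2) = (g x).1.side (g x).2 := by rw [g2, opp_opp, g3]
      rcases hg (g x) with ⟨k1, k2, k3⟩ | ⟨k1, k2⟩
      · have e2 : (g (g x)).2 = x.2 := by rw [k2, g2, opp_opp]
        have e1 : (g (g x)).1 = x.1 := h.eq_of_side_eq k1 hx1 (k3.trans hback.symm)
        exact Prod.ext e1 e2
      · exact absurd ⟨x.1, hx1, hback⟩ k2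
    · show g (g x) = x
      rw [g1, g1]

theorem diam_le_meshSize {T : Rect} (hT : T ∈ 𝒯) : T.diam ≤ meshSize 𝒯 :=
  le_csSup ((𝒯.finite_toSet.image _).bddAbove) ⟨T, hT, rfl⟩

theorem nonempty (h : IsMesh Ω 𝒯) (hΩ : Ω.Nonempty) : 𝒯.Nonempty := by
  obtain ⟨p, hp⟩ := hΩ
  have := subset_closure hp
  rw [← h.cover] at this
  simp only [mem_iUnion, exists_prop] at this
  obtain ⟨T, hT, -⟩ := this
  exact ⟨T, hT⟩

theorem meshSize_pos (h : IsMesh Ω 𝒯) (hΩ : Ω.Nonempty) : 0 < meshSize 𝒯 := by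
  obtain ⟨T, hT⟩ := h.nonempty hΩ
  exact T.diam_pos.trans_le (diam_le_meshSize hT)

/-- An upper bound for `h` in terms of `Ω` alone; it absorbs excess powers of `h` into the constant.
Coordinates bounded by `B` give sides at most `2 B` and a diameter below `4 B`. -/
theorem exists_meshSize_le (hΩ : Ω.Nonempty) (hb : Bornology.IsBounded Ω) :
    ∃ D : ℝ, 1 ≤ D ∧ ∀ 𝒯 : Finset Rect, IsMesh Ω 𝒯 → meshSize 𝒯 ≤ D := by
  obtain ⟨B, hB⟩ := hb.closure.exists_norm_le
  refine ⟨max 1 (4 * B), le_max_left _ _, fun 𝒯 h => ?_⟩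
  obtain ⟨T₀, hT₀⟩ := h.nonempty hΩ
  refine csSup_le ⟨_, T₀, hT₀, rfl⟩ ?_
  rintro _ ⟨T, hT, rfl⟩
  refine le_trans ?_ (le_max_right _ _)
  have hsub : T.toSet ⊆ closure Ω := by
    rw [← h.cover]
    exact subset_biUnion_of_mem (u := fun T : Rect => T.toSet) hT
  have hab := T.hab
  have hcd := T.hcd
  have p1 := hB (T.a, T.c) (hsub ⟨⟨le_rfl, hab.le⟩, le_rfl, hcd.le⟩)
  have p2 := hB (T.b, T.d) (hsub ⟨⟨hab.le, le_rfl⟩, hcd.le, le_rfl⟩)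
  rw [Prod.norm_def, max_le_iff, Real.norm_eq_abs, Real.norm_eq_abs, abs_le, abs_le] at p1 p2
  simp only at p1 p2
  unfold Rect.diam
  rw [Real.sqrt_le_left (by linarith)]
  nlinarith

theorem sum_sobolevSq_le (h : IsMesh Ω 𝒯) {m : ℕ} {u : ℝ × ℝ → ℝ}
    (hu : MemH Ω m u) :
    ∑ T ∈ 𝒯, sobolevSq T m (fun i j => weakD Ω i j u) ≤ sobolevNorm Ω m u ^ 2 := by
  unfold sobolevNorm sobolevSq
  rw [Real.sq_sqrt (Finset.sum_nonneg fun _ _ => Finset.sum_nonneg fun _ _ =>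
    integral_nonneg fun _ => sq_nonneg _), Finset.sum_comm]
  refine Finset.sum_le_sum fun i hi => ?_
  rw [Finset.sum_comm]
  refine Finset.sum_le_sum fun j hj => ?_
  rw [Finset.mem_range] at hi hj
  have hint := (isWeakDeriv_weakD hu (i := i) (j := j) (by omega)).1.integrable_sq
  have hsub : (⋃ T ∈ 𝒯, T.openSet) ⊆ Ω := iUnion₂_subset h.interior_subset
  simp only [Rect.restrict_toSet_eq]
  rw [← integral_biUnion_finset 𝒯 (fun T _ => T.isOpen_openSet.measurableSet)
    (fun T hT T' hT' hne => h.disjoint_openSet hT hT' hne)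
    (fun T hT => IntegrableOn.mono_set hint (h.interior_subset T hT))]
  exact setIntegral_mono_set hint (.of_forall fun _ => sq_nonneg _) hsub.eventuallyLE

end IsMesh

end

section

/-! ### The error equation -/

variable {Ω : Set (ℝ × ℝ)} {𝒯 : Finset Rect} {k : ℕ}

theorem continuous_of_mem_Vh {v : WeakFunction} (hv : v ∈ Vh 𝒯 k) {T : Rect} (hT : T ∈ 𝒯) :
    Continuous (v.1 T) ∧ ∀ i, Continuous (v.2 (T.side i)) :=
  ⟨(contDiff_of_mem_Q (hv.1 T hT)).continuous,
    fun i => continuous_of_mem_P (hv.2 _ ⟨T, hT, i, rfl⟩)⟩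

theorem isDiscreteWeakGrad_of_mem_Vh {v : WeakFunction} (hv : v ∈ Vh 𝒯 k) {T : Rect}
    (hT : T ∈ 𝒯) : IsDiscreteWeakGrad k T v (discreteWeakGrad k T v) :=
  isDiscreteWeakGrad_discreteWeakGrad (continuous_of_mem_Vh hv hT).1 (continuous_of_mem_Vh hv hT).2

/-- The weak gradient is a chosen object, so its linearity is not used directly. Tested with `∇_w v
∈ W_k`, each term equals its defining right-hand side, which is visibly linear. -/
theorem integral_weakGrad_sub {w w' v : WeakFunction} (hw : w ∈ Vh 𝒯 k) (hw' : w' ∈ Vh 𝒯 k)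
    (hv : v ∈ Vh 𝒯 k) {T : Rect} (hT : T ∈ 𝒯) :
    ∫ p in T.toSet, ((discreteWeakGrad k T (w - w')).1 p * (discreteWeakGrad k T v).1 p +
      (discreteWeakGrad k T (w - w')).2 p * (discreteWeakGrad k T v).2 p) =
    (∫ p in T.toSet, ((discreteWeakGrad k T w).1 p * (discreteWeakGrad k T v).1 p +
      (discreteWeakGrad k T w).2 p * (discreteWeakGrad k T v).2 p)) -
    ∫ p in T.toSet, ((discreteWeakGrad k T w').1 p * (discreteWeakGrad k T v).1 p +
      (discreteWeakGrad k T w').2 p * (discreteWeakGrad k T v).2 p) := by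
  have hq := (isDiscreteWeakGrad_of_mem_Vh hv hT).1
  set q := discreteWeakGrad k T v
  rw [(isDiscreteWeakGrad_of_mem_Vh (Submodule.sub_mem _ hw hw') hT).2 q hq,
    (isDiscreteWeakGrad_of_mem_Vh hw hT).2 q hq, (isDiscreteWeakGrad_of_mem_Vh hw' hT).2 q hq]
  have s1 := contDiff_of_mem_Q hq.1
  have s2 := contDiff_of_mem_Q hq.2
  have cd : Continuous fun p => dx q.1 p + dy q.2 p :=
    (contDiff_dx s1).continuous.add (contDiff_dy s2).continuous
  obtain ⟨c1, c2⟩ := continuous_of_mem_Vh hw hT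
  obtain ⟨c1', c2'⟩ := continuous_of_mem_Vh hw' hT
  have e1 : ∫ p in T.toSet, (w - w').1 T p * (dx q.1 p + dy q.2 p) =
      (∫ p in T.toSet, w.1 T p * (dx q.1 p + dy q.2 p)) -
        ∫ p in T.toSet, w'.1 T p * (dx q.1 p + dy q.2 p) := by
    have i1 : IntegrableOn (fun p => w.1 T p * (dx q.1 p + dy q.2 p)) T.toSet :=
      integrableOn_rect (c1.mul cd).continuousOn
    have i2 : IntegrableOn (fun p => w'.1 T p * (dx q.1 p + dy q.2 p)) T.toSet :=
      integrableOn_rect (c1'.mul cd).continuousOn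
    rw [← integral_sub i1 i2]
    refine integral_congr_ae (.of_forall fun p => ?_)
    simp only [Prod.fst_sub, Pi.sub_apply]
    ring
  have e2 := flux_add (T := T) c2 c2' s1.continuous s2.continuous
  unfold flux at e2
  rw [e1]
  simp only [Prod.snd_sub, Pi.sub_apply]
  rw [e2]
  ring

theorem stabilizer_sub {α : ℝ} {w w' v : WeakFunction} (hw : w ∈ Vh 𝒯 k) (hw' : w' ∈ Vh 𝒯 k)
    (hv : v ∈ Vh 𝒯 k) :
    stabilizer 𝒯 α (w - w') v = stabilizer 𝒯 α w v - stabilizer 𝒯 α w' v := by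
  unfold stabilizer
  rw [← Finset.sum_sub_distrib]
  refine Finset.sum_congr rfl fun T hT => ?_
  rw [← mul_sub, ← Finset.sum_sub_distrib]
  congr 1
  refine Finset.sum_congr rfl fun i _ => ?_
  obtain ⟨c1, c2⟩ := continuous_of_mem_Vh hw hT
  obtain ⟨c1', c2'⟩ := continuous_of_mem_Vh hw' hT
  obtain ⟨d1, d2⟩ := continuous_of_mem_Vh hv hT
  have := c2 i
  have := c2' i
  have := d2 i
  have cP := (T.side i).continuous_point
  rw [← intervalIntegral.integral_sub (Continuous.intervalIntegrable (by fun_prop) _ _)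
    (Continuous.intervalIntegrable (by fun_prop) _ _)]
  refine intervalIntegral.integral_congr fun t _ => ?_
  simp only [Prod.fst_sub, Prod.snd_sub, Pi.sub_apply]
  ring

theorem aS_sub {α : ℝ} {w w' v : WeakFunction} (hw : w ∈ Vh 𝒯 k) (hw' : w' ∈ Vh 𝒯 k)
    (hv : v ∈ Vh 𝒯 k) : aS 𝒯 k α (w - w') v = aS 𝒯 k α w v - aS 𝒯 k α w' v := by
  unfold aS
  rw [stabilizer_sub hw hw' hv,
    Finset.sum_congr rfl fun T hT => integral_weakGrad_sub hw hw' hv hT, Finset.sum_sub_distrib]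
  ring

theorem Ih_mem_Vh (hk : 1 ≤ k) (u : ℝ × ℝ → ℝ) : Ih k u ∈ Vh 𝒯 k :=
  ⟨fun T _ => interpRect_mem_Q hk u T, fun e _ => interpEdge_mem_P hk u e⟩

/-- The bilinear form of an interpolant sees only its gradient. -/
theorem aS_Ih (hk : 1 ≤ k) {α : ℝ} (u : ℝ × ℝ → ℝ) {v : WeakFunction} (hv : v ∈ Vh 𝒯 k) :
    aS 𝒯 k α (Ih k u) v = ∑ T ∈ 𝒯, ∫ p in T.toSet,
      (dx (interpRect k u T) p * (discreteWeakGrad k T v).1 p +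
        dy (interpRect k u T) p * (discreteWeakGrad k T v).2 p) := by
  have hs : stabilizer 𝒯 α (Ih k u) v = 0 := by
    unfold stabilizer
    refine Finset.sum_eq_zero fun T _ => ?_
    rw [Finset.sum_eq_zero, mul_zero]
    intro i _
    simp only [Ih, interpRect_side hk, sub_self, zero_mul, intervalIntegral.integral_zero]
  unfold aS
  rw [hs, add_zero]
  refine Finset.sum_congr rfl fun T hT => ?_
  have hq := (isDiscreteWeakGrad_of_mem_Vh hv hT).1
  set q := discreteWeakGrad k T v
  -- With `q = ∇_w v` as test field, the trace of the interpolant is its edge component, so Green's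
  -- formula replaces `∇_w I_h u` by `∇ I_h u`.
  rw [(isDiscreteWeakGrad_of_mem_Vh (Ih_mem_Vh hk u) hT).2 q hq]
  have hI := contDiff_of_mem_Q (interpRect_mem_Q hk u T)
  have hg := green_rect hI (contDiff_of_mem_Q hq.1) (contDiff_of_mem_Q hq.2) T
  simp only [interpRect_side hk] at hg
  simp only [Ih]
  rw [hg]
  have : ∫ p in T.toSet, (dx (interpRect k u T) p * q.1 p + dy (interpRect k u T) p * q.2 p) =
      ∫ p in T.toSet, (q.1 p * dx (interpRect k u T) p + q.2 p * dy (interpRect k u T) p) :=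
    integral_congr_ae (.of_forall fun p => by simp only; ring)
  rw [this]
  ring

theorem hasReps_weakD {m : ℕ} (hm : 3 ≤ m) {u : ℝ × ℝ → ℝ} (hu : MemH Ω m u) :
    HasReps Ω (weakD Ω 0 0 u) ∧ HasReps Ω (weakD Ω 1 0 u) ∧ HasReps Ω (weakD Ω 0 1 u) := by
  refine ⟨fun R hR => ?_, fun R hR => ?_, fun R hR => ?_⟩
  · obtain ⟨_, U, _, _, _, _, h, _, _⟩ := exists_approx hm hu hR
    exact ⟨U, h.2⟩
  · obtain ⟨_, _, U, _, _, _, _, h, _⟩ := exists_approx hm hu hR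
    exact ⟨U, h.2⟩
  · obtain ⟨_, _, _, U, _, _, _, _, h⟩ := exists_approx hm hu hR
    exact ⟨U, h.2⟩

theorem vanishesOnBoundary_weakD (hΩ : IsOpen Ω) {m : ℕ} (hm : 3 ≤ m) {u : ℝ × ℝ → ℝ}
    (hu : MemH Ω m u) (hu0 : MemH10 Ω u) : VanishesOnBoundary Ω (weakD Ω 0 0 u) :=
  fun _ hR _ hi _ hU => eq_zero_of_memH10 hΩ hm hu hu0 hR hi hU.1 hU.2

/-- An edge contained in the frontier is disjoint from the open set `Ω`, so the representative
vanishes at all its nodes. -/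
theorem Ih_mem_Vh0 (hk : 1 ≤ k) (hΩ : IsOpen Ω) (h : IsMesh Ω 𝒯) {w uc : ℝ × ℝ → ℝ}
    (hb : VanishesOnBoundary Ω w) (hrep : ∀ R : Rect, R.openSet ⊆ Ω → IsRep w R uc) :
    Ih k uc ∈ Vh0 Ω 𝒯 k := by
  refine ⟨Ih_mem_Vh hk uc, ?_⟩
  rintro e ⟨T, hT, i, rfl⟩ hf
  have hd : Disjoint (T.side i).openSet Ω := by
    have h1 : (T.side i).openSet ⊆ frontier Ω := (image_mono Ioo_subset_Icc_self).trans hf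
    refine disjoint_of_subset_left h1 ?_
    rw [hΩ.frontier_eq]
    exact disjoint_sdiff_left
  funext t
  refine Finset.sum_eq_zero fun ζ hζ => ?_
  rw [hb T (h.interior_subset T hT) i hd uc (hrep T (h.interior_subset T hT)) _
    (fromRef_mem_Icc (T.lo_lt_hi i) (lobattoNodes_subset_Icc hk hζ)), zero_mul]

theorem aS_self_eq (α : ℝ) (v : WeakFunction) : aS 𝒯 k α v v =
    (∑ T ∈ 𝒯, gradSq k T v) + meshSize 𝒯 ^ (-α) * ∑ T ∈ 𝒯, jumpSq T v := by
  unfold aS stabilizer gradSq jumpSq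
  rw [Finset.mul_sum]

/-- The error equation. -/
theorem aS_error_eq (hk : 1 ≤ k) (hΩ : IsOpen Ω) (h : IsMesh Ω 𝒯) {α : ℝ} {f u uc : ℝ × ℝ → ℝ}
    (hf : f =ᵐ[volume.restrict Ω] fun p => -(weakD Ω 2 0 u p + weakD Ω 0 2 u p))
    {uh v : WeakFunction} (huh : IsWGSolution Ω 𝒯 k α f uh) (hv : v ∈ Vh0 Ω 𝒯 k)
    (G : Rect → VField)
    (hG : ∀ T ∈ 𝒯, ∀ T' ∈ 𝒯, ∀ i j, T.side i = T'.side j → (T.side i).openSet ⊆ Ω →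
      ∀ t ∈ Icc (T.side i).lo (T.side i).hi,
        (G T).1 ((T.side i).point t) = (G T').1 ((T.side i).point t) ∧
        (G T).2 ((T.side i).point t) = (G T').2 ((T.side i).point t)) :
    aS 𝒯 k α (Ih k uc - uh) v = ∑ T ∈ 𝒯, elementError k T v uc (G T).1 (G T).2
      (fun p => weakD Ω 2 0 u p + weakD Ω 0 2 u p) := by
  rw [aS_sub (Ih_mem_Vh hk uc) huh.1.1 hv.1, aS_Ih hk uc hv.1, huh.2 v hv]
  unfold elementError
  -- Summed over the mesh, the fluxes of `G` against the single-valued `v_b` cancel, so subtracting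
  -- them on each element is free.
  rw [Finset.sum_sub_distrib, Finset.sum_add_distrib, h.sum_flux_eq_zero hΩ hv.2 G hG, sub_zero,
    sub_eq_add_neg, ← Finset.sum_neg_distrib]
  congr 1
  refine Finset.sum_congr rfl fun T hT => ?_
  rw [← integral_neg, T.restrict_toSet_eq]
  refine integral_congr_ae ?_
  filter_upwards [ae_restrict_of_ae_restrict_of_subset (h.interior_subset T hT) hf] with p hp
  rw [hp]
  ring

/-! ### From element bounds to the energy norm -/

/-- Cauchy–Schwarz for the sum over elements separates the Sobolev part from the energy part;
diameters are then replaced by the mesh size. -/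
theorem sq_sum_elementError_le {h C S : ℝ} (hC : 0 ≤ C)
    (hh : ∀ T ∈ 𝒯, T.diam ≤ h) {v : WeakFunction} {E s : Rect → ℝ} (hs : ∀ T, 0 ≤ s T)
    (hS : ∑ T ∈ 𝒯, s T ≤ S)
    (hE : ∀ T ∈ 𝒯, E T ^ 2 ≤ C * s T * (T.diam ^ (2 * k + 2) * gradSq k T v +
      (T.diam ^ (2 * k - 1) + T.diam ^ (2 * k + 1)) * jumpSq T v)) :
    (∑ T ∈ 𝒯, E T) ^ 2 ≤ C * S * (h ^ (2 * k + 2) * (∑ T ∈ 𝒯, gradSq k T v) +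
      (h ^ (2 * k - 1) + h ^ (2 * k + 1)) * ∑ T ∈ 𝒯, jumpSq T v) := by
  have hX : ∀ T, 0 ≤ T.diam ^ (2 * k + 2) * gradSq k T v +
      (T.diam ^ (2 * k - 1) + T.diam ^ (2 * k + 1)) * jumpSq T v := by
    intro T
    have := T.diam_pos
    have := gradSq_nonneg k T v
    have := jumpSq_nonneg T v
    positivity
  refine (Finset.sum_sq_le_sum_mul_sum_of_sq_le_mul 𝒯 (fun T _ => mul_nonneg hC (hs T))
    (fun T _ => hX T) hE).trans ?_
  have hS0 : 0 ≤ ∑ T ∈ 𝒯, s T := Finset.sum_nonneg fun T _ => hs T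
  refine mul_le_mul ?_ ?_ (Finset.sum_nonneg fun T _ => hX T) (mul_nonneg hC (hS0.trans hS))
  · rw [← Finset.mul_sum]
    exact mul_le_mul_of_nonneg_left hS hC
  · rw [Finset.mul_sum, Finset.mul_sum, ← Finset.sum_add_distrib]
    refine Finset.sum_le_sum fun T hT => ?_
    have h0 := T.diam_pos.le
    have p : ∀ n : ℕ, T.diam ^ n ≤ h ^ n := fun n => pow_le_pow_left₀ h0 (hh T hT) n
    exact add_le_add (mul_le_mul_of_nonneg_right (p _) (gradSq_nonneg k T v))
      (mul_le_mul_of_nonneg_right (add_le_add (p _) (p _)) (jumpSq_nonneg T v))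

theorem rpow_le_mul_rpow {h D μ ν : ℝ} (hh : 0 < h) (hD : h ≤ D) (hμν : μ ≤ ν) :
    h ^ ν ≤ D ^ (ν - μ) * h ^ μ := by
  have : h ^ ν = h ^ (ν - μ) * h ^ μ := by rw [← Real.rpow_add hh]; ring_nf
  rw [this]
  exact mul_le_mul_of_nonneg_right (Real.rpow_le_rpow hh.le hD (sub_nonneg.2 hμν))
    (Real.rpow_nonneg hh.le _)

/-- From the squared estimate to the energy estimate. -/
theorem le_of_sq_le_energy {h D α C N A g j : ℝ} (hk : 1 ≤ k) (hh : 0 < h) (hD : h ≤ D)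
    (hC : 0 ≤ C) (hN : 0 ≤ N) (hg : 0 ≤ g) (hj : 0 ≤ j) (hA : A = g + h ^ (-α) * j)
    (hle : A ^ 2 ≤ C * N ^ 2 * (h ^ (2 * k + 2) * g + (h ^ (2 * k - 1) + h ^ (2 * k + 1)) * j)) :
    Real.sqrt A ≤ Real.sqrt (C * (D ^ (2 * ((k : ℝ) + 1) -
        2 * min ((k : ℝ) + 1) ((k : ℝ) + (α - 1) / 2)) + (1 + D ^ 2) *
        D ^ (2 * ((k : ℝ) + (α - 1) / 2) - 2 * min ((k : ℝ) + 1) ((k : ℝ) + (α - 1) / 2)))) *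
      h ^ min ((k : ℝ) + 1) ((k : ℝ) + (α - 1) / 2) * N := by
  set μ := min ((k : ℝ) + 1) ((k : ℝ) + (α - 1) / 2) with hμ
  set K₁ := D ^ (2 * ((k : ℝ) + 1) - 2 * μ)
  set K₂ := D ^ (2 * ((k : ℝ) + (α - 1) / 2) - 2 * μ)
  have hD0 : 0 < D := hh.trans_le hD
  have hα : 0 < h ^ (-α) := Real.rpow_pos_of_pos hh _
  have hα' : h ^ α * h ^ (-α) = 1 := by rw [← Real.rpow_add hh, add_neg_cancel, Real.rpow_zero]
  have hA0 : 0 ≤ A := by rw [hA]; positivity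
  have hgA : g ≤ A := by rw [hA]; linarith [mul_nonneg hα.le hj]
  -- The stabilizer pays for the jumps: its weight `h^{-α}` is what turns `h^{2k-1}` into the
  -- exponent `2 k - 1 + α = 2 (k + (α - 1) / 2)`.
  have hjA : j ≤ h ^ α * A := by
    have h1 : j = h ^ α * (h ^ (-α) * j) := by rw [← mul_assoc, hα', one_mul]
    rw [h1]
    refine mul_le_mul_of_nonneg_left ?_ (Real.rpow_nonneg hh.le _)
    rw [hA]; linarith
  have m1 : μ ≤ (k : ℝ) + 1 := min_le_left _ _
  have m2 : μ ≤ (k : ℝ) + (α - 1) / 2 := min_le_right _ _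
  have r1 : h ^ (2 * k + 2) ≤ K₁ * h ^ (2 * μ) := by
    have := rpow_le_mul_rpow hh hD (show 2 * μ ≤ 2 * ((k : ℝ) + 1) by linarith)
    rwa [show 2 * ((k : ℝ) + 1) = ((2 * k + 2 : ℕ) : ℝ) by push_cast; ring,
      Real.rpow_natCast, show ((2 * k + 2 : ℕ) : ℝ) = 2 * ((k : ℝ) + 1) by push_cast; ring] at this
  have r2 : h ^ (2 * k - 1) * h ^ α ≤ K₂ * h ^ (2 * μ) := by
    have := rpow_le_mul_rpow hh hD (show 2 * μ ≤ 2 * ((k : ℝ) + (α - 1) / 2) by linarith)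
    refine le_trans (le_of_eq ?_) this
    rw [← Real.rpow_natCast h (2 * k - 1), ← Real.rpow_add hh]
    congr 1
    rw [Nat.cast_sub (by omega)]
    push_cast
    ring
  have r3 : h ^ (2 * k + 1) = h ^ (2 * k - 1) * h ^ 2 := by
    rw [← pow_add]; congr 1; omega
  have r4 : h ^ 2 ≤ D ^ 2 := pow_le_pow_left₀ hh.le hD 2
  have b0 : 0 ≤ h ^ (2 * k - 1) := by positivity
  have bμ : 0 ≤ h ^ (2 * μ) := Real.rpow_nonneg hh.le _
  have bK1 : 0 ≤ K₁ := Real.rpow_nonneg hD0.le _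
  have bK2 : 0 ≤ K₂ := Real.rpow_nonneg hD0.le _
  have t1 : h ^ (2 * k + 2) * g ≤ K₁ * h ^ (2 * μ) * A :=
    mul_le_mul r1 hgA hg (mul_nonneg bK1 bμ)
  -- The higher power is `h²` times the lower one, and `h² ≤ D²`.
  have t2 : (h ^ (2 * k - 1) + h ^ (2 * k + 1)) * j ≤ (1 + D ^ 2) * K₂ * h ^ (2 * μ) * A := by
    calc (h ^ (2 * k - 1) + h ^ (2 * k + 1)) * j
        ≤ ((1 + D ^ 2) * h ^ (2 * k - 1)) * (h ^ α * A) := by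
          refine mul_le_mul ?_ hjA hj (by positivity)
          rw [r3]
          nlinarith
      _ = (1 + D ^ 2) * A * (h ^ (2 * k - 1) * h ^ α) := by ring
      _ ≤ (1 + D ^ 2) * A * (K₂ * h ^ (2 * μ)) :=
          mul_le_mul_of_nonneg_left r2 (by positivity)
      _ = _ := by ring
  -- The right side of the squared estimate contains one factor `A`, which is divided out.
  have main : A ≤ C * (K₁ + (1 + D ^ 2) * K₂) * h ^ (2 * μ) * N ^ 2 := by
    rcases hA0.eq_or_lt with h0 | h0
    · rw [← h0]; positivity
    · have : A ^ 2 ≤ (C * (K₁ + (1 + D ^ 2) * K₂) * h ^ (2 * μ) * N ^ 2) * A := by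
        refine hle.trans ?_
        have := mul_le_mul_of_nonneg_left (add_le_add t1 t2) (mul_nonneg hC (sq_nonneg N))
        refine this.trans (le_of_eq ?_)
        ring
      rw [sq] at this
      exact le_of_mul_le_mul_right this h0
  have e : h ^ (2 * μ) = (h ^ μ) ^ 2 := by
    rw [← Real.rpow_natCast, ← Real.rpow_mul hh.le]
    congr 1
    push_cast
    ring
  rw [e] at main
  refine (Real.sqrt_le_sqrt main).trans (le_of_eq ?_)
  rw [mul_assoc, ← mul_pow, Real.sqrt_mul (by positivity),
    Real.sqrt_sq (mul_nonneg (Real.rpow_nonneg hh.le _) hN), mul_assoc]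

end

end WG

end

/-! ### The convergence estimate -/

theorem theorem4p1 (Ω : Set (ℝ × ℝ)) (hΩ : WG.IsRectangularDomain Ω)
    (k : ℕ) (hk : 1 ≤ k) (α : ℝ) (hα : 1 ≤ α) (σ : ℝ) :
    ∃ C : ℝ, 0 < C ∧
      ∀ f u : ℝ × ℝ → ℝ,
        MeasureTheory.MemLp f 2 (MeasureTheory.volume.restrict Ω) →
        WG.IsWeakSolution Ω f u →
        WG.MemH Ω (k + 2) u →
        ∃ uc : ℝ × ℝ → ℝ,
          ContinuousOn uc (closure Ω) ∧
          uc =ᵐ[MeasureTheory.volume.restrict Ω] u ∧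
          ∀ 𝒯 : Finset WG.Rect, WG.IsMesh Ω 𝒯 → WG.ShapeRegular σ 𝒯 →
            ∀ uh : WG.WeakFunction, WG.IsWGSolution Ω 𝒯 k α f uh →
              WG.energyNorm 𝒯 k α (WG.Ih k uc - uh) ≤
                C * WG.meshSize 𝒯 ^ (min ((k : ℝ) + 1) ((k : ℝ) + (α - 1) / 2)) *
                  WG.sobolevNorm Ω (k + 2) u := by
  obtain ⟨F, hF, hΩF⟩ := hΩ
  have hO : IsOpen Ω := by
    rw [hΩF]; exact isOpen_biUnion fun R _ => R.isOpen_openSet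
  have hne : Ω.Nonempty := by
    obtain ⟨R, hR⟩ := hF
    obtain ⟨p, hp⟩ := R.openSet_nonempty
    refine ⟨p, ?_⟩
    rw [hΩF]
    exact Set.mem_biUnion (s := (F : Set WG.Rect)) (t := fun R => R.openSet) hR hp
  have hbd : Bornology.IsBounded Ω := by
    rw [hΩF, Bornology.isBounded_biUnion_finset]
    exact fun R _ => R.isCompact_toSet.isBounded.subset R.openSet_subset
  obtain ⟨C₀, hC₀, H⟩ := WG.exists_sq_elementError_weakD_le hk σ
  obtain ⟨D, hD1, hD⟩ := WG.IsMesh.exists_meshSize_le hne hbd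
  have hD0 : 0 < D := by linarith
  refine ⟨Real.sqrt (C₀ * (D ^ (2 * ((k : ℝ) + 1) -
        2 * min ((k : ℝ) + 1) ((k : ℝ) + (α - 1) / 2)) + (1 + D ^ 2) *
        D ^ (2 * ((k : ℝ) + (α - 1) / 2) - 2 * min ((k : ℝ) + 1) ((k : ℝ) + (α - 1) / 2)))),
    by positivity, fun f u hf hsol hu => ?_⟩
  have hb := WG.vanishesOnBoundary_weakD hO (by omega) hu hsol.1
  obtain ⟨w0, w1, w2⟩ := WG.hasReps_weakD (by omega) hu
  obtain ⟨uc, cuc, euc, hrep⟩ := WG.exists_continuous_rep hΩF w0 hb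
  refine ⟨uc, cuc, euc.trans (WG.weakD_ae_eq hO (WG.isWeakDeriv_zero_zero hu.1)),
    fun 𝒯 h𝒯 hσ uh huh => ?_⟩
  -- The gradient of `u` need not extend continuously to the closure of `Ω`. Representatives on each
  -- element suffice, since they only have to agree on edges inside `Ω`.
  have hex : ∀ T : WG.Rect, ∃ G : WG.VField, T ∈ 𝒯 →
      WG.IsRep (WG.weakD Ω 1 0 u) T G.1 ∧ WG.IsRep (WG.weakD Ω 0 1 u) T G.2 := by
    intro T
    by_cases hT : T ∈ 𝒯
    · obtain ⟨G₁, h1⟩ := w1 T (h𝒯.interior_subset T hT)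
      obtain ⟨G₂, h2⟩ := w2 T (h𝒯.interior_subset T hT)
      exact ⟨(G₁, G₂), fun _ => ⟨h1, h2⟩⟩
    · exact ⟨0, fun h => absurd h hT⟩
  choose G hG using hex
  have hv : WG.Ih k uc - uh ∈ WG.Vh0 Ω 𝒯 k :=
    Submodule.sub_mem _ (WG.Ih_mem_Vh0 hk hO h𝒯 hb hrep) huh.1
  have herr := WG.aS_error_eq hk hO h𝒯 (uc := uc) (hsol.ae_eq hO (by omega) hf hu) huh hv G
    (fun T hT T' hT' i j hij he t ht =>
      ⟨(hG T hT).1.eq_on_side hO w1 (hG T' hT').1 hij he ht,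
        (hG T hT).2.eq_on_side hO w2 (hG T' hT').2 hij he ht⟩)
  -- The error equation is used with `v` equal to the error itself, so the left side becomes the
  -- square of its energy.
  have hle := WG.sq_sum_elementError_le (k := k) (v := WG.Ih k uc - uh) hC₀.le
    (fun T hT => WG.IsMesh.diam_le_meshSize hT) (fun T => WG.sobolevSq_nonneg T (k + 2) _)
    (h𝒯.sum_sobolevSq_le hu) (fun T hT => H Ω u hu T (h𝒯.interior_subset T hT) (hσ T hT) _
      (hv.1.1 T hT) (WG.continuous_of_mem_Vh hv.1 hT).2 uc (G T).1 (G T).2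
      (hrep T (h𝒯.interior_subset T hT)).1 (hG T hT).1.1 (hG T hT).2.1
      (hrep T (h𝒯.interior_subset T hT)).2 (hG T hT).1.2 (hG T hT).2.2)
  rw [← herr] at hle
  exact WG.le_of_sq_le_energy hk (h𝒯.meshSize_pos hne) (hD 𝒯 h𝒯) hC₀.le (Real.sqrt_nonneg _)
    (Finset.sum_nonneg fun T _ => WG.gradSq_nonneg k T _)
    (Finset.sum_nonneg fun T _ => WG.jumpSq_nonneg T _) (WG.aS_self_eq α _) hle
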